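/- **Laakso spaces.** Let $j\ge 2$, $k\ge 1$ be integers, $j_i\in\{j,j+1\}$ for $i\ge1$, $d_N=\prod_{i=1}^N j_i$ and $L_N=\{i/d_N : 1\le i\le d_N-1\}$. Let $I=[0,1]$ and let $K\subset[0,1]$ be a Cantor set whose $n$-th level pieces split into two copies of themselves scaled by some $r_{n+1}\in(0,\tfrac12)$ and touching the two ends; write its points as sequences $w\in\{0,1\}^{\mathbb N}$. The Laakso space $L=I\times K^k/\!\sim$ is obtained by identifying, for $x\in L_n\setminus L_{n-1}$, the points $(x,w)$ and $(x,w')$ whenever, in each of the $k$ coordinates, $w$ and $w'$ differ at most in the $n$-th digit; $\iota:I\times K^k\to L$ is the quotient map. $L$ carries the quotient topology, the geodesic metric, and the image $\mu$ under $\iota$ of Lebesgue measure times the uniform Bernoulli measures. **The form.** A Borel function $g:L\to[0,\infty]$ is an upper gradient of a continuous $f$ if $|f(x)-f(y)|\le\int_\gamma g\,ds$ for every rectifiable path $\gamma$ from $x$ to $y$. A square integrable $p\ge0$ is a generalized upper gradient of $u\in L^2(L,\mu)$ if there are continuous $f_n$ with upper gradients $g_n$ such that $f_n\to u$ and $g_n\to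 p$ in $L^2$; it is the minimal one, $p=p_u$, if it is $\mu$-a.e. at most every other one. Let $\mathcal F_M$ be the set of $u\in L^2(L,\mu)$ that have a minimal generalized upper gradient $p_u\in L^2(L,\mu)$. **Invariance.** An $n$-cell is $S=\iota(B_S)$ with $B_S=[i/d_n,(i+1)/d_n]\times K_a$, where $0\le i<d_n$ and $K_a\subset K^k$ is the set of points whose $k$ coordinates start with prescribed words $a$ of length $n$; $\mathcal S_n$ is the set of the $m_L^n=2^{nk}d_n$ $n$-cells. The folding map $\varphi_S:L\to S$ folds the $I$-coordinate, $x\mapsto \frac{i}{d_n}+\frac1{d_n}\overline\varphi_0(d_nx-i)$ with $\overline\varphi_0$ the $2$-periodic function equal to $|t|$ on $[-1,1]$, and replaces the first $n$ digits of each Cantor coordinate by those of $a$. Put $R_Sf=f|_S$ and $U_Sg=g\circ\varphi_S$. For a Dirichlet form $(\mathcal E,\mathcal F)$ put $\mathcal F^S=\{g:S\to\mathbb R : U_Sg\in\mathcal F\}$ and $\mathcal E^S(g,g)=\frac1{m_L^n}\mathcal E(U_Sg,U_Sg)$. The form is $L$-invariant if for all $n\ge0$: (1) $R_Sf\in\mathcal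 F^S$ for all $S\in\mathcal S_n$, $f\in\mathcal F$; (2) if $S_1,S_2\in\mathcal S_n$ and $\Phi$ is an isometry of $\mathbb R^{1+k}$ with $\Phi(B_{S_1})\subseteq B_{S_2}$ such that $\tilde\Phi=\iota\circ\Phi\circ\iota^{-1}$ maps $S_1$ onto $S_2$, then $f\circ\tilde\Phi\in\mathcal F^{S_1}$ and $\mathcal E^{S_1}(f\circ\tilde\Phi,f\circ\tilde\Phi)=\mathcal E^{S_2}(f,f)$ for all $f\in\mathcal F^{S_2}$; (3) $\mathcal E(f,f)=\sum_{S\in\mathcal S_n}\mathcal E^S(R_Sf,R_Sf)$ for all $f\in\mathcal F$. Let $\mathfrak C$ be the family of all $L$-invariant, non-zero, local, regular, conservative Dirichlet forms on $L^2(L,\mu)$, where local means $\mathcal E(u,v)=0$ for $u,v\in\mathcal F$ with disjoint compact supports, regular means that the continuous functions in $\mathcal F$ are dense both in $\mathcal F$ (for $\mathcal E(u,u)+\|u\|_2^2$) and, uniformly, in $C(L)$, and conservative means that the associated semigroup satisfies $T_t1=1$ for all $t>0$. **Lemma.** There is a Dirichlet form $(\mathcal E_M,\mathcal F_M)$ with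 domain $\mathcal F_M$ and $$\mathcal E_M(u,u)=\int_L p_u^2\,d\mu\qquad(u\in\mathcal F_M),$$ and $(\mathcal E_M,\mathcal F_M)\in\mathfrak C$; in particular $\mathfrak C\neq\emptyset$. Moreover, if a continuous function $f$ has a square integrable upper gradient $p$ that is $\mu$-a.e. at most every other upper gradient of $f$, then $p$ is the minimal generalized upper gradient $p_f$ above. -/

import Mathlib

open MeasureTheory Set Filter Topology
open scoped ENNReal NNReal unitInterval

/-! ### Dirichlet forms -/

section DirichletForms

variable {X : Type*} [MeasurableSpace X]

/-- A Dirichlet form on real `L²(X, μ)`: a densely defined, symmetric, nonnegative, closed bilinear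
form on which the unit contraction `u ↦ (0 ∨ u) ∧ 1` operates. -/
structure DirichletForm (μ : Measure X) where
  domain : Submodule ℝ (Lp ℝ 2 μ)
  form : domain →ₗ[ℝ] domain →ₗ[ℝ] ℝ
  dense : Dense (domain : Set (Lp ℝ 2 μ))
  symm : ∀ u v, form u v = form v u
  nonneg : ∀ u, 0 ≤ form u u
  closed : ∀ u : ℕ → domain,
    (∀ ε > 0, ∃ N, ∀ m ≥ N, ∀ n ≥ N,
      form (u m - u n) (u m - u n) + ‖u m - u n‖ ^ 2 < ε) →
    ∃ v : domain,
      Tendsto (fun n => form (u n - v) (u n - v) + ‖u n - v‖ ^ 2) atTop (𝓝 0)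
  markov : ∀ (u : domain) (v : Lp ℝ 2 μ),
    (v =ᵐ[μ] fun x => max 0 (min ((u : Lp ℝ 2 μ) x) 1)) →
    ∃ hv : v ∈ domain, form ⟨v, hv⟩ ⟨v, hv⟩ ≤ form u u

namespace DirichletForm

variable {μ : Measure X} (E : DirichletForm μ)

/-- The function `f` is (a representative of) an element of the domain. -/
def Mem (f : X → ℝ) : Prop := ∃ hf : MemLp f 2 μ, hf.toLp f ∈ E.domain

open Classical in
/-- The energy `E(f, f)` of a function `f` in the domain (and `0` for other functions). -/
noncomputable def energy (f : X → ℝ) : ℝ :=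
  if h : E.Mem f then E.form ⟨_, h.choose_spec⟩ ⟨_, h.choose_spec⟩ else 0

/-- The form is not identically zero. -/
def IsNonzero : Prop := ∃ u v, E.form u v ≠ 0

/-- The graph of the generator `A` of the form: `u ∈ Dom A` and `A u = w` iff `u` lies in the
domain of the form and `E(u, v) = -⟨w, v⟩` for all `v` in the domain of the form. -/
def IsGenerator (u w : Lp ℝ 2 μ) : Prop :=
  ∃ hu : u ∈ E.domain, ∀ v : E.domain, E.form ⟨u, hu⟩ v = - inner ℝ w (v : Lp ℝ 2 μ)

/-- `T` is the semigroup associated with the form: a strongly continuous semigroup on `L²` whose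
strong derivative at zero is the generator of the form. -/
structure IsSemigroup (T : ℝ≥0 → Lp ℝ 2 μ →L[ℝ] Lp ℝ 2 μ) : Prop where
  zero : T 0 = ContinuousLinearMap.id ℝ _
  add : ∀ s t, T (s + t) = (T s).comp (T t)
  continuous : ∀ u, Tendsto (fun t => T t u) (𝓝 0) (𝓝 u)
  generator : ∀ u w,
    Tendsto (fun t : ℝ≥0 => (t : ℝ)⁻¹ • (T t u - u)) (𝓝[>] 0) (𝓝 w) ↔ E.IsGenerator u w

/-- Conservativity: the associated semigroup satisfies `T_t 1 = 1` for all `t > 0`. -/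
def IsConservative [IsFiniteMeasure μ] : Prop :=
  ∃ T, E.IsSemigroup T ∧ ∀ t > 0, T t (Lp.const 2 μ (1 : ℝ)) = Lp.const 2 μ (1 : ℝ)

variable [TopologicalSpace X]

/-- Regularity: the continuous functions with compact support that belong to the domain are dense
in the domain (for `E(u, u) + ‖u‖²`) and dense, for the uniform norm, among all continuous
functions with compact support. -/
structure IsRegular : Prop where
  dense_domain : ∀ u : E.domain, ∀ ε > 0, ∃ v : E.domain,
    (∃ g : X → ℝ, Continuous g ∧ HasCompactSupport g ∧ (v : Lp ℝ 2 μ) =ᵐ[μ] g) ∧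
    E.form (u - v) (u - v) + ‖u - v‖ ^ 2 < ε
  dense_continuous : ∀ g : X → ℝ, Continuous g → HasCompactSupport g → ∀ ε > 0,
    ∃ h : X → ℝ, Continuous h ∧ HasCompactSupport h ∧ E.Mem h ∧ ∀ x, |g x - h x| < ε

/-- The support of (the class of) a function: the complement of the largest open set on which it
vanishes almost everywhere. -/
def aeSupport (μ : Measure X) (f : X → ℝ) : Set X :=
  {x | ∀ U ∈ 𝓝 x, ¬ (∀ᵐ y ∂μ, y ∈ U → f y = 0)}

/-- Locality: `E(u, v) = 0` whenever `u` and `v` have disjoint compact supports. -/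
def IsLocal : Prop :=
  ∀ u v : E.domain, IsCompact (aeSupport μ (u : Lp ℝ 2 μ)) →
    IsCompact (aeSupport μ (v : Lp ℝ 2 μ)) →
    Disjoint (aeSupport μ (u : Lp ℝ 2 μ)) (aeSupport μ (v : Lp ℝ 2 μ)) → E.form u v = 0

end DirichletForm

end DirichletForms

/-! ### Laakso spaces -/

/-- The data of a Laakso space: an integer `j ≥ 2`, a sequence `j₁, j₂, … ∈ {j, j + 1}`
(`js i` is `j_{i+1}`), the number `k ≥ 1` of Cantor factors, and the contraction ratios `r` of the
Cantor set `K ⊆ ℝ` (the two parts of a level `i` piece are copies of it scaled by `r i`).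
The ratios enter only when `I × K^k` is regarded as a subset of `ℝ^{1+k}`. -/
structure LaaksoData where
  j : ℕ
  two_le_j : 2 ≤ j
  js : ℕ → ℕ
  js_mem : ∀ i, js i = j ∨ js i = j + 1
  k : ℕ
  one_le_k : 1 ≤ k
  r : ℕ → ℝ
  r_pos : ∀ i, 0 < r i
  r_lt : ∀ i, r i < 1 / 2

namespace LaaksoData

variable (D : LaaksoData)

/-- `d_N = j₁ ⋯ j_N`. -/
def d (N : ℕ) : ℕ := ∏ i ∈ Finset.range N, D.js i

/-- The wormhole heights `L_N = {i / d_N : 1 ≤ i ≤ d_N - 1}` of depth at most `N`. -/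
def wormholes (N : ℕ) : Set ℝ := {x | ∃ i : ℕ, 1 ≤ i ∧ i < D.d N ∧ x = (i : ℝ) / D.d N}

/-- `I × K^k`, the elements of the Cantor set `K` being written as binary sequences (the entry with
index `m` is the digit number `m + 1`). -/
abbrev Pre : Type := I × (Fin D.k → ℕ → Bool)

/-- `(x, w)` and `(x, w')` are identified if `x ∈ L_{n+1} \ L_n` and each coordinate of `w'` arises
from that of `w` by possibly switching the digit number `n + 1`. -/
def Rel (p q : D.Pre) : Prop :=
  p = q ∨ p.1 = q.1 ∧ ∃ n, (p.1 : ℝ) ∈ D.wormholes (n + 1) \ D.wormholes n ∧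
    ∀ c m, m ≠ n → p.2 c m = q.2 c m

lemma js_pos (i : ℕ) : 0 < D.js i := by
  have := D.two_le_j
  rcases D.js_mem i with h | h <;> omega

lemma d_pos (N : ℕ) : 0 < D.d N := Finset.prod_pos fun i _ => D.js_pos i

lemma d_dvd {m n : ℕ} (h : m ≤ n) : D.d m ∣ D.d n :=
  Finset.prod_dvd_prod_of_subset _ _ _ (Finset.range_mono h)

lemma mem_wormholes {N : ℕ} {x : ℝ} :
    x ∈ D.wormholes N ↔ 0 < x ∧ x < 1 ∧ ∃ z : ℤ, x * D.d N = z := by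
  have hd : (0 : ℝ) < D.d N := by exact_mod_cast D.d_pos N
  constructor
  · rintro ⟨i, hi, hi', rfl⟩
    refine ⟨by positivity, ?_, i, by field_simp; simp⟩
    rw [div_lt_one hd]
    exact_mod_cast hi'
  · rintro ⟨h0, h1, z, hz⟩
    have hz0 : (0 : ℝ) < z := by rw [← hz]; positivity
    have hz1 : (z : ℝ) < D.d N := by rw [← hz]; nlinarith
    have hz0' : 0 < z := by exact_mod_cast hz0
    have hz1' : z < D.d N := by exact_mod_cast hz1
    lift z to ℕ using hz0'.le
    refine ⟨z, by omega, by omega, ?_⟩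
    rw [eq_div_iff hd.ne', hz]
    simp

lemma wormholes_mono {m n : ℕ} (h : m ≤ n) : D.wormholes m ⊆ D.wormholes n := by
  intro x hx
  rw [mem_wormholes] at hx ⊢
  obtain ⟨h0, h1, z, hz⟩ := hx
  obtain ⟨c, hc⟩ := D.d_dvd h
  refine ⟨h0, h1, z * c, ?_⟩
  rw [hc]
  push_cast
  rw [← mul_assoc, hz]

lemma level_unique {x : ℝ} {m n : ℕ} (hm : x ∈ D.wormholes (m + 1) \ D.wormholes m)
    (hn : x ∈ D.wormholes (n + 1) \ D.wormholes n) : m = n := by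
  rcases lt_trichotomy m n with h | h | h
  · exact absurd (D.wormholes_mono h hm.1) hn.2
  · exact h
  · exact absurd (D.wormholes_mono h hn.1) hm.2

lemma rel_equivalence : Equivalence D.Rel where
  refl p := Or.inl rfl
  symm := by
    rintro p q (rfl | ⟨h, n, hn, hw⟩)
    · exact Or.inl rfl
    · exact Or.inr ⟨h.symm, n, h ▸ hn, fun c m hm => (hw c m hm).symm⟩
  trans := by
    rintro p q s (rfl | ⟨h, n, hn, hw⟩) h2
    · exact h2
    · rcases h2 with rfl | ⟨h', n', hn', hw'⟩
      · exact Or.inr ⟨h, n, hn, hw⟩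
      · obtain rfl : n = n' := D.level_unique hn (h ▸ hn')
        exact Or.inr ⟨h.trans h', n, hn, fun c m hm => (hw c m hm).trans (hw' c m hm)⟩

instance setoid : Setoid D.Pre := ⟨D.Rel, D.rel_equivalence⟩

/-- The Laakso space `L = I × K^k / ∼`, with the quotient topology. -/
def Space : Type := Quotient D.setoid

instance : TopologicalSpace D.Space := inferInstanceAs (TopologicalSpace (Quotient D.setoid))

instance : MeasurableSpace D.Space := borel D.Space

instance : BorelSpace D.Space := ⟨rfl⟩

/-- The wormhole map `ι : I × K^k → L`. -/
def wormholeMap : D.Pre → D.Space := Quotient.mk D.setoid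

/-- The uniform Bernoulli measure on the Cantor set. -/
noncomputable def bernoulli : Measure (ℕ → Bool) :=
  Measure.infinitePi fun _ => (PMF.uniformOfFintype Bool).toMeasure

instance : IsProbabilityMeasure bernoulli := by
  unfold bernoulli; infer_instance

/-- The measure on `L` inherited from Lebesgue measure on `I` and the Bernoulli measures. -/
noncomputable def μ : Measure D.Space :=
  Measure.map D.wormholeMap
    ((volume : Measure I).prod (Measure.pi fun _ : Fin D.k => bernoulli))

instance : IsFiniteMeasure D.μ := by
  unfold μ; infer_instance

/-- The `I`-coordinate of a point of `L`. -/
def height : D.Space → ℝ :=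
  Quotient.lift (fun p : D.Pre => (p.1 : ℝ)) (by
    rintro p q (rfl | ⟨h, -⟩)
    · rfl
    · simp [h])

/-- The geodesic metric of `L`: the distance of two points is the infimum of the lengths of the
paths joining them, the length of a path being the total variation of its `I`-coordinate. -/
noncomputable abbrev geodesicMetric : PseudoEMetricSpace D.Space where
  edist p q := ⨅ γ : Path p q, eVariationOn (fun t : I => D.height (γ t)) univ
  edist_self p := by
    refine le_antisymm (iInf_le_of_le (Path.refl p) ?_) bot_le
    exact (eVariationOn.constant_on (by
      rintro _ ⟨a, -, rfl⟩ _ ⟨b, -, rfl⟩; simp)).le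
  edist_comm := by
    have key : ∀ p q : D.Space,
        (⨅ γ : Path p q, eVariationOn (fun t : I => D.height (γ t)) univ) ≤
          ⨅ γ : Path q p, eVariationOn (fun t : I => D.height (γ t)) univ := by
      intro p q
      refine le_iInf fun γ => iInf_le_of_le γ.symm ?_
      exact eVariationOn.comp_le_of_antitoneOn (fun t : I => D.height (γ t)) (t := univ)
        unitInterval.symm (fun a _ b _ h => unitInterval.symm_le_symm.2 h)
        (fun _ _ => mem_univ _)
    exact fun p q => le_antisymm (key p q) (key q p)
  edist_triangle p q s := by
    simp only [ENNReal.iInf_add, ENNReal.add_iInf]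
    refine le_iInf fun δ => le_iInf fun γ => iInf_le_of_le (γ.trans δ) ?_
    let h : I := ⟨1 / 2, by norm_num, by norm_num⟩
    have hu : (univ : Set I) = Iic h ∪ Ici h := Iic_union_Ici.symm
    rw [hu, eVariationOn.union _ (x := h) isGreatest_Iic isLeast_Ici]
    refine add_le_add ?_ ?_
    · let φ : I → I := fun t => Set.projIcc 0 1 zero_le_one (2 * (t : ℝ))
      have e : EqOn (fun t : I => D.height ((γ.trans δ) t))
          ((fun t : I => D.height (γ t)) ∘ φ) (Iic h) := by
        intro t ht
        have ht' : (t : ℝ) ≤ 1 / 2 := ht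
        simp only [Path.trans_apply, Function.comp, φ]
        rw [dif_pos ht']
        congr 2
        rw [Set.projIcc_of_mem]
      rw [eVariationOn.congr e]
      refine eVariationOn.comp_le_of_monotoneOn _ φ ?_
        (fun _ _ => hu ▸ mem_univ _)
      intro a _ b _ hab
      have hab' : (a : ℝ) ≤ b := hab
      exact Set.monotone_projIcc _ (by linarith)
    · let φ : I → I := fun t => Set.projIcc 0 1 zero_le_one (2 * (t : ℝ) - 1)
      have e : EqOn (fun t : I => D.height ((γ.trans δ) t))
          ((fun t : I => D.height (δ t)) ∘ φ) (Ici h) := by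
        intro t ht
        have ht' : (1 / 2 : ℝ) ≤ t := ht
        simp only [Path.trans_apply, Function.comp, φ]
        split_ifs with h'
        · have : (t : ℝ) = 1 / 2 := le_antisymm h' ht'
          have h1 : Set.projIcc (0 : ℝ) 1 zero_le_one (2 * (t : ℝ) - 1) = 0 := by
            apply Set.projIcc_of_le_left; linarith
          have h2 : (⟨2 * (t : ℝ), (unitInterval.mul_pos_mem_iff zero_lt_two).2 ⟨t.2.1, h'⟩⟩ : I)
              = 1 := by
            ext; simp [this]
          rw [h1, h2]; simp
        · congr 2
          rw [Set.projIcc_of_mem]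
      rw [eVariationOn.congr e]
      refine eVariationOn.comp_le_of_monotoneOn _ φ ?_
        (fun _ _ => hu ▸ mem_univ _)
      intro a _ b _ hab
      have hab' : (a : ℝ) ≤ b := hab
      exact Set.monotone_projIcc _ (by linarith)

/-! ### Upper gradients and the form they define -/

/-- The length of a path `γ : [0, 1] → L`. -/
noncomputable def pathLength (γ : ℝ → D.Space) : ℝ≥0∞ :=
  letI := D.geodesicMetric
  eVariationOn γ (Icc 0 1)

/-- The integral of `g` along a rectifiable path `γ : [0, 1] → L`, with respect to arc length. -/
noncomputable def pathIntegral (γ : ℝ → D.Space) (g : D.Space → ℝ≥0∞) : ℝ≥0∞ :=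
  letI := D.geodesicMetric
  ∫⁻ s in Icc 0 (D.pathLength γ).toReal, g (naturalParameterization γ (Icc 0 1) 0 s)

/-- `g` is an upper gradient of `f`: for every rectifiable path, the values of `f` at the end points
differ by at most the integral of `g` along the path. -/
structure IsUpperGradient (f : D.Space → ℝ) (g : D.Space → ℝ≥0∞) : Prop where
  measurable : Measurable g
  le_integral : ∀ γ : ℝ → D.Space, ContinuousOn γ (Icc 0 1) → D.pathLength γ ≠ ∞ →
    ENNReal.ofReal |f (γ 0) - f (γ 1)| ≤ D.pathIntegral γ g

/-- An upper gradient that is almost everywhere at most every other upper gradient. -/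
def IsMinimalUpperGradient (f : D.Space → ℝ) (p : D.Space → ℝ≥0∞) : Prop :=
  D.IsUpperGradient f p ∧ ∀ q, D.IsUpperGradient f q → p ≤ᵐ[D.μ] q

/-- `p` is a (square integrable) generalized upper gradient of `u ∈ L²`: there are continuous
functions `f n` with upper gradients `g n` such that `f n → u` and `g n → p` in `L²`
(`(g - p) + (p - g)` is `|g - p|`, as subtraction in `[0, ∞]` is truncated). -/
def IsGeneralizedUpperGradient (u : Lp ℝ 2 D.μ) (p : D.Space → ℝ≥0∞) : Prop :=
  Measurable p ∧ ∫⁻ x, p x ^ 2 ∂D.μ ≠ ∞ ∧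
  ∃ (f : ℕ → D.Space → ℝ) (g : ℕ → D.Space → ℝ≥0∞),
    (∀ n, Continuous (f n) ∧ D.IsUpperGradient (f n) (g n)) ∧
    Tendsto (fun n => ∫⁻ x, ENNReal.ofReal |f n x - u x| ^ 2 ∂D.μ) atTop (𝓝 0) ∧
    Tendsto (fun n => ∫⁻ x, ((g n x - p x) + (p x - g n x)) ^ 2 ∂D.μ) atTop (𝓝 0)

/-- `p` is a minimal generalized upper gradient of `u ∈ L²`. -/
def IsMGUG (u : Lp ℝ 2 D.μ) (p : D.Space → ℝ≥0∞) : Prop :=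
  D.IsGeneralizedUpperGradient u p ∧
    ∀ q, D.IsGeneralizedUpperGradient u q → p ≤ᵐ[D.μ] q

/-- `E` is the form `(E_M, F_M)`: its domain consists of the `u ∈ L²` that have a square integrable
minimal generalized upper gradient `p_u`, and `E(u, u) = ∫ p_u² dμ`. -/
structure IsMGUGForm (E : DirichletForm D.μ) : Prop where
  mem_domain : ∀ u, u ∈ E.domain ↔ ∃ p, D.IsMGUG u p
  form_self : ∀ (u : E.domain) (p : D.Space → ℝ≥0∞), D.IsMGUG u p →
    ENNReal.ofReal (E.form u u) = ∫⁻ x, p x ^ 2 ∂D.μ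

/-! ### Cells, folding maps, invariance -/

/-- The `n`-cells, indexed by an interval `[i / d_n, (i + 1) / d_n]` and `k` binary words of
length `n`. -/
abbrev Cell (n : ℕ) : Type := Fin (D.d n) × (Fin D.k → Fin n → Bool)

variable {D} {n : ℕ}

/-- The set `[i / d_n, (i + 1) / d_n] × K_a ⊆ I × K^k` belonging to a cell. -/
def block (S : D.Cell n) : Set D.Pre :=
  {p | ((S.1 : ℕ) : ℝ) / D.d n ≤ p.1 ∧ (p.1 : ℝ) ≤ ((S.1 : ℕ) + 1 : ℝ) / D.d n ∧
    ∀ c (m : Fin n), p.2 c m = S.2 c m}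

/-- The cell as a subset of `L`. -/
def carrier (S : D.Cell n) : Set D.Space := D.wormholeMap '' block S

/-- The 2-periodic triangle wave that equals `|t|` on `[-1, 1]`. -/
noncomputable def triangle (t : ℝ) : ℝ := |t - 2 * round (t / 2)|

lemma triangle_le (t : ℝ) : triangle t ≤ 1 := by
  have h := abs_sub_round (t / 2)
  have e : t - 2 * round (t / 2) = 2 * (t / 2 - round (t / 2)) := by ring
  rw [triangle, e, abs_mul, abs_two]
  linarith

/-- The folding of the interval `[0, 1]` onto `[x_i, x_{i+1}]`, as a real-valued function. -/
noncomputable def foldReal (S : D.Cell n) (x : ℝ) : ℝ :=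
  ((S.1 : ℕ) : ℝ) / D.d n + triangle (D.d n * (x - ((S.1 : ℕ) : ℝ) / D.d n)) / D.d n

lemma foldReal_ge (S : D.Cell n) (x : ℝ) : ((S.1 : ℕ) : ℝ) / D.d n ≤ foldReal S x :=
  le_add_of_nonneg_right (div_nonneg (abs_nonneg _) (Nat.cast_nonneg _))

lemma foldReal_le (S : D.Cell n) (x : ℝ) : foldReal S x ≤ ((S.1 : ℕ) + 1 : ℝ) / D.d n := by
  rw [foldReal, ← add_div]
  exact div_le_div_of_nonneg_right (by linarith [triangle_le (D.d n * (x - ((S.1 : ℕ) : ℝ) / D.d n))])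
    (Nat.cast_nonneg _)

lemma foldReal_mem (S : D.Cell n) (x : ℝ) : foldReal S x ∈ Icc (0 : ℝ) 1 := by
  refine ⟨le_trans (by positivity) (foldReal_ge S x), (foldReal_le S x).trans ?_⟩
  have hd : (0 : ℝ) < D.d n := by exact_mod_cast D.d_pos n
  rw [div_le_one hd]
  exact_mod_cast S.1.2

/-- The folding of `I × K^k` onto a block: fold the interval, and replace the first `n` digits of
each Cantor coordinate by those of the cell. -/
noncomputable def foldPre (S : D.Cell n) (p : D.Pre) : D.Pre :=
  (⟨foldReal S p.1, foldReal_mem S p.1⟩,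
    fun c m => if h : m < n then S.2 c ⟨m, h⟩ else p.2 c m)

lemma foldPre_mem (S : D.Cell n) (p : D.Pre) : foldPre S p ∈ block S :=
  ⟨foldReal_ge S p.1, foldReal_le S p.1, fun c m => by simp [foldPre]⟩

lemma foldReal_eq (S : D.Cell n) (x : ℝ) :
    ∃ z : ℤ, foldReal S x * D.d n = z + x * D.d n ∨ foldReal S x * D.d n = z - x * D.d n := by
  have hd : (0 : ℝ) < D.d n := by exact_mod_cast D.d_pos n
  set t : ℝ := D.d n * (x - ((S.1 : ℕ) : ℝ) / D.d n) with ht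
  have ht' : t = x * D.d n - (S.1 : ℕ) := by rw [ht]; field_simp
  have e : foldReal S x * D.d n = (S.1 : ℕ) + triangle t := by
    rw [foldReal, ← ht]; field_simp
  rcases abs_choice (t - 2 * round (t / 2)) with h | h
  · refine ⟨-(2 * round (t / 2)), Or.inl ?_⟩
    rw [e, triangle, h, ht']; push_cast; ring
  · refine ⟨2 * (S.1 : ℕ) + 2 * round (t / 2), Or.inr ?_⟩
    rw [e, triangle, h, ht']; push_cast; ring

lemma foldReal_int (S : D.Cell n) (x : ℝ) {N : ℕ} (hN : n ≤ N) :
    (∃ z : ℤ, foldReal S x * D.d N = z) ↔ ∃ z : ℤ, x * D.d N = z := by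
  obtain ⟨c, hc⟩ := D.d_dvd hN
  rw [hc]
  push_cast
  obtain ⟨z, h | h⟩ := foldReal_eq S x
  · rw [← mul_assoc, h, ← mul_assoc, add_mul]
    constructor
    · rintro ⟨y, hy⟩
      exact ⟨y - z * c, by push_cast; linarith⟩
    · rintro ⟨y, hy⟩
      exact ⟨y + z * c, by push_cast; linarith⟩
  · rw [← mul_assoc, h, ← mul_assoc, sub_mul]
    constructor
    · rintro ⟨y, hy⟩
      exact ⟨z * c - y, by push_cast; linarith⟩
    · rintro ⟨y, hy⟩
      exact ⟨z * c - y, by push_cast; linarith⟩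

lemma foldReal_wormholes (S : D.Cell n) {x : ℝ} {m : ℕ} (hm : n ≤ m)
    (hx : x ∈ D.wormholes (m + 1) \ D.wormholes m) :
    foldReal S x ∈ D.wormholes (m + 1) \ D.wormholes m := by
  obtain ⟨h1, h2⟩ := hx
  rw [mem_wormholes] at h1 h2
  obtain ⟨h0, h1, hz⟩ := h1
  have hno : ¬ ∃ z : ℤ, x * D.d m = z := fun h => h2 ⟨h0, h1, h⟩
  have hno' : ¬ ∃ z : ℤ, foldReal S x * D.d m = z := fun h => hno ((foldReal_int S x hm).1 h)
  have hI := foldReal_mem S x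
  refine ⟨?_, fun h => hno' (D.mem_wormholes.1 h).2.2⟩
  rw [mem_wormholes]
  refine ⟨lt_of_le_of_ne hI.1 fun h => hno' ⟨0, by rw [← h]; simp⟩,
    lt_of_le_of_ne hI.2 fun h => hno' ⟨D.d m, by rw [h]; simp⟩,
    (foldReal_int S x (by omega)).2 hz⟩

lemma foldPre_rel (S : D.Cell n) {p q : D.Pre} (h : D.Rel p q) :
    D.Rel (foldPre S p) (foldPre S q) := by
  rcases h with rfl | ⟨h, m, hm, hw⟩
  · exact Or.inl rfl
  · rcases lt_or_ge m n with hmn | hmn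
    · left
      refine Prod.ext (by simp [foldPre, h]) ?_
      funext c l
      by_cases hl : l < n
      · simp [foldPre, hl]
      · simp [foldPre, hl, hw c l (by omega)]
    · right
      refine ⟨by simp [foldPre, h], m, foldReal_wormholes S hmn hm, fun c l hl => ?_⟩
      by_cases hl' : l < n
      · simp [foldPre, hl']
      · simp [foldPre, hl', hw c l hl]

/-- The folding map `φ_S : L → S`. -/
noncomputable def fold (S : D.Cell n) : D.Space → carrier S :=
  Quotient.lift
    (fun p : D.Pre => (⟨D.wormholeMap (foldPre S p), foldPre S p, foldPre_mem S p, rfl⟩ : carrier S))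
    (fun _ _ h => Subtype.ext (Quotient.sound (foldPre_rel S h)))

/-- The restriction `R_S f`. -/
def restr (S : D.Cell n) (f : D.Space → ℝ) : carrier S → ℝ := fun x => f x

/-- The unfolding `U_S g = g ∘ φ_S`. -/
noncomputable def unfold (S : D.Cell n) (g : carrier S → ℝ) : D.Space → ℝ := g ∘ fold S

/-- `g` belongs to the domain `F^S`, i.e. `U_S g` belongs to the domain of `E`. -/
def MemCell (E : DirichletForm D.μ) (S : D.Cell n) (g : carrier S → ℝ) : Prop :=
  E.Mem (unfold S g)

/-- `E^S(g, g) = E(U_S g, U_S g) / m_L^n`, where `m_L^n` is the number of `n`-cells. -/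
noncomputable def energyCell (E : DirichletForm D.μ) (S : D.Cell n) (g : carrier S → ℝ) : ℝ :=
  1 / (Fintype.card (D.Cell n) : ℝ) * E.energy (unfold S g)

variable (D)

/-- The point of the Cantor set `K ⊆ [0, 1]` with a given sequence of digits. -/
noncomputable def cantorPoint (w : ℕ → Bool) : ℝ :=
  ∑' n, if w n then (1 - D.r n) * ∏ l ∈ Finset.range n, D.r l else 0

/-- The inclusion of `I × K^k` in Euclidean space `ℝ^{1+k}`. -/
noncomputable def embed (p : D.Pre) : EuclideanSpace ℝ (Fin (D.k + 1)) :=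
  WithLp.toLp 2 (Fin.cons (p.1 : ℝ) fun c => D.cantorPoint (p.2 c))

variable {D}

/-- The map `Ψ` from the cell `S₁` to the cell `S₂` is `ι ∘ Φ ∘ ι⁻¹`. -/
def IsInducedBy (S₁ S₂ : D.Cell n)
    (Φ : EuclideanSpace ℝ (Fin (D.k + 1)) → EuclideanSpace ℝ (Fin (D.k + 1)))
    (Ψ : carrier S₁ → carrier S₂) : Prop :=
  ∀ p (hp : p ∈ block S₁), ∃ q ∈ block S₂, D.embed q = Φ (D.embed p) ∧
    (Ψ ⟨D.wormholeMap p, p, hp, rfl⟩ : D.Space) = D.wormholeMap q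

/-- `L`-invariance: invariance with respect to all the local symmetries of `L`. -/
structure IsInvariant (E : DirichletForm D.μ) : Prop where
  unfold_restr : ∀ (n : ℕ) (S : D.Cell n) (f : D.Space → ℝ), E.Mem f → MemCell E S (restr S f)
  isometry : ∀ (n : ℕ) (S₁ S₂ : D.Cell n)
    (Φ : EuclideanSpace ℝ (Fin (D.k + 1)) → EuclideanSpace ℝ (Fin (D.k + 1)))
    (Ψ : carrier S₁ → carrier S₂), Isometry Φ → IsInducedBy S₁ S₂ Φ Ψ →
    Function.Surjective Ψ → ∀ f : carrier S₂ → ℝ, MemCell E S₂ f →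
      MemCell E S₁ (f ∘ Ψ) ∧ energyCell E S₁ (f ∘ Ψ) = energyCell E S₂ f
  energy_sum : ∀ (n : ℕ) (f : D.Space → ℝ), E.Mem f →
    E.energy f = ∑ S : D.Cell n, energyCell E S (restr S f)

variable (D)

/-- The family of all `L`-invariant, non-zero, local, regular, conservative Dirichlet forms. -/
def invariantForms : Set (DirichletForm D.μ) :=
  {E | IsInvariant E ∧ E.IsNonzero ∧ E.IsLocal ∧ E.IsRegular ∧ E.IsConservative}

end LaaksoData

/-! A function that is affine in the height on every cell of some level has a locally constant
slope. Let ∂ be the closure in L² × L² of this slope operator (its graph is `slopeGraph`).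
Everything rests on the identity p_u = |∂u| (`isMGUG_iff`), which exhibits E_M as the quadratic form
of the bilinear form ∫ ∂u ∂v dμ.

The operator ∂ is single-valued (`slopeGraph_eq_zero`): integration by parts along vertical lines
gives ∫ f ∂φ + φ ∂f = 0 for piecewise affine φ vanishing at the heights 0 and 1, and only 0 is
orthogonal to all such φ (`eq_zero_of_forall_integral_eq_zero`).

|∂u| is a generalized upper gradient, because the modulus of the slope of a piecewise affine
function is, up to a null set, an upper gradient (`IsPiecewiseAffine.isUpperGradient`): the length
of a path is the variation of its height, so along the arc length parametrization the function
changes at most at the rate |slope|.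

It is the smallest one. Let f be continuous with a square integrable upper gradient g. Interpolate f
between its fibre averages at the heights i / d_n. The slopes are bounded by the cell averages of g,
whose excess over g tends to 0 in L². By Mazur's argument (`exists_convexHull_tail_tendsto`) convex
combinations of the slopes converge strongly to some V with |V| ≤ g, and V = ∂f since the
interpolations converge uniformly. The same argument once more passes to generalized upper
gradients.

If p is a minimal upper gradient of f, the piecewise affine approximations also give p ≤ |∂f|:
suprema over tails of their upper gradients are upper gradients of f, and along a subsequence these
gradients converge to |∂f| almost everywhere.

The form inherits closedness from ∂, the Markov property from the description by upper gradients,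
and regularity from the interpolations. Conservativity holds because ∂1 = 0 and the semigroup of
-∂*∂ is constructed by the Hille–Yosida theorem. For invariance, an isometry between blocks only
permutes and reflects the Cantor axes and perhaps reflects the interval; followed by unfolding it is
a map `symFold`, which changes ∂ by a sign and spreads the measure uniformly over a cell
(`energy_folding`). Locality follows since unfolding a function that vanishes on a cell gives 0. -/

/-! ### Functional analysis -/

/-! ### Strongly convergent convex combinations. -/

section Mazur

variable {E H : Type*} [AddCommGroup E] [Module ℝ E] [NormedAddCommGroup H]
  [InnerProductSpace ℝ H]

/-- A sequence whose images in a Hilbert space are bounded has convex combinations of its tails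
whose images form a Cauchy sequence. -/
theorem exists_convexHull_tail_cauchySeq (π : E →ₗ[ℝ] H) (x : ℕ → E) (R : ℝ)
    (hR : ∀ n, ‖π (x n)‖ ≤ R) :
    ∃ y : ℕ → E, (∀ n, y n ∈ convexHull ℝ (x '' Ici n)) ∧ CauchySeq fun n => π (y n) := by
  -- The combinations are formed in `E` and only measured through `π`. Later `E` consists of pairs
  -- and `π` takes the slope, so information about the other component survives.
  let C : ℕ → Set E := fun n => convexHull ℝ (x '' Ici n)
  let N : ℕ → Set ℝ := fun n => (fun z => ‖π z‖) '' C n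
  have hanti : ∀ {m n}, m ≤ n → C n ⊆ C m := fun h =>
    convexHull_mono (image_mono (Ici_subset_Ici.2 h))
  have hmem : ∀ n, x n ∈ C n := fun n => subset_convexHull _ _ ⟨n, self_mem_Ici, rfl⟩
  have hne : ∀ n, (N n).Nonempty := fun n => ⟨_, x n, hmem n, rfl⟩
  have hbd : ∀ n, BddBelow (N n) := fun n => ⟨0, by rintro _ ⟨z, -, rfl⟩; exact norm_nonneg _⟩
  let c : ℕ → ℝ := fun n => sInf (N n)
  have hc0 : ∀ n, 0 ≤ c n := fun n =>
    le_csInf (hne n) (by rintro _ ⟨z, -, rfl⟩; exact norm_nonneg _)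
  have hcle : ∀ {n z}, z ∈ C n → c n ≤ ‖π z‖ := fun {n z} hz => csInf_le (hbd n) ⟨z, hz, rfl⟩
  have hmono : Monotone c := fun m n h => csInf_le_csInf (hbd m) (hne n) (image_mono (hanti h))
  have hcR : BddAbove (range c) := ⟨R, by rintro _ ⟨n, rfl⟩; exact (hcle (hmem n)).trans (hR n)⟩
  have hlim := tendsto_atTop_ciSup hmono hcR
  set c' := ⨆ n, c n
  have hcc : ∀ n, c n ≤ c' := fun n => le_ciSup hcR n
  -- Near minimizers of the norm on the hulls. The infima increase to a finite limit and midpoints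
  -- of late terms stay in the hull, so the parallelogram law forces the Cauchy property.
  have hy : ∀ n : ℕ, ∃ z ∈ C n, ‖π z‖ < c n + 1 / ((n : ℝ) + 1) := by
    intro n
    obtain ⟨_, ⟨z, hz, rfl⟩, h⟩ := exists_lt_of_csInf_lt (hne n)
      (show sInf (N n) < c n + 1 / ((n : ℝ) + 1) from lt_add_of_pos_right _ (by positivity))
    exact ⟨z, hz, h⟩
  choose y hyC hyn using hy
  refine ⟨y, hyC, ?_⟩
  refine cauchySeq_of_le_tendsto_0
    (fun n : ℕ => Real.sqrt (4 * ((c' + 1 / ((n : ℝ) + 1)) ^ 2 - c n ^ 2))) ?_ ?_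
  · intro n m k hn hm
    rw [dist_eq_norm]
    apply Real.le_sqrt_of_sq_le
    have hpar := parallelogram_law_with_norm ℝ (π (y n)) (π (y m))
    have hmid : (2⁻¹ : ℝ) • y n + (2⁻¹ : ℝ) • y m ∈ C k :=
      (convex_convexHull ℝ _) (hanti hn (hyC n)) (hanti hm (hyC m)) (by norm_num) (by norm_num)
        (by norm_num)
    have h1 := hcle hmid
    rw [← smul_add, map_smul, map_add, norm_smul, Real.norm_of_nonneg (by norm_num)] at h1
    have h2 : ∀ l, k ≤ l → ‖π (y l)‖ ≤ c' + 1 / ((k : ℝ) + 1) := fun l hl => by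
      refine (hyn l).le.trans (add_le_add (hcc l) ?_)
      apply one_div_le_one_div_of_le (by positivity)
      have : (k : ℝ) ≤ l := by exact_mod_cast hl
      linarith
    have h3 := h2 n hn
    have h4 := h2 m hm
    have h5 := hc0 k
    have h6 : c k ^ 2 ≤ (2⁻¹ * ‖π (y n) + π (y m)‖) ^ 2 := pow_le_pow_left₀ h5 h1 2
    have h7 := pow_le_pow_left₀ (norm_nonneg _) h3 2
    have h8 := pow_le_pow_left₀ (norm_nonneg _) h4 2
    nlinarith [hpar]
  · have h1 : Tendsto (fun n : ℕ => c' + 1 / ((n : ℝ) + 1)) atTop (𝓝 (c' + 0)) :=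
      tendsto_const_nhds.add tendsto_one_div_add_atTop_nhds_zero_nat
    have h2 := (((h1.pow 2).sub (hlim.pow 2)).const_mul 4).sqrt
    simpa using h2

end Mazur

/-! ### Contraction semigroups by Yosida approximation. -/

section HilleYosida

open NormedSpace

variable {X : Type*} [NormedAddCommGroup X] [NormedSpace ℝ X] [CompleteSpace X]

theorem norm_exp_le_exp_norm (A : X →L[ℝ] X) : ‖exp A‖ ≤ Real.exp ‖A‖ := by
  have h1 := exp_series_hasSum_exp' (𝕂 := ℝ) A
  have h2 := expSeries_div_hasSum_exp ‖A‖
  rw [← Real.exp_eq_exp_ℝ] at h2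
  refine h1.norm_le_of_bounded h2 fun n => ?_
  rw [norm_smul, div_eq_inv_mul, norm_inv, Real.norm_natCast]
  gcongr
  induction n with
  -- Only an inequality, since the identity has norm 0 on the trivial space.
  | zero => rw [pow_zero, pow_zero]; exact ContinuousLinearMap.norm_id_le
  | succ n ih =>
    rw [pow_succ, pow_succ]
    exact (norm_mul_le _ _).trans (by gcongr)

theorem exp_add_smul (A : X →L[ℝ] X) (s t : ℝ) :
    exp ((s + t) • A) = exp (s • A) * exp (t • A) := by
  let _ : NormedAlgebra ℚ (X →L[ℝ] X) := NormedAlgebra.restrictScalars ℚ ℝ _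
  rw [add_smul, exp_add_of_commute ((Commute.refl A).smul_left s |>.smul_right t)]

/-- The scalar part commutes and splits off as exp(-tc), which compensates the bound exp(tc) for the
exponential of tcB. -/
theorem norm_exp_smul_sub_one_le {B : X →L[ℝ] X} (hB : ‖B‖ ≤ 1) {c t : ℝ} (hc : 0 ≤ c)
    (ht : 0 ≤ t) : ‖exp (t • c • (B - 1))‖ ≤ 1 := by
  let _ : NormedAlgebra ℚ (X →L[ℝ] X) := NormedAlgebra.restrictScalars ℚ ℝ _
  have e : t • c • (B - 1) = (-(t * c)) • (1 : X →L[ℝ] X) + (t * c) • B := by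
    rw [smul_smul, smul_sub, neg_smul]; abel
  rw [e, exp_add_of_commute ((Commute.one_left _).smul_left _)]
  have e2 : exp ((-(t * c)) • (1 : X →L[ℝ] X)) = Real.exp (-(t * c)) • 1 := by
    have := (algebraMap_exp_comm (𝔸 := X →L[ℝ] X) (-(t * c)))
    rw [Algebra.algebraMap_eq_smul_one, Algebra.algebraMap_eq_smul_one] at this
    rw [← this, Real.exp_eq_exp_ℝ]
  rw [e2, smul_mul_assoc, one_mul, norm_smul, Real.norm_of_nonneg (Real.exp_pos _).le]
  calc Real.exp (-(t * c)) * ‖exp ((t * c) • B)‖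
      ≤ Real.exp (-(t * c)) * Real.exp (t * c) := by
        gcongr
        refine (norm_exp_le_exp_norm _).trans (Real.exp_le_exp.2 ?_)
        rw [norm_smul, Real.norm_of_nonneg (by positivity)]
        exact mul_le_of_le_one_right (by positivity) hB
    _ = 1 := by rw [← Real.exp_add]; simp

theorem hasDerivAt_exp_smul_apply (A : X →L[ℝ] X) (u : X) (t : ℝ) :
    HasDerivAt (fun s : ℝ => exp (s • A) u) (exp (t • A) (A u)) t := by
  simpa using (hasDerivAt_exp_smul_const (𝕂 := ℝ) A t).clm_apply (hasDerivAt_const t u)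

/-- The curve s ↦ exp(sA) exp((t - s)B) u joins the two vectors. As A and B commute, its derivative
is a contraction applied to (A - B)u. -/
theorem norm_exp_smul_apply_sub_le {A B : X →L[ℝ] X} (hAB : Commute A B)
    (hA : ∀ t : ℝ, 0 ≤ t → ‖exp (t • A)‖ ≤ 1) (hB : ∀ t : ℝ, 0 ≤ t → ‖exp (t • B)‖ ≤ 1)
    {t : ℝ} (ht : 0 ≤ t) (u : X) :
    ‖exp (t • A) u - exp (t • B) u‖ ≤ ‖A u - B u‖ * t := by
  let _ : NormedAlgebra ℚ (X →L[ℝ] X) := NormedAlgebra.restrictScalars ℚ ℝ _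
  let φ : ℝ → X := fun s => exp (s • A) (exp ((t - s) • B) u)
  have hd : ∀ s ∈ Icc (0 : ℝ) t, HasDerivWithinAt φ
      ((exp (s • A) * exp ((t - s) • B)) (A u - B u)) (Icc 0 t) s := by
    intro s _
    have h1 : HasDerivAt (fun s : ℝ => exp ((t - s) • B))
        (-(exp ((t - s) • B) * B)) s := by
      have := (hasDerivAt_exp_smul_const (𝕂 := ℝ) B (t - s)).scomp s
        ((hasDerivAt_const s t).sub (hasDerivAt_id s))
      refine this.congr_deriv ?_
      simp
    have h2 := (hasDerivAt_exp_smul_const (𝕂 := ℝ) A s).clm_apply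
      (h1.clm_apply (hasDerivAt_const s u))
    refine (h2.congr_deriv ?_).hasDerivWithinAt
    have hc : A * exp ((t - s) • B) = exp ((t - s) • B) * A :=
      ((hAB.smul_right (t - s)).exp_right).eq
    have hc' := congrArg (fun L : X →L[ℝ] X => L u) hc
    simp only [mul_apply_eq_comp] at hc'
    simp only [mul_apply_eq_comp, map_zero, add_zero, neg_apply, hc', map_neg, map_sub,
      ← sub_eq_add_neg]
  have := norm_image_sub_le_of_norm_deriv_le_segment' (C := ‖A u - B u‖) hd (fun s hs => by
    refine (ContinuousLinearMap.le_opNorm _ _).trans ?_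
    refine mul_le_of_le_one_left (norm_nonneg _) ((norm_mul_le _ _).trans ?_)
    exact mul_le_one₀ (hA s hs.1) (norm_nonneg _) (hB _ (sub_nonneg.2 hs.2.le)))
    t (right_mem_Icc.2 ht)
  simpa [φ] using this

theorem norm_exp_smul_apply_sub_self_le {A : X →L[ℝ] X}
    (hA : ∀ t : ℝ, 0 ≤ t → ‖exp (t • A)‖ ≤ 1) {t : ℝ} (ht : 0 ≤ t) (u : X) :
    ‖exp (t • A) u - u‖ ≤ ‖A u‖ * t := by
  have := norm_exp_smul_apply_sub_le (Commute.zero_right A) hA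
    (fun s _ => by
    rw [smul_zero, exp_zero]; exact ContinuousLinearMap.norm_id_le) ht u
  simpa using this

/-- This is the estimate that survives the limit of Yosida approximations: `w` stands for the
generator at `u` and need not lie in its domain, so it is compared with a nearby `w'` that does. -/
theorem norm_exp_smul_apply_sub_sub_le {A : X →L[ℝ] X}
    (hA : ∀ t : ℝ, 0 ≤ t → ‖exp (t • A)‖ ≤ 1) {t : ℝ} (ht : 0 ≤ t) (u w w' : X) :
    ‖exp (t • A) u - u - t • w‖ ≤ (‖A u - w‖ + 2 * ‖w - w'‖ + ‖A w'‖ * t) * t := by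
  let φ : ℝ → X := fun s => exp (s • A) u - s • w
  have hd : ∀ s ∈ Icc (0 : ℝ) t, HasDerivWithinAt φ (exp (s • A) (A u) - w) (Icc 0 t) s := by
    intro s _
    have h2 := (hasDerivAt_exp_smul_apply A u s).sub ((hasDerivAt_id s).smul_const w)
    refine (h2.congr_deriv ?_).hasDerivWithinAt
    simp
  have hb : ∀ s ∈ Ico (0 : ℝ) t, ‖exp (s • A) (A u) - w‖ ≤
      ‖A u - w‖ + 2 * ‖w - w'‖ + ‖A w'‖ * t := by
    intro s hs
    have e : exp (s • A) (A u) - w = exp (s • A) (A u - w) + exp (s • A) (w - w')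
        + (exp (s • A) w' - w') + (w' - w) := by
      simp only [map_sub]; abel
    have h1 : ∀ z, ‖exp (s • A) z‖ ≤ ‖z‖ := fun z =>
      (ContinuousLinearMap.le_opNorm _ _).trans (mul_le_of_le_one_left (norm_nonneg _) (hA s hs.1))
    have h2 := norm_exp_smul_apply_sub_self_le hA hs.1 w'
    have h3 : ‖A w'‖ * s ≤ ‖A w'‖ * t := mul_le_mul_of_nonneg_left hs.2.le (norm_nonneg _)
    rw [e]
    refine (norm_add_le _ _).trans ?_
    have h4 := norm_add₃_le (a := exp (s • A) (A u - w)) (b := exp (s • A) (w - w'))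
      (c := exp (s • A) w' - w')
    have h5 := h1 (A u - w)
    have h6 := h1 (w - w')
    rw [norm_sub_rev w' w]
    linarith
  have := norm_image_sub_le_of_norm_deriv_le_segment' hd hb t (right_mem_Icc.2 ht)
  have e : φ t - φ 0 = exp (t • A) u - u - t • w := by simp [φ]; abel
  rw [e, sub_zero] at this
  exact this

/-- The Hille–Yosida theorem for contraction semigroups, with the generator given by its
resolvents. -/
theorem exists_contraction_semigroup (R : ℕ → X →L[ℝ] X) (𝒜 : X → X → Prop)
    (hR : ∀ n : ℕ, ‖((n : ℝ) + 1) • R n‖ ≤ 1)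
    (hA : ∀ (n : ℕ) u w, 𝒜 u w ↔ R n (((n : ℝ) + 1) • u - w) = u)
    (hd : Dense {u | ∃ w, 𝒜 u w}) :
    ∃ T : ℝ≥0 → X →L[ℝ] X, T 0 = ContinuousLinearMap.id ℝ X ∧
      (∀ s t, T (s + t) = (T s).comp (T t)) ∧
      (∀ u, Tendsto (fun t => T t u) (𝓝 0) (𝓝 u)) ∧
      (∀ u w, Tendsto (fun t : ℝ≥0 => (t : ℝ)⁻¹ • (T t u - u)) (𝓝[>] 0) (𝓝 w) ↔ 𝒜 u w) ∧
      ∀ u, 𝒜 u 0 → ∀ t, T t u = u := by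
  -- `R n` is the resolvent at n + 1, `B n` its normalization to a contraction, and `Y n` the
  -- bounded Yosida approximation of the generator.
  let c : ℕ → ℝ := fun n => (n : ℝ) + 1
  have hc : ∀ n, 0 < c n := fun n => by positivity
  let B : ℕ → X →L[ℝ] X := fun n => c n • R n
  let Y : ℕ → X →L[ℝ] X := fun n => c n • (B n - 1)
  let S : ℕ → ℝ → X →L[ℝ] X := fun n t => exp (t • Y n)
  have hS : ∀ n (t : ℝ), 0 ≤ t → ‖S n t‖ ≤ 1 := fun n t ht =>
    norm_exp_smul_sub_one_le (hR n) (hc n).le ht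
  have hSle : ∀ n (t : ℝ), 0 ≤ t → ∀ u, ‖S n t u‖ ≤ ‖u‖ := fun n t ht u =>
    (ContinuousLinearMap.le_opNorm _ _).trans (mul_le_of_le_one_left (norm_nonneg _) (hS n t ht))
  have hres : ∀ n w, 𝒜 (R n w) (c n • R n w - w) := fun n w => by
    rw [hA n]; simp [c]
  have hcomm : ∀ m n, Commute (R m) (R n) := by
    intro m n
    -- The resolvent identity; it makes all approximations commute.
    have key : ∀ m n w, R n w = R m w + (c m - c n) • R m (R n w) := by
      intro m n w
      have h1 := (hA m _ _).1 (hres n w)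
      have e : ((m : ℝ) + 1) • R n w - (c n • R n w - w) = (c m - c n) • R n w + w := by
        simp only [c, sub_smul]; abel
      rw [e, map_add, map_smul, add_comm] at h1
      exact h1.symm
    rcases eq_or_ne m n with rfl | hmn
    · exact Commute.refl _
    · ext w
      have h1 := key m n w
      have h2 := key n m w
      have hne : c m - c n ≠ 0 := by
        simp only [c, ne_eq, sub_eq_zero, add_left_inj, Nat.cast_inj]; exact hmn
      have h3 : (c m - c n) • (R m (R n w) - R n (R m w)) = 0 := by
        have h4 : (c m - c n) • R m (R n w) = R n w - R m w := by rw [eq_sub_iff_add_eq', ← h1]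
        have h5 : (c n - c m) • R n (R m w) = R m w - R n w := by rw [eq_sub_iff_add_eq', ← h2]
        have h6 : (c m - c n) • R n (R m w) = R n w - R m w := by
          rw [← neg_sub (R m w), ← h5, ← neg_smul, neg_sub]
        rw [smul_sub, h4, h6, sub_self]
      simpa [sub_eq_zero, hne] using h3
  have hYcomm : ∀ m n, Commute (Y m) (Y n) := fun m n =>
    (((((hcomm m n).smul_left (c m)).smul_right (c n)).sub_left (Commute.one_left _)).sub_right
      (Commute.one_right _)).smul_left (c m) |>.smul_right (c n)
  have hB : ∀ n u, ‖B n u‖ ≤ ‖u‖ := fun n u =>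
    (ContinuousLinearMap.le_opNorm _ _).trans (mul_le_of_le_one_left (norm_nonneg _) (hR n))
  -- On the domain the approximation is `B n` applied to the generator, and `B n` tends strongly to
  -- the identity; so the approximations converge there.
  have hY : ∀ n {u w}, 𝒜 u w → Y n u = B n w := by
    intro n u w h
    have h1 := (hA n u w).1 h
    rw [map_sub, map_smul, sub_eq_iff_eq_add] at h1
    have h1' : c n • R n u = u + R n w := h1
    simp only [Y, B, smul_apply, sub_apply, h1',
      one_apply_eq_self, add_sub_cancel_left]
  have happ : ∀ w : X, ∀ ε > 0, ∃ u w', 𝒜 u w' ∧ ‖w - u‖ < ε := by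
    intro w ε hε
    obtain ⟨u, ⟨w', h⟩, hu⟩ := hd.exists_dist_lt w hε
    exact ⟨u, w', h, by rwa [dist_eq_norm] at hu⟩
  have hBlim : ∀ w, Tendsto (fun n => B n w) atTop (𝓝 w) := by
    intro w
    rw [Metric.tendsto_atTop]
    intro ε hε
    obtain ⟨u, w', h, hu⟩ := happ w (ε / 3) (by positivity)
    obtain ⟨N, hN⟩ := exists_nat_gt (‖w'‖ / (ε / 3))
    refine ⟨N, fun n hn => ?_⟩
    have h1 : ‖B n u - u‖ < ε / 3 := by
      have e : B n u - u = (c n)⁻¹ • B n w' := by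
        rw [← hY n h]
        simp only [Y, smul_apply, sub_apply,
          one_apply_eq_self]
        rw [inv_smul_smul₀ (hc n).ne']
      rw [e, norm_smul, norm_inv, Real.norm_of_nonneg (hc n).le, inv_mul_lt_iff₀ (hc n)]
      refine (hB n w').trans_lt ?_
      rw [div_lt_iff₀ (by positivity)] at hN
      refine hN.trans_le (mul_le_mul_of_nonneg_right ?_ (by positivity))
      have : (N : ℝ) ≤ n := by exact_mod_cast hn
      simp only [c]; linarith
    have h2 := hB n (w - u)
    rw [dist_eq_norm]
    have e : B n w - w = B n (w - u) + (B n u - u) + (u - w) := by rw [map_sub]; abel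
    rw [e]
    refine (norm_add₃_le).trans_lt ?_
    rw [norm_sub_rev u w]
    linarith
  have hYlim : ∀ {u w}, 𝒜 u w → Tendsto (fun n => Y n u) atTop (𝓝 w) := fun h => by
    simpa only [hY _ h] using hBlim _
  have hlim : ∀ (t : ℝ≥0) u, ∃ l, Tendsto (fun n => S n t u) atTop (𝓝 l) := by
    intro t u
    apply cauchySeq_tendsto_of_complete
    rw [Metric.cauchySeq_iff]
    intro ε hε
    obtain ⟨v, w, h, hv⟩ := happ u (ε / 3) (by positivity)
    have hcs := (hYlim h).cauchySeq
    rw [Metric.cauchySeq_iff] at hcs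
    obtain ⟨N, hN⟩ := hcs (ε / 3 / (t + 1)) (by positivity)
    refine ⟨N, fun m hm n hn => ?_⟩
    have h1 := norm_exp_smul_apply_sub_le (hYcomm m n) (hS m) (hS n) t.2 v
    have h2 := hN m hm n hn
    rw [dist_eq_norm, lt_div_iff₀ (by positivity)] at h2
    have h3 := hSle m t t.2 (u - v)
    have h4 := hSle n t t.2 (u - v)
    rw [dist_eq_norm]
    have e : S m t u - S n t u = S m t (u - v) + (S m t v - S n t v) + -(S n t (u - v)) := by
      simp only [map_sub]; abel
    have h5 : ‖S m t v - S n t v‖ < ε / 3 := by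
      refine lt_of_le_of_lt (h1.trans ?_) h2
      exact mul_le_mul_of_nonneg_left (by simp) (norm_nonneg _)
    rw [e]
    refine (norm_add₃_le).trans_lt ?_
    rw [norm_neg]
    linarith
  choose T' hT' using hlim
  let T : ℝ≥0 → X →L[ℝ] X := fun t =>
    continuousLinearMapOfTendsto (fun n => S n t) (tendsto_pi_nhds.2 (hT' t))
  have hT : ∀ (t : ℝ≥0) u, Tendsto (fun n => S n t u) atTop (𝓝 (T t u)) := hT'
  have hTle : ∀ (t : ℝ≥0) u, ‖T t u‖ ≤ ‖u‖ := fun t u =>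
    le_of_tendsto (hT t u).norm (Eventually.of_forall fun n => hSle n t t.2 u)
  have hT1 : ∀ {u w}, 𝒜 u w → ∀ t : ℝ≥0, ‖T t u - u‖ ≤ ‖w‖ * t := fun {u w} h t =>
    le_of_tendsto_of_tendsto' ((hT t u).sub_const u).norm ((hYlim h).norm.mul_const _)
      fun n => norm_exp_smul_apply_sub_self_le (hS n) t.2 u
  have hT2 : ∀ {u w}, 𝒜 u w → ∀ {v v'}, 𝒜 v v' → ∀ t : ℝ≥0,
      ‖T t u - u - (t : ℝ) • w‖ ≤ (‖w - w‖ + 2 * ‖w - v‖ + ‖v'‖ * t) * t := by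
    intro u w h v v' h' t
    refine le_of_tendsto_of_tendsto' (((hT t u).sub_const u).sub_const _).norm
      (((((hYlim h).sub_const w).norm.add_const _).add ((hYlim h').norm.mul_const _)).mul_const _)
      fun n => norm_exp_smul_apply_sub_sub_le (hS n) t.2 u w v
  have hgen : ∀ {u w}, 𝒜 u w →
      Tendsto (fun t : ℝ≥0 => (t : ℝ)⁻¹ • (T t u - u)) (𝓝[>] 0) (𝓝 w) := by
    intro u w h
    rw [Metric.tendsto_nhds]
    intro ε hε
    obtain ⟨v, v', h', hv⟩ := happ w (ε / 4) (by positivity)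
    have hev : ∀ᶠ t : ℝ≥0 in 𝓝[>] 0, ‖v'‖ * t < ε / 2 := by
      have : Tendsto (fun t : ℝ≥0 => ‖v'‖ * (t : ℝ)) (𝓝[>] 0) (𝓝 (‖v'‖ * (0 : ℝ≥0))) :=
        ((continuous_const.mul NNReal.continuous_coe).tendsto 0).mono_left nhdsWithin_le_nhds
      exact this.eventually (gt_mem_nhds (by simpa using half_pos hε))
    filter_upwards [hev, self_mem_nhdsWithin] with t ht ht0
    have ht0' : (0 : ℝ) < t := ht0
    have h1 := hT2 h h' t
    have e : (t : ℝ)⁻¹ • (T t u - u) - w = (t : ℝ)⁻¹ • (T t u - u - (t : ℝ) • w) := by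
      rw [smul_sub (t : ℝ)⁻¹ (T t u - u), inv_smul_smul₀ ht0'.ne']
    rw [dist_eq_norm, e, norm_smul, norm_inv, Real.norm_of_nonneg ht0'.le, inv_mul_lt_iff₀ ht0']
    refine h1.trans_lt ?_
    rw [mul_comm]
    refine mul_lt_mul_of_pos_left ?_ ht0'
    rw [sub_self, norm_zero]
    linarith
  refine ⟨T, ?_, ?_, ?_, ?_, ?_⟩
  · ext u
    refine tendsto_nhds_unique (hT 0 u) ?_
    simp [S]
  · intro s t
    ext u
    refine tendsto_nhds_unique (hT (s + t) u) ?_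
    rw [tendsto_iff_norm_sub_tendsto_zero]
    have h1 : Tendsto (fun n => ‖S n t u - T t u‖ + ‖S n s (T t u) - T s (T t u)‖) atTop (𝓝 0) := by
      simpa using (tendsto_iff_norm_sub_tendsto_zero.1 (hT t u)).add
        (tendsto_iff_norm_sub_tendsto_zero.1 (hT s (T t u)))
    refine squeeze_zero (fun _ => norm_nonneg _) (fun n => ?_) h1
    have e : S n ((s + t : ℝ≥0) : ℝ) u - ((T s).comp (T t)) u
        = S n s (S n t u - T t u) + (S n s (T t u) - T s (T t u)) := by
      have : S n ((s + t : ℝ≥0) : ℝ) = S n s * S n t := by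
        simp only [S]; push_cast; exact exp_add_smul _ _ _
      rw [this, map_sub]
      simp
    rw [e]
    exact (norm_add_le _ _).trans (add_le_add_left (hSle n s s.2 _) _)
  · intro u
    rw [Metric.tendsto_nhds]
    intro ε hε
    obtain ⟨v, w, h, hv⟩ := happ u (ε / 3) (by positivity)
    have hev : ∀ᶠ t : ℝ≥0 in 𝓝 0, ‖w‖ * t < ε / 3 := by
      have : Tendsto (fun t : ℝ≥0 => ‖w‖ * (t : ℝ)) (𝓝 0) (𝓝 (‖w‖ * (0 : ℝ≥0))) :=
        ((continuous_const.mul NNReal.continuous_coe).tendsto 0)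
      exact this.eventually (gt_mem_nhds (by simp; positivity))
    filter_upwards [hev] with t ht
    have h1 := hT1 h t
    have h2 := hTle t (u - v)
    rw [dist_eq_norm]
    have e : T t u - u = T t (u - v) + (T t v - v) + (v - u) := by rw [map_sub]; abel
    rw [e]
    refine (norm_add₃_le).trans_lt ?_
    rw [norm_sub_rev v u]
    linarith
  · refine fun u w => ⟨fun h => ?_, hgen⟩
    -- To see that the strong derivative does not extend `𝒜` properly, solve z - 𝒜z = u - w. The
    -- difference y = u - z then has strong derivative y, which is impossible for a contraction
    -- semigroup unless y = 0.
    let z := R 0 (u - w)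
    have hz : 𝒜 z (z - (u - w)) := by
      have h1 := hres 0 (u - w)
      have h2 : c 0 = 1 := by simp [c]
      rwa [h2, one_smul] at h1
    let y := u - z
    have hy : Tendsto (fun t : ℝ≥0 => (t : ℝ)⁻¹ • (T t y - y)) (𝓝[>] 0) (𝓝 y) := by
      have h1 := h.sub (hgen hz)
      have e : w - (z - (u - w)) = y := by simp only [y]; abel
      rw [e] at h1
      refine h1.congr fun t => ?_
      rw [← smul_sub]
      congr 1
      simp only [y, map_sub]; abel
    -- Solving for (1 + t)y and using ‖T t y‖ ≤ ‖y‖ bounds y by the error of the difference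
    -- quotient.
    have hle : ∀ t : ℝ≥0, 0 < t → ‖y‖ ≤ ‖(t : ℝ)⁻¹ • (T t y - y) - y‖ := by
      intro t ht
      have ht' : (0 : ℝ) < t := ht
      have h1 : (1 + (t : ℝ)) • y = T t y - (t : ℝ) • ((t : ℝ)⁻¹ • (T t y - y) - y) := by
        rw [smul_sub (t : ℝ) ((t : ℝ)⁻¹ • _), smul_inv_smul₀ ht'.ne', add_smul, one_smul]; abel
      have h2 := congrArg norm h1
      rw [norm_smul, Real.norm_of_nonneg (by positivity)] at h2
      have h3 := norm_sub_le (T t y) ((t : ℝ) • ((t : ℝ)⁻¹ • (T t y - y) - y))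
      rw [norm_smul, Real.norm_of_nonneg ht'.le] at h3
      have h4 := hTle t y
      have h5 : (t : ℝ) * ‖y‖ ≤ t * ‖(t : ℝ)⁻¹ • (T t y - y) - y‖ := by linarith
      exact le_of_mul_le_mul_left h5 ht'
    have h0 : ‖y‖ ≤ 0 := by
      have h1 := tendsto_iff_norm_sub_tendsto_zero.1 hy
      have : (𝓝[>] (0 : ℝ≥0)).NeBot := inferInstance
      exact ge_of_tendsto h1 (by filter_upwards [self_mem_nhdsWithin] with t ht using hle t ht)
    have hy0 : u - z = 0 := norm_le_zero_iff.1 h0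
    have huz : z = u := (sub_eq_zero.1 hy0).symm
    rw [huz] at hz
    simpa using hz
  · intro u h t
    have := hT1 h t
    rw [norm_zero, zero_mul, norm_le_zero_iff, sub_eq_zero] at this
    exact this

end HilleYosida

/-! ### The semigroup generated by -T*T. -/

section ClosedOperator

variable {H : Type*} [NormedAddCommGroup H] [InnerProductSpace ℝ H] [CompleteSpace H]

/-- Solvability of `λ u + T* T u = w` for a closed operator `T`, given by its graph `G`. -/
theorem exists_resolvent (G : Submodule ℝ (H × H)) (hG : IsClosed (G : Set (H × H)))
    {l : ℝ} (hl : 0 < l) (w : H) :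
    ∃ p ∈ G, ∀ q ∈ G, inner ℝ p.2 q.2 + l * inner ℝ p.1 q.1 = inner ℝ w q.1 := by
  -- Scaling the first coordinate by √l turns the weighted inner product on the graph into that of
  -- the Hilbert sum; the solution is then an orthogonal projection of (w / √l, 0).
  let s := Real.sqrt l
  have hs : 0 < s := Real.sqrt_pos.2 hl
  have hss : s * s = l := Real.mul_self_sqrt hl.le
  let e : WithLp 2 (H × H) →L[ℝ] H × H :=
    ((s⁻¹ • ContinuousLinearMap.fst ℝ H H).prod (ContinuousLinearMap.snd ℝ H H)).comp
      (WithLp.prodContinuousLinearEquiv 2 ℝ H H).toContinuousLinearMap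
  let K : Submodule ℝ (WithLp 2 (H × H)) := G.comap e.toLinearMap
  have hK : IsClosed (K : Set (WithLp 2 (H × H))) := hG.preimage e.continuous
  have : CompleteSpace K := hK.completeSpace_coe
  let x : WithLp 2 (H × H) := WithLp.toLp 2 (s⁻¹ • w, 0)
  let y := K.starProjection x
  have hy : y ∈ K := Submodule.starProjection_apply_mem K x
  refine ⟨e y, hy, fun q hq => ?_⟩
  have hz : WithLp.toLp 2 (s • q.1, q.2) ∈ K := by
    change e (WithLp.toLp 2 (s • q.1, q.2)) ∈ G
    have : e (WithLp.toLp 2 (s • q.1, q.2)) = q := by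
      simp [e, hs.ne']
    rwa [this]
  have h := Submodule.starProjection_inner_eq_zero (K := K) x _ hz
  rw [inner_sub_left, WithLp.prod_inner_apply, WithLp.prod_inner_apply, sub_eq_zero] at h
  have h' : s * (s⁻¹ * inner ℝ w q.1) = s * inner ℝ y.fst q.1 + inner ℝ y.snd q.2 := by
    simpa [y, x, inner_smul_left, inner_smul_right] using h
  rw [mul_inv_cancel_left₀ hs.ne'] at h'
  rw [h']
  simp [e, inner_smul_left, ← hss]
  field_simp
  ring

/-- The semigroup generated by `-T* T` for a closed densely defined operator `T`, given by its
graph `G`. -/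
theorem exists_semigroup_of_graph (G : Submodule ℝ (H × H)) (hG : IsClosed (G : Set (H × H)))
    (hd : Dense {u : H | ∃ v, (u, v) ∈ G}) :
    ∃ T : ℝ≥0 → H →L[ℝ] H, T 0 = ContinuousLinearMap.id ℝ H ∧
      (∀ s t, T (s + t) = (T s).comp (T t)) ∧
      (∀ u, Tendsto (fun t => T t u) (𝓝 0) (𝓝 u)) ∧
      (∀ u w, Tendsto (fun t : ℝ≥0 => (t : ℝ)⁻¹ • (T t u - u)) (𝓝[>] 0) (𝓝 w) ↔
        ∃ v, (u, v) ∈ G ∧ ∀ q ∈ G, inner ℝ v q.2 = - inner ℝ w q.1) ∧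
      ∀ u, (u, 0) ∈ G → ∀ t, T t u = u := by
  have hu : ∀ {l : ℝ}, 0 < l → ∀ {p}, p ∈ G →
      inner ℝ p.2 p.2 + l * inner ℝ p.1 p.1 = 0 → p = 0 := by
    intro l hl p hp h
    rw [real_inner_self_eq_norm_sq, real_inner_self_eq_norm_sq] at h
    have h1 : ‖p.1‖ = 0 := by
      have := mul_nonneg hl.le (sq_nonneg ‖p.1‖)
      have h2 : l * ‖p.1‖ ^ 2 = 0 := by linarith [sq_nonneg ‖p.2‖]
      simpa [hl.ne'] using h2
    rw [h1] at h
    have h2 : ‖p.2‖ = 0 := by simpa using h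
    exact Prod.ext (norm_eq_zero.1 h1) (norm_eq_zero.1 h2)
  have hex : ∀ n : ℕ, ∀ w : H, ∃ p ∈ G, ∀ q ∈ G,
      inner ℝ p.2 q.2 + ((n : ℝ) + 1) * inner ℝ p.1 q.1 = inner ℝ w q.1 :=
    fun n w => exists_resolvent G hG (by positivity) w
  choose p hpG hp using hex
  have huniq : ∀ (n : ℕ) (w : H) (r : H × H), r ∈ G → (∀ q ∈ G,
      inner ℝ r.2 q.2 + ((n : ℝ) + 1) * inner ℝ r.1 q.1 = inner ℝ w q.1) → r = p n w := by
    intro n w r hr h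
    have hmem := G.sub_mem hr (hpG n w)
    rw [← sub_eq_zero]
    refine hu (l := (n : ℝ) + 1) (by positivity) hmem ?_
    have h1 := h _ hmem
    have h2 := hp n w _ hmem
    simp only [Prod.snd_sub, Prod.fst_sub] at h1 h2 ⊢
    rw [inner_sub_left, inner_sub_left]
    linarith
  have hbound : ∀ (n : ℕ) (w : H), ‖(p n w).1‖ ≤ ((n : ℝ) + 1)⁻¹ * ‖w‖ := by
    intro n w
    have h1 := hp n w _ (hpG n w)
    rw [real_inner_self_eq_norm_sq, real_inner_self_eq_norm_sq] at h1
    have h2 := real_inner_le_norm w (p n w).1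
    rw [le_inv_mul_iff₀ (by positivity)]
    rcases (norm_nonneg (p n w).1).eq_or_lt with h0 | h0
    · rw [← h0]; simp
    · refine le_of_mul_le_mul_right ?_ h0
      nlinarith [sq_nonneg ‖(p n w).2‖]
  let R : ℕ → H →L[ℝ] H := fun n => LinearMap.mkContinuous
    { toFun := fun w => (p n w).1
      map_add' := fun w w' => by
        rw [← huniq n (w + w') (p n w + p n w') (G.add_mem (hpG n w) (hpG n w')) fun q hq => by
          have h1 := hp n w q hq
          have h2 := hp n w' q hq
          simp only [Prod.snd_add, Prod.fst_add, inner_add_left]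
          linarith]
        rfl
      map_smul' := fun a w => by
        rw [← huniq n (a • w) (a • p n w) (G.smul_mem a (hpG n w)) fun q hq => by
          have h1 := hp n w q hq
          simp only [Prod.smul_snd, Prod.smul_fst, real_inner_smul_left, ← h1]
          ring]
        rfl } (((n : ℝ) + 1)⁻¹) (hbound n)
  have hRapp : ∀ n w, R n w = (p n w).1 := fun n w => rfl
  suffices h : ∃ T : ℝ≥0 → H →L[ℝ] H, T 0 = ContinuousLinearMap.id ℝ H ∧
      (∀ s t, T (s + t) = (T s).comp (T t)) ∧
      (∀ u, Tendsto (fun t => T t u) (𝓝 0) (𝓝 u)) ∧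
      (∀ u w, Tendsto (fun t : ℝ≥0 => (t : ℝ)⁻¹ • (T t u - u)) (𝓝[>] 0) (𝓝 w) ↔
        ∃ v, (u, v) ∈ G ∧ ∀ q ∈ G, inner ℝ v q.2 = - inner ℝ w q.1) ∧
      ∀ u, (∃ v, (u, v) ∈ G ∧ ∀ q ∈ G, inner ℝ v q.2 = - inner ℝ (0 : H) q.1) →
        ∀ t, T t u = u by
    obtain ⟨T, h0, hadd, hcont, hgen, hfix⟩ := h
    refine ⟨T, h0, hadd, hcont, hgen, fun u hu' t => hfix u ⟨0, hu', fun q _ => ?_⟩ t⟩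
    simp
  refine exists_contraction_semigroup R
    (fun u w => ∃ v, (u, v) ∈ G ∧ ∀ q ∈ G, inner ℝ v q.2 = - inner ℝ w q.1) ?_ ?_ ?_
  · intro n
    rw [norm_smul, Real.norm_of_nonneg (by positivity)]
    have := LinearMap.mkContinuous_norm_le (R n).toLinearMap (C := ((n : ℝ) + 1)⁻¹)
      (by positivity) (hbound n)
    calc ((n : ℝ) + 1) * ‖R n‖ ≤ ((n : ℝ) + 1) * ((n : ℝ) + 1)⁻¹ := by gcongr; exact this
      _ = 1 := mul_inv_cancel₀ (by positivity)
  · intro n u w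
    rw [hRapp]
    constructor
    · rintro ⟨v, hv, h⟩
      rw [← huniq n _ (u, v) hv fun q hq => by
        rw [h q hq, inner_sub_left, real_inner_smul_left]; ring]
    · intro h
      refine ⟨(p n (((n : ℝ) + 1) • u - w)).2, ?_, fun q hq => ?_⟩
      · have := hpG n (((n : ℝ) + 1) • u - w)
        nth_rw 1 [← h]
        exact this
      · have h1 := hp n (((n : ℝ) + 1) • u - w) q hq
        rw [h, inner_sub_left, real_inner_smul_left] at h1
        linarith
  -- The domain of the generator contains the range of `R 0`. If z is orthogonal to this range,
  -- testing with `R 0 z` itself shows that the solution for z vanishes; hence z is orthogonal to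
  -- the dense domain of T.
  · have hsub : (LinearMap.range (R 0).toLinearMap : Set H) ⊆
        {u | ∃ w v, (u, v) ∈ G ∧ ∀ q ∈ G, inner ℝ v q.2 = - inner ℝ w q.1} := by
      rintro _ ⟨w, rfl⟩
      refine ⟨(p 0 w).1 - w, (p 0 w).2, hpG 0 w, fun q hq => ?_⟩
      have h1 := hp 0 w q hq
      rw [inner_sub_left]
      simp only [Nat.cast_zero, zero_add, one_mul] at h1
      linarith
    refine Dense.mono hsub ?_
    rw [Submodule.dense_iff_topologicalClosure_eq_top, Submodule.topologicalClosure_eq_top_iff,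
      Submodule.eq_bot_iff]
    intro z hz
    rw [Submodule.mem_orthogonal'] at hz
    have h1 := hz _ ⟨z, rfl⟩
    have h2 : p 0 z = 0 := hu (l := ((0 : ℕ) : ℝ) + 1) (by positivity) (hpG 0 z)
      ((hp 0 z _ (hpG 0 z)).trans h1)
    have h3 : ∀ u ∈ {u : H | ∃ v, (u, v) ∈ G}, inner ℝ z u = 0 := by
      rintro u ⟨v, hv⟩
      have := hp 0 z _ hv
      rw [h2] at this
      simpa using this.symm
    have h4 : inner ℝ z z = 0 := by
      have hc : IsClosed {u : H | inner ℝ z u = 0} :=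
        isClosed_eq (by fun_prop) continuous_const
      exact hc.closure_subset_iff.2 h3 (hd z)
    simpa using h4

end ClosedOperator

/-! ### The measure of a Laakso space -/

namespace LaaksoData

/-! ### Bernoulli measures and operations on digits. -/

section Digits

variable {k n : ℕ}

/-- The product of the uniform Bernoulli measures. -/
noncomputable def digitMeasure (k : ℕ) : Measure (Fin k → ℕ → Bool) :=
  Measure.pi fun _ : Fin k => bernoulli

instance : IsProbabilityMeasure (digitMeasure k) := by
  unfold digitMeasure; infer_instance

/-- Replace the first `n` digits of each coordinate by prescribed ones. -/
def overwrite (a : Fin k → Fin n → Bool) (w : Fin k → ℕ → Bool) : Fin k → ℕ → Bool :=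
  fun c m => if h : m < n then a c ⟨m, h⟩ else w c m

lemma continuous_overwrite (a : Fin k → Fin n → Bool) : Continuous (overwrite a) := by
  refine continuous_pi fun c => continuous_pi fun m => ?_
  unfold overwrite
  split_ifs
  · exact continuous_const
  · fun_prop

lemma overwrite_apply_lt (a : Fin k → Fin n → Bool) (w : Fin k → ℕ → Bool) (c : Fin k)
    (m : Fin n) : overwrite a w c m = a c m := by simp [overwrite]

/-- Switch the digits of a point of the Cantor space according to a mask. -/
def switchDigits (z w : Fin k → ℕ → Bool) : Fin k → ℕ → Bool := fun c m => xor (z c m) (w c m)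

lemma measurePreserving_xor (z : ℕ → Bool) :
    MeasurePreserving (fun (w : ℕ → Bool) m => xor (z m) (w m)) bernoulli bernoulli where
  measurable := measurable_pi_iff.2 fun m =>
    (measurable_from_top (f := fun b => xor (z m) b)).comp (measurable_pi_apply m)
  map_eq := by
    unfold bernoulli
    rw [Measure.infinitePi_map_pi _ fun m => measurable_from_top (f := fun b => xor (z m) b)]
    congr 1
    funext m
    ext s hs
    rw [Measure.map_apply measurable_from_top hs, ← PMF.toMeasure_map_apply _ _ _
      measurable_from_top hs]
    congr 2
    ext b
    rw [PMF.map_apply, tsum_bool]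
    cases z m <;> cases b <;> simp

lemma measurePreserving_switchDigits (z : Fin k → ℕ → Bool) :
    MeasurePreserving (switchDigits z) (digitMeasure k) (digitMeasure k) :=
  measurePreserving_pi _ _ fun c => measurePreserving_xor (z c)

lemma measurePreserving_permCoords (τ : Equiv.Perm (Fin k)) :
    MeasurePreserving (fun (w : Fin k → ℕ → Bool) c => w (τ c)) (digitMeasure k)
      (digitMeasure k) := by
  have := measurePreserving_piCongrLeft (fun _ : Fin k => bernoulli) τ⁻¹
  rw [← digitMeasure] at this
  convert this using 1
  ext w c m
  obtain ⟨c', rfl⟩ := (τ⁻¹).surjective c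
  rw [MeasurableEquiv.coe_piCongrLeft, Equiv.piCongrLeft_apply_apply]
  simp

lemma measurable_overwrite (a : Fin k → Fin n → Bool) : Measurable (overwrite a) :=
  (continuous_overwrite a).measurable

/-- The integral over the Cantor space is the average of the integrals over its pieces. -/
lemma sum_lintegral_overwrite {F : (Fin k → ℕ → Bool) → ℝ≥0∞} (hF : Measurable F) :
    ∑ a : Fin k → Fin n → Bool, ∫⁻ w, F (overwrite a w) ∂digitMeasure k =
      Fintype.card (Fin k → Fin n → Bool) * ∫⁻ w, F w ∂digitMeasure k := by
  have h1 : ∀ a : Fin k → Fin n → Bool,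
      ∫⁻ w, F (switchDigits (overwrite a fun _ _ => false) w) ∂digitMeasure k =
        ∫⁻ w, F w ∂digitMeasure k := fun a =>
    (measurePreserving_switchDigits _).lintegral_comp hF
  have h2 : ∑ a : Fin k → Fin n → Bool,
      ∫⁻ w, F (switchDigits (overwrite a fun _ _ => false) w) ∂digitMeasure k =
        Fintype.card (Fin k → Fin n → Bool) * ∫⁻ w, F w ∂digitMeasure k := by
    simp only [h1, Finset.sum_const, nsmul_eq_mul, Finset.card_univ]
  rw [← h2, ← lintegral_finsetSum (f := fun a w => F (overwrite a w)) _
      fun a _ => hF.comp (measurable_overwrite a),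
    ← lintegral_finsetSum (f := fun a w => F (switchDigits (overwrite a fun _ _ => false) w)) _
      fun a _ => hF.comp (measurePreserving_switchDigits _).measurable]
  refine lintegral_congr fun w => ?_
  -- For fixed w, adding the first digits of w modulo 2 permutes the words and turns switching,
  -- which preserves the measure, into overwriting.
  let e : (Fin k → Fin n → Bool) ≃ (Fin k → Fin n → Bool) :=
    Function.Involutive.toPerm (fun a c m => xor (a c m) (w c m)) (by
      intro a; funext c m; simp)
  refine (Fintype.sum_equiv e _ _ fun a => ?_).symm
  congr 1
  funext c m
  have he : e a = fun c m => xor (a c m) (w c m) := rfl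
  rw [he]
  by_cases h : m < n <;> simp [switchDigits, overwrite, h]

end Digits

/-! ### Lebesgue measure under subdivision and folding. -/

section Interval

lemma lintegral_Ico_div {d : ℕ} (hd : 0 < d) (l : ℕ) (G : ℝ → ℝ≥0∞) :
    ∫⁻ t in Icc (0 : ℝ) 1, G ((l + t) / d) =
      d * ∫⁻ x in Ico ((l : ℝ) / d) (((l + 1 : ℕ) : ℝ) / d), G x := by
  have hd' : (0 : ℝ) < d := by exact_mod_cast hd
  have himg : (fun t : ℝ => (l + t) / d) '' Ico 0 1 =
      Ico ((l : ℝ) / d) (((l + 1 : ℕ) : ℝ) / d) := by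
    ext x
    simp only [mem_image, mem_Ico]
    constructor
    · rintro ⟨t, ⟨h0, h1⟩, rfl⟩
      push_cast
      constructor
      · gcongr; linarith
      · gcongr
    · rintro ⟨h0, h1⟩
      push_cast at h1
      rw [div_le_iff₀ hd'] at h0
      rw [lt_div_iff₀ hd'] at h1
      refine ⟨x * d - l, ⟨by linarith, by linarith⟩, ?_⟩
      field_simp
      ring
  have := lintegral_image_eq_lintegral_abs_deriv_mul (s := Ico (0 : ℝ) 1)
    (f := fun t : ℝ => (l + t) / d) (f' := fun _ => 1 / (d : ℝ)) measurableSet_Ico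
    (fun x _ => by
      have := ((hasDerivAt_const x (l : ℝ)).add (hasDerivAt_id x)).div_const (d : ℝ)
      simpa using this.hasDerivWithinAt)
    (fun x _ y _ h => by
      have : (l + x) / (d : ℝ) = (l + y) / d := h
      rw [div_left_inj' hd'.ne'] at this
      linarith) G
  rw [himg] at this
  rw [this, lintegral_const_mul' _ _ ENNReal.ofReal_ne_top, ← mul_assoc,
    restrict_Ico_eq_restrict_Icc, abs_of_pos (by positivity), ENNReal.ofReal_div_of_pos hd',
    ENNReal.ofReal_one, ENNReal.ofReal_natCast, one_div, ENNReal.mul_inv_cancel, one_mul]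
  · exact_mod_cast hd.ne'
  · exact ENNReal.natCast_ne_top d

lemma sum_lintegral_Icc_div {d : ℕ} (hd : 0 < d) (G : ℝ → ℝ≥0∞) :
    ∑ l ∈ Finset.range d, ∫⁻ t in Icc (0 : ℝ) 1, G ((l + t) / d) =
      d * ∫⁻ x in Icc (0 : ℝ) 1, G x := by
  have hd' : (0 : ℝ) < d := by exact_mod_cast hd
  have key : ∀ n : ℕ, ∑ l ∈ Finset.range n,
      ∫⁻ x in Ico ((l : ℝ) / d) (((l + 1 : ℕ) : ℝ) / d), G x =
        ∫⁻ x in Ico (0 : ℝ) ((n : ℝ) / d), G x := by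
    intro n
    induction n with
    | zero => simp
    | succ n ih =>
      have h1 : (0 : ℝ) ≤ n / d := by positivity
      have h2 : (n : ℝ) / d ≤ ((n + 1 : ℕ) : ℝ) / d := by gcongr; simp
      rw [Finset.sum_range_succ, ih, ← Ico_union_Ico_eq_Ico h1 h2,
        lintegral_union measurableSet_Ico Ico_disjoint_Ico_same]
  simp only [lintegral_Ico_div hd, ← Finset.mul_sum, key]
  rw [div_self hd'.ne', restrict_Ico_eq_restrict_Icc]

lemma lintegral_Icc_one_sub (G : ℝ → ℝ≥0∞) :
    ∫⁻ t in Icc (0 : ℝ) 1, G (1 - t) = ∫⁻ t in Icc (0 : ℝ) 1, G t := by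
  have := lintegral_image_eq_lintegral_abs_deriv_mul (s := Icc (0 : ℝ) 1)
    (f := fun t : ℝ => 1 - t) (f' := fun _ => -1) measurableSet_Icc
    (fun x _ => by
      simpa using ((hasDerivAt_id x).const_sub (1 : ℝ)).hasDerivWithinAt)
    (fun x _ y _ h => by
      have : 1 - x = 1 - y := h
      linarith) G
  rw [image_const_sub_Icc] at this
  simpa using this.symm

/-- `round` breaks the tie at odd integers in one direction; the value is the same for either of the
two nearest even integers. -/
lemma triangle_eq_of_round {t : ℝ} {z : ℤ} (h : |t - 2 * z| ≤ 1) : triangle t = |t - 2 * z| := by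
  unfold triangle
  have h1 := abs_sub_round (t / 2)
  rcases abs_cases (t - 2 * z) with ⟨h2, h3⟩ | ⟨h2, h3⟩ <;>
  rcases abs_cases (t / 2 - round (t / 2)) with ⟨h4, h5⟩ | ⟨h4, h5⟩ <;>
  rcases abs_cases (t - 2 * (round (t / 2) : ℝ)) with ⟨h6, h7⟩ | ⟨h6, h7⟩ <;>
  · rw [h2] at h ⊢
    rw [h4] at h1
    rw [h6]
    have e1 : round (t / 2) < z + 2 := by
      have : (round (t / 2) : ℝ) < z + 2 := by linarith
      exact_mod_cast this
    have e2 : z - 2 < round (t / 2) := by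
      have : (z : ℝ) - 2 < round (t / 2) := by linarith
      exact_mod_cast this
    obtain h | h | h : round (t / 2) = z - 1 ∨ round (t / 2) = z ∨ round (t / 2) = z + 1 := by
      omega
    all_goals
      generalize round (t / 2) = y at *
      subst h
      push_cast at *
      linarith

lemma triangle_even_add {z : ℤ} (hz : Even z) {t : ℝ} (h0 : 0 ≤ t) (h1 : t ≤ 1) :
    triangle (z + t) = t := by
  obtain ⟨y, rfl⟩ := hz
  have e : ((y + y : ℤ) : ℝ) + t - 2 * y = t := by push_cast; ring
  rw [triangle_eq_of_round (z := y) (by rw [e, abs_of_nonneg h0]; exact h1), e, abs_of_nonneg h0]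

lemma triangle_odd_add {z : ℤ} (hz : ¬ Even z) {t : ℝ} (h0 : 0 ≤ t) (h1 : t ≤ 1) :
    triangle (z + t) = 1 - t := by
  obtain ⟨y, rfl⟩ := Int.not_even_iff_odd.1 hz
  have e : ((2 * y + 1 : ℤ) : ℝ) + t - 2 * (y + 1 : ℤ) = -(1 - t) := by push_cast; ring
  have h2 : |-(1 - t)| = 1 - t := by rw [abs_neg, abs_of_nonneg (by linarith)]
  rw [triangle_eq_of_round (z := y + 1) (by rw [e, h2]; linarith), e, h2]

/-- On each interval [l / d, (l + 1) / d] the argument of G runs once through [0, 1], upwards or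
downwards according to the parity of l - m. Hence the phase m is irrelevant. -/
lemma lintegral_triangle {d : ℕ} (hd : 0 < d) (m : ℤ) (G : ℝ → ℝ≥0∞) :
    ∫⁻ x in Icc (0 : ℝ) 1, G (triangle (d * x - m)) = ∫⁻ t in Icc (0 : ℝ) 1, G t := by
  have hd' : (0 : ℝ) < d := by exact_mod_cast hd
  have h := sum_lintegral_Icc_div hd fun x => G (triangle (d * x - m))
  have h2 : ∀ l ∈ Finset.range d, ∫⁻ t in Icc (0 : ℝ) 1, G (triangle (d * ((l + t) / d) - m)) =
      ∫⁻ t in Icc (0 : ℝ) 1, G t := by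
    intro l _
    have e : ∀ t : ℝ, (d : ℝ) * ((l + t) / d) - m = ((l - m : ℤ) : ℝ) + t := by
      intro t; push_cast; field_simp; ring
    simp only [e]
    by_cases hp : Even ((l : ℤ) - m)
    · exact setLIntegral_congr_fun measurableSet_Icc fun t ht => by
        simp only [triangle_even_add hp ht.1 ht.2]
    · refine Eq.trans ?_ (lintegral_Icc_one_sub G)
      exact setLIntegral_congr_fun measurableSet_Icc fun t ht => by
        simp only [triangle_odd_add hp ht.1 ht.2]
  rw [Finset.sum_congr rfl h2, Finset.sum_const, Finset.card_range, nsmul_eq_mul] at h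
  refine ((ENNReal.mul_right_inj ?_ ?_).1 h).symm
  · exact_mod_cast hd.ne'
  · exact ENNReal.natCast_ne_top d

lemma lintegral_unitInterval (G : ℝ → ℝ≥0∞) (hG : Measurable G) :
    ∫⁻ x : I, G x = ∫⁻ x in Icc (0 : ℝ) 1, G x :=
  unitInterval.measurePreserving_coe.lintegral_comp hG

end Interval

/-! ### The measure of the cells. -/

variable (D : LaaksoData)

/-- The measure on `I × K^k`. -/
noncomputable def preMeasure : Measure D.Pre := (volume : Measure I).prod (digitMeasure D.k)

instance : IsProbabilityMeasure D.preMeasure := by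
  unfold preMeasure; infer_instance

lemma continuous_wormholeMap : Continuous D.wormholeMap := continuous_quotient_mk'

lemma measurable_wormholeMap : Measurable D.wormholeMap := D.continuous_wormholeMap.measurable

lemma μ_eq_map : D.μ = Measure.map D.wormholeMap D.preMeasure := rfl

instance : IsProbabilityMeasure D.μ := by
  rw [μ_eq_map]; exact Measure.isProbabilityMeasure_map D.measurable_wormholeMap.aemeasurable

lemma surjective_wormholeMap : Function.Surjective D.wormholeMap := Quotient.mk_surjective

variable {D} {n : ℕ}

/-- The affine parametrization of a block by `I × K^k`. -/
noncomputable def par (S : D.Cell n) (p : D.Pre) : D.Pre :=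
  (⟨((S.1 : ℕ) + (p.1 : ℝ)) / D.d n, by
    have hd : (0 : ℝ) < D.d n := by exact_mod_cast D.d_pos n
    have hS : ((S.1 : ℕ) : ℝ) + 1 ≤ D.d n := by exact_mod_cast S.1.2
    have := p.1.2
    refine ⟨div_nonneg (add_nonneg (Nat.cast_nonneg _) this.1) hd.le, ?_⟩
    rw [div_le_one hd]
    linarith [this.2]⟩, overwrite S.2 p.2)

/-- Foldings of `I × K^k` onto a block, up to a symmetry of the block: the interval is folded,
and the digits are permuted, switched, and overwritten. -/
noncomputable def symFold (S : D.Cell n) (m : ℤ) (τ : Equiv.Perm (Fin D.k))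
    (z : Fin D.k → ℕ → Bool) (p : D.Pre) : D.Pre :=
  (⟨((S.1 : ℕ) + triangle (D.d n * p.1 - m)) / D.d n, by
    have hd : (0 : ℝ) < D.d n := by exact_mod_cast D.d_pos n
    have hS : ((S.1 : ℕ) : ℝ) + 1 ≤ D.d n := by exact_mod_cast S.1.2
    refine ⟨div_nonneg (add_nonneg (Nat.cast_nonneg _) (abs_nonneg _)) hd.le, ?_⟩
    rw [div_le_one hd]
    linarith [triangle_le (D.d n * p.1 - m)]⟩,
    overwrite S.2 (switchDigits z fun c => p.2 (τ c)))

lemma measurable_triangle : Measurable triangle := by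
  unfold triangle
  have : Measurable (fun t : ℝ => round t) := by
    simp only [round_eq]
    fun_prop
  fun_prop

lemma measurable_par (S : D.Cell n) : Measurable (par S) := by
  refine Measurable.prodMk (Measurable.subtype_mk ?_) ((measurable_overwrite _).comp measurable_snd)
  fun_prop

lemma measurable_symFold (S : D.Cell n) (m : ℤ) (τ : Equiv.Perm (Fin D.k))
    (z : Fin D.k → ℕ → Bool) : Measurable (symFold S m τ z) := by
  refine Measurable.prodMk (Measurable.subtype_mk ?_) ?_
  · have := measurable_triangle
    fun_prop
  · exact (measurable_overwrite _).comp ((measurePreserving_switchDigits z).measurable.comp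
      ((measurePreserving_permCoords τ).measurable.comp measurable_snd))

/-- Extending heights to ℝ by `projIcc` makes the one-dimensional substitution rules applicable to
inner integrals over the digits. -/
lemma measurable_lintegral_projIcc {F : D.Pre → ℝ≥0∞} (hF : Measurable F)
    {g : (Fin D.k → ℕ → Bool) → (Fin D.k → ℕ → Bool)} (hg : Measurable g) :
    Measurable fun x : ℝ => ∫⁻ w, F (projIcc 0 1 zero_le_one x, g w) ∂digitMeasure D.k := by
  refine Measurable.lintegral_prod_right'
    (f := fun q : ℝ × (Fin D.k → ℕ → Bool) => F (projIcc 0 1 zero_le_one q.1, g q.2)) ?_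
  exact hF.comp ((continuous_projIcc.measurable.comp measurable_fst).prodMk
    (hg.comp measurable_snd))

/-- The integral over the image of a block, as an iterated integral. -/
lemma lintegral_par (S : D.Cell n) {F : D.Pre → ℝ≥0∞} (hF : Measurable F) :
    ∫⁻ p, F (par S p) ∂D.preMeasure = ∫⁻ t in Icc (0 : ℝ) 1,
      ∫⁻ w, F (projIcc 0 1 zero_le_one (((S.1 : ℕ) + t) / D.d n), overwrite S.2 w)
        ∂digitMeasure D.k := by
  rw [← lintegral_unitInterval (fun t => ∫⁻ w, F (projIcc 0 1 zero_le_one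
    (((S.1 : ℕ) + t) / D.d n), overwrite S.2 w) ∂digitMeasure D.k)]
  · unfold preMeasure
    rw [lintegral_prod (fun p => F (par S p)) (hF.comp (measurable_par S)).aemeasurable]
    refine lintegral_congr fun x => lintegral_congr fun w => ?_
    congr 1
    exact Prod.ext (projIcc_of_mem zero_le_one (par S (x, w)).1.2).symm rfl
  · exact (measurable_lintegral_projIcc hF (measurable_overwrite S.2)).comp
      ((measurable_const.add measurable_id).div_const _)

/-- Switching and permuting digits preserve the Bernoulli measures, and the fold preserves Lebesgue
measure. So all these foldings distribute the measure over the block in the same way, whatever the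
symmetry. -/
lemma lintegral_symFold (S : D.Cell n) (m : ℤ) (τ : Equiv.Perm (Fin D.k))
    (z : Fin D.k → ℕ → Bool) {F : D.Pre → ℝ≥0∞} (hF : Measurable F) :
    ∫⁻ p, F (symFold S m τ z p) ∂D.preMeasure = ∫⁻ p, F (par S p) ∂D.preMeasure := by
  have hmeas := (measurable_lintegral_projIcc hF (measurable_overwrite S.2))
  have h1 : ∀ x : I, ∫⁻ w, F (symFold S m τ z (x, w)) ∂digitMeasure D.k =
      ∫⁻ w, F (projIcc 0 1 zero_le_one (((S.1 : ℕ) + triangle (D.d n * x - m)) / D.d n),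
        overwrite S.2 w) ∂digitMeasure D.k := by
    intro x
    have e : ∀ w, symFold S m τ z (x, w) =
        (projIcc 0 1 zero_le_one (((S.1 : ℕ) + triangle (D.d n * x - m)) / D.d n),
          overwrite S.2 (switchDigits z fun c => w (τ c))) := fun w =>
      Prod.ext (projIcc_of_mem zero_le_one (symFold S m τ z (x, w)).1.2).symm rfl
    simp only [e]
    have hm : Measurable fun w => F (projIcc 0 1 zero_le_one
        (((S.1 : ℕ) + triangle (D.d n * x - m)) / D.d n), overwrite S.2 w) :=
      hF.comp (measurable_const.prodMk (measurable_overwrite S.2))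
    exact ((measurePreserving_switchDigits z).comp
      (measurePreserving_permCoords τ)).lintegral_comp hm
  rw [lintegral_par S hF, ← lintegral_triangle (D.d_pos n) m (fun t => ∫⁻ w,
    F (projIcc 0 1 zero_le_one (((S.1 : ℕ) + t) / D.d n), overwrite S.2 w) ∂digitMeasure D.k)]
  rw [← lintegral_unitInterval]
  · unfold preMeasure
    rw [lintegral_prod (fun p => F (symFold S m τ z p))
      (hF.comp (measurable_symFold S m τ z)).aemeasurable]
    exact lintegral_congr h1
  · exact hmeas.comp (((measurable_const.add (measurable_triangle.comp
      ((measurable_const.mul measurable_id).sub_const _)))).div_const _)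

/-- The measure of `I × K^k` is the average of its images in the blocks of a level. -/
lemma sum_lintegral_par (n : ℕ) {F : D.Pre → ℝ≥0∞} (hF : Measurable F) :
    ∑ S : D.Cell n, ∫⁻ p, F (par S p) ∂D.preMeasure =
      Fintype.card (D.Cell n) * ∫⁻ p, F p ∂D.preMeasure := by
  have hmeas : ∀ a : Fin D.k → Fin n → Bool, Measurable fun x : ℝ => ∫⁻ w,
      F (projIcc 0 1 zero_le_one x, overwrite a w) ∂digitMeasure D.k := fun a =>
    measurable_lintegral_projIcc hF (measurable_overwrite a)
  simp only [lintegral_par _ hF]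
  rw [Fintype.sum_prod_type_right]
  have h1 : ∀ a : Fin D.k → Fin n → Bool, ∑ i : Fin (D.d n), ∫⁻ t in Icc (0 : ℝ) 1,
      ∫⁻ w, F (projIcc 0 1 zero_le_one (((i : ℕ) + t) / D.d n), overwrite a w)
        ∂digitMeasure D.k = D.d n * ∫⁻ x in Icc (0 : ℝ) 1,
      ∫⁻ w, F (projIcc 0 1 zero_le_one x, overwrite a w) ∂digitMeasure D.k := by
    intro a
    rw [← sum_lintegral_Icc_div (D.d_pos n), Finset.sum_range]
  simp only [h1]
  rw [← Finset.mul_sum, ← lintegral_finsetSum _ fun a _ => hmeas a]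
  have h2 : ∀ x : ℝ, ∑ a : Fin D.k → Fin n → Bool,
      ∫⁻ w, F (projIcc 0 1 zero_le_one x, overwrite a w) ∂digitMeasure D.k =
      Fintype.card (Fin D.k → Fin n → Bool) *
        ∫⁻ w, F (projIcc 0 1 zero_le_one x, w) ∂digitMeasure D.k := fun x =>
    sum_lintegral_overwrite (hF.comp (measurable_const.prodMk measurable_id))
  simp only [h2]
  have hm3 := measurable_lintegral_projIcc hF measurable_id
  simp only [id] at hm3
  rw [lintegral_const_mul _ hm3, ← mul_assoc, ← lintegral_unitInterval _ hm3]
  congr 1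
  · rw [Fintype.card_prod, Fintype.card_fin]; push_cast; rfl
  · unfold preMeasure
    rw [lintegral_prod _ hF.aemeasurable]
    simp only [projIcc_val]

end LaaksoData

/-! ### Cells and piecewise affine functions -/

namespace LaaksoData

variable {D : LaaksoData} {n : ℕ}

lemma d_pos_real (n : ℕ) : (0 : ℝ) < D.d n := by exact_mod_cast D.d_pos n

lemma lt_d (n : ℕ) : n < D.d n := by
  refine n.lt_two_pow_self.trans_le ?_
  unfold d
  refine (Finset.pow_card_le_prod (Finset.range n) D.js 2 fun i _ => ?_).trans' (by simp)
  have := D.two_le_j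
  rcases D.js_mem i with h | h <;> omega

lemma tendsto_inv_d : Tendsto (fun n => (1 : ℝ) / D.d n) atTop (𝓝 0) := by
  have h : Tendsto (fun n => (D.d n : ℝ)) atTop atTop :=
    tendsto_natCast_atTop_atTop.comp (tendsto_atTop_mono (fun n => (lt_d n).le) tendsto_id)
  simpa [Function.comp_def] using tendsto_inv_atTop_zero.comp h

/-- The part of a block over the open interval. -/
def openBlock (S : D.Cell n) : Set D.Pre :=
  {p | ((S.1 : ℕ) : ℝ) / D.d n < p.1 ∧ (p.1 : ℝ) < ((S.1 : ℕ) + 1 : ℝ) / D.d n ∧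
    ∀ c (m : Fin n), p.2 c m = S.2 c m}

/-- The part of a cell over the open interval. -/
def openCell (S : D.Cell n) : Set D.Space := D.wormholeMap '' openBlock S

lemma openBlock_subset (S : D.Cell n) : openBlock S ⊆ block S :=
  fun _ h => ⟨h.1.le, h.2.1.le, h.2.2⟩

lemma mem_block_iff {S : D.Cell n} {p : D.Pre} :
    p ∈ block S ↔ ((S.1 : ℕ) : ℝ) ≤ p.1 * D.d n ∧ (p.1 : ℝ) * D.d n ≤ (S.1 : ℕ) + 1 ∧
      ∀ c (m : Fin n), p.2 c m = S.2 c m := by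
  unfold block
  rw [mem_ofPred_eq, div_le_iff₀ (d_pos_real n), le_div_iff₀ (d_pos_real n)]

lemma mem_openBlock_iff {S : D.Cell n} {p : D.Pre} :
    p ∈ openBlock S ↔ ((S.1 : ℕ) : ℝ) < p.1 * D.d n ∧ (p.1 : ℝ) * D.d n < (S.1 : ℕ) + 1 ∧
      ∀ c (m : Fin n), p.2 c m = S.2 c m := by
  unfold openBlock
  rw [mem_ofPred_eq, div_lt_iff₀ (d_pos_real n), lt_div_iff₀ (d_pos_real n)]

lemma wormholeMap_eq_iff {p q : D.Pre} : D.wormholeMap p = D.wormholeMap q ↔ D.Rel p q :=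
  Quotient.eq (r := D.setoid)

/-- The height of a wormhole of level at most `n` is a multiple of `1 / d_n`. -/
lemma Rel.int_or_digits {p q : D.Pre} (h : D.Rel p q) (n : ℕ) :
    p.1 = q.1 ∧ ((∃ z : ℤ, (p.1 : ℝ) * D.d n = z) ∨ ∀ c, ∀ m < n, p.2 c m = q.2 c m) := by
  rcases h with rfl | ⟨h, l, hl, hw⟩
  · exact ⟨rfl, Or.inr fun _ _ _ => rfl⟩
  · refine ⟨h, ?_⟩
    rcases lt_or_ge l n with hln | hln
    · exact Or.inl (D.mem_wormholes.1 (D.wormholes_mono hln hl.1)).2.2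
    · exact Or.inr fun c m hm => hw c m (by omega)

lemma not_int_of_mem_openBlock {S : D.Cell n} {p : D.Pre} (hp : p ∈ openBlock S) :
    ¬ ∃ z : ℤ, (p.1 : ℝ) * D.d n = z := by
  rintro ⟨z, hz⟩
  rw [mem_openBlock_iff, hz] at hp
  have h1 : ((S.1 : ℕ) : ℤ) < z := by exact_mod_cast hp.1
  have h2 : z < ((S.1 : ℕ) : ℤ) + 1 := by exact_mod_cast hp.2.1
  omega

/-- A wormhole that switches one of the first n digits sits at a height i / d_n, which the open
block avoids; all others respect the block. Thus open blocks are saturated, and open cells are open.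
-/
lemma preimage_openCell (S : D.Cell n) : D.wormholeMap ⁻¹' openCell S = openBlock S := by
  refine Subset.antisymm ?_ (subset_preimage_image _ _)
  rintro p ⟨q, hq, hqp⟩
  obtain ⟨h1, h2⟩ := Rel.int_or_digits (wormholeMap_eq_iff.1 hqp) n
  have h3 := h2.resolve_left (not_int_of_mem_openBlock hq)
  refine ⟨h1 ▸ hq.1, h1 ▸ hq.2.1, fun c m => ?_⟩
  rw [← h3 c m m.2, hq.2.2]

lemma isOpen_digits_eq (a : Fin D.k → Fin n → Bool) :
    IsOpen {p : D.Pre | ∀ c (m : Fin n), p.2 c m = a c m} := by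
  simp only [ofPred_forall]
  refine isOpen_iInter_of_finite fun c => isOpen_iInter_of_finite fun m => ?_
  exact (isOpen_discrete {a c m}).preimage
    (f := fun p : D.Pre => p.2 c m) (by fun_prop)

lemma isClosed_digits_eq (a : Fin D.k → Fin n → Bool) :
    IsClosed {p : D.Pre | ∀ c (m : Fin n), p.2 c m = a c m} := by
  simp only [ofPred_forall]
  refine isClosed_iInter fun c => isClosed_iInter fun m => ?_
  exact (isClosed_discrete {a c m}).preimage
    (f := fun p : D.Pre => p.2 c m) (by fun_prop)

lemma isOpen_openBlock (S : D.Cell n) : IsOpen (openBlock S) := by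
  have h : openBlock S = {p : D.Pre | ((S.1 : ℕ) : ℝ) / D.d n < p.1} ∩
      ({p : D.Pre | (p.1 : ℝ) < ((S.1 : ℕ) + 1 : ℝ) / D.d n} ∩
      {p : D.Pre | ∀ c (m : Fin n), p.2 c m = S.2 c m}) := rfl
  rw [h]
  exact (isOpen_lt (by fun_prop) (by fun_prop)).inter
    ((isOpen_lt (by fun_prop) (by fun_prop)).inter (isOpen_digits_eq _))

lemma isClosed_block (S : D.Cell n) : IsClosed (block S) := by
  have h : block S = {p : D.Pre | ((S.1 : ℕ) : ℝ) / D.d n ≤ p.1} ∩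
      ({p : D.Pre | (p.1 : ℝ) ≤ ((S.1 : ℕ) + 1 : ℝ) / D.d n} ∩
      {p : D.Pre | ∀ c (m : Fin n), p.2 c m = S.2 c m}) := rfl
  rw [h]
  exact (isClosed_le (by fun_prop) (by fun_prop)).inter
    ((isClosed_le (by fun_prop) (by fun_prop)).inter (isClosed_digits_eq _))

lemma isOpen_openCell (S : D.Cell n) : IsOpen (openCell S) := by
  have : IsOpen (D.wormholeMap ⁻¹' openCell S) := by
    rw [preimage_openCell]; exact isOpen_openBlock S
  exact isOpen_coinduced.2 this

lemma openBlock_unique {S S' : D.Cell n} {p : D.Pre} (h : p ∈ openBlock S) (h' : p ∈ block S') :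
    S = S' := by
  rw [mem_openBlock_iff] at h
  rw [mem_block_iff] at h'
  have h1 : ((S.1 : ℕ) : ℝ) < (S'.1 : ℕ) + 1 := by linarith [h.1, h'.2.1]
  have h2 : ((S'.1 : ℕ) : ℝ) < (S.1 : ℕ) + 1 := by linarith [h.2.1, h'.1]
  have h1' : (S.1 : ℕ) < (S'.1 : ℕ) + 1 := by exact_mod_cast h1
  have h2' : (S'.1 : ℕ) < (S.1 : ℕ) + 1 := by exact_mod_cast h2
  refine Prod.ext (Fin.ext (by omega)) ?_
  funext c m
  rw [← h.2.2 c m, h'.2.2 c m]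

lemma exists_mem_block (n : ℕ) (p : D.Pre) : ∃ S : D.Cell n, p ∈ block S := by
  have hd := d_pos_real (D := D) n
  have hp := p.1.2
  -- At height 1 the floor is d_n, one more than the last admissible index.
  rcases hp.2.eq_or_lt with h1 | h1
  · refine ⟨(⟨D.d n - 1, Nat.sub_lt (D.d_pos n) one_pos⟩, fun c m => p.2 c m), ?_⟩
    rw [mem_block_iff, h1]
    have h2 : ((D.d n - 1 : ℕ) : ℝ) = D.d n - 1 := by
      rw [Nat.cast_sub (D.d_pos n)]; simp
    simp [h2]
  · have h0 : 0 ≤ (p.1 : ℝ) * D.d n := mul_nonneg hp.1 hd.le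
    refine ⟨(⟨⌊(p.1 : ℝ) * D.d n⌋₊, ?_⟩, fun c m => p.2 c m), ?_⟩
    · rw [Nat.floor_lt h0]
      nlinarith
    · rw [mem_block_iff]
      exact ⟨Nat.floor_le h0, (Nat.lt_floor_add_one _).le, fun _ _ => rfl⟩

lemma exists_mem_openBlock {p : D.Pre} (hp : ¬ ∃ z : ℤ, (p.1 : ℝ) * D.d n = z) :
    ∃ S : D.Cell n, p ∈ openBlock S := by
  obtain ⟨S, hS⟩ := exists_mem_block n p
  refine ⟨S, ?_⟩
  rw [mem_block_iff] at hS
  rw [mem_openBlock_iff]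
  refine ⟨hS.1.lt_of_ne fun h => hp ⟨(S.1 : ℕ), by rw [← h]; simp⟩,
    hS.2.1.lt_of_ne fun h => hp ⟨(S.1 : ℕ) + 1, by rw [h]; push_cast; ring⟩, hS.2.2⟩

lemma ae_height {s : Set ℝ} (hs : s.Countable) : ∀ᵐ p ∂D.preMeasure, (p.1 : ℝ) ∉ s := by
  have h : volume (((↑) : I → ℝ) ⁻¹' s) = 0 :=
    (hs.preimage Subtype.val_injective).measure_zero _
  have h2 : ∀ᵐ x : I, (x : ℝ) ∉ s := by
    rw [ae_iff]; simpa [preimage] using h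
  exact Measure.quasiMeasurePreserving_fst.ae h2

lemma ae_not_int (n : ℕ) : ∀ᵐ p ∂D.preMeasure, ¬ ∃ z : ℤ, (p.1 : ℝ) * D.d n = z := by
  have hc : (range fun z : ℤ => (z : ℝ) / D.d n).Countable := countable_range _
  filter_upwards [ae_height hc] with p hp
  rintro ⟨z, hz⟩
  exact hp ⟨z, by simp only [← hz]; exact mul_div_cancel_right₀ _ (d_pos_real n).ne'⟩

lemma ae_exists_mem_openBlock (n : ℕ) : ∀ᵐ p ∂D.preMeasure, ∃ S : D.Cell n, p ∈ openBlock S := by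
  filter_upwards [ae_not_int n] with p hp using exists_mem_openBlock hp

lemma ae_par_mem_openBlock (S : D.Cell n) : ∀ᵐ p ∂D.preMeasure, par S p ∈ openBlock S := by
  filter_upwards [ae_height (D := D) (s := {0, 1}) (by simp)] with p hp
  rw [mem_openBlock_iff]
  have hd := d_pos_real (D := D) n
  have e : ((par S p).1 : ℝ) * D.d n = (S.1 : ℕ) + p.1 := by
    simp only [par]; field_simp
  have h0 := p.1.2.1.lt_of_ne fun h => hp (Or.inl h.symm)
  have h1 := p.1.2.2.lt_of_ne fun h => hp (Or.inr h)
  rw [e]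
  exact ⟨by linarith, by linarith, fun c m => overwrite_apply_lt _ _ _ _⟩

/-- The locally constant function with prescribed values on the open cells, and `0` elsewhere. -/
noncomputable def grad (v : D.Cell n → ℝ) (x : D.Space) : ℝ :=
  ∑ S : D.Cell n, (openCell S).indicator (fun _ => v S) x

lemma measurable_grad (v : D.Cell n → ℝ) : Measurable (grad v) := by
  unfold grad
  exact Finset.measurable_fun_sum _ fun S _ =>
    measurable_const.indicator (isOpen_openCell S).measurableSet

lemma grad_wormholeMap {v : D.Cell n → ℝ} {S : D.Cell n} {p : D.Pre} (hp : p ∈ openBlock S) :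
    grad v (D.wormholeMap p) = v S := by
  unfold grad
  rw [Finset.sum_eq_single S]
  · exact indicator_of_mem (mem_image_of_mem _ hp) _
  · intro S' _ hS'
    refine indicator_of_notMem (fun h => hS' ?_) _
    have : p ∈ D.wormholeMap ⁻¹' openCell S' := h
    rw [preimage_openCell] at this
    exact openBlock_unique this (openBlock_subset _ hp)
  · simp

lemma grad_of_mem {v : D.Cell n → ℝ} {S : D.Cell n} {x : D.Space} (hx : x ∈ openCell S) :
    grad v x = v S := by
  obtain ⟨p, hp, rfl⟩ := hx
  exact grad_wormholeMap hp

/-- `f` is affine in the height on each cell of level `n`, with the slope `v S` on the cell `S`. -/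
def IsPiecewiseAffine (f : D.Space → ℝ) (v : D.Cell n → ℝ) : Prop :=
  ∀ S : D.Cell n, ∀ p ∈ block S, ∀ q ∈ block S,
    f (D.wormholeMap q) - f (D.wormholeMap p) = v S * ((q.1 : ℝ) - p.1)

lemma continuous_iff_wormholeMap {Y : Type*} [TopologicalSpace Y] {f : D.Space → Y} :
    Continuous f ↔ Continuous fun p => f (D.wormholeMap p) :=
  continuous_coinduced_dom

lemma IsPiecewiseAffine.continuous {f : D.Space → ℝ} {v : D.Cell n → ℝ}
    (h : IsPiecewiseAffine f v) : Continuous f := by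
  rw [continuous_iff_wormholeMap]
  refine (locallyFinite_of_finite (fun S : D.Cell n => block S)).continuous ?_ isClosed_block ?_
  · exact eq_univ_of_forall fun p => mem_iUnion.2 (exists_mem_block n p)
  · intro S
    rcases (block S).eq_empty_or_nonempty with h0 | ⟨p, hp⟩
    · rw [h0]; exact continuousOn_empty _
    · have e : EqOn (fun q => f (D.wormholeMap q))
          (fun q => f (D.wormholeMap p) + v S * ((q.1 : ℝ) - p.1)) (block S) := fun q hq => by
        have := h S p hp q hq
        simp only
        linarith
      refine ContinuousOn.congr ?_ e
      fun_prop

lemma IsPiecewiseAffine.add {f g : D.Space → ℝ} {v w : D.Cell n → ℝ}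
    (hf : IsPiecewiseAffine f v) (hg : IsPiecewiseAffine g w) :
    IsPiecewiseAffine (f + g) (v + w) := fun S p hp q hq => by
  have h1 := hf S p hp q hq
  have h2 := hg S p hp q hq
  simp only [Pi.add_apply]
  linarith

lemma IsPiecewiseAffine.smul {f : D.Space → ℝ} {v : D.Cell n → ℝ} (c : ℝ)
    (hf : IsPiecewiseAffine f v) : IsPiecewiseAffine (c • f) (c • v) := fun S p hp q hq => by
  have h1 := hf S p hp q hq
  simp only [Pi.smul_apply, smul_eq_mul]
  linear_combination c * h1

/-- The cell of level `n` containing a given cell of level `N ≥ n`. -/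
def parent {N : ℕ} (h : n ≤ N) (S : D.Cell N) : D.Cell n :=
  (⟨(S.1 : ℕ) / (D.d N / D.d n), by
    obtain ⟨e, he⟩ := D.d_dvd h
    have hn := D.d_pos n
    have hde : D.d N / D.d n = e := by rw [he, Nat.mul_div_cancel_left _ hn]
    rw [hde]
    exact Nat.div_lt_of_lt_mul ((S.1.2).trans_eq (by rw [he, mul_comm]))⟩, fun c m => S.2 c ⟨m, m.2.trans_le h⟩)

lemma parent_bounds {N : ℕ} (h : n ≤ N) (S : D.Cell N) {x : ℝ} :
    (((S.1 : ℕ) : ℝ) ≤ x * D.d N → (((parent h S).1 : ℕ) : ℝ) ≤ x * D.d n) ∧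
    (x * D.d N ≤ (S.1 : ℕ) + 1 → x * D.d n ≤ ((parent h S).1 : ℕ) + 1) := by
  obtain ⟨e, he⟩ := D.d_dvd h
  have hn := D.d_pos n
  have hN := D.d_pos N
  have he0 : 0 < e := by
    rcases Nat.eq_zero_or_pos e with h0 | h0
    · rw [he, h0] at hN; simp at hN
    · exact h0
  have hq : ((parent h S).1 : ℕ) = (S.1 : ℕ) / e := by
    have hde : D.d N / D.d n = e := by rw [he, Nat.mul_div_cancel_left _ hn]
    simp only [parent]; rw [hde]
  have h1 : (S.1 : ℕ) / e * e ≤ (S.1 : ℕ) := Nat.div_mul_le_self _ _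
  have h2 : (S.1 : ℕ) + 1 ≤ ((S.1 : ℕ) / e + 1) * e := by
    rw [Nat.add_mul, one_mul]
    have := Nat.lt_div_mul_add (a := (S.1 : ℕ)) he0
    omega
  have hcast : (D.d N : ℝ) = D.d n * e := by rw [he]; push_cast; rfl
  rw [hq, hcast]
  have he' : (0 : ℝ) < e := by exact_mod_cast he0
  constructor
  · intro hx
    have h3 : (((S.1 : ℕ) / e : ℕ) : ℝ) * e ≤ (S.1 : ℕ) := by exact_mod_cast h1
    refine le_of_mul_le_mul_right ?_ he'
    linarith
  · intro hx
    have h3 : ((S.1 : ℕ) : ℝ) + 1 ≤ ((((S.1 : ℕ) / e : ℕ) : ℝ) + 1) * e := by exact_mod_cast h2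
    refine le_of_mul_le_mul_right ?_ he'
    linarith

lemma block_subset_parent {N : ℕ} (h : n ≤ N) (S : D.Cell N) : block S ⊆ block (parent h S) := by
  intro p hp
  rw [mem_block_iff] at hp ⊢
  exact ⟨(parent_bounds h S).1 hp.1, (parent_bounds h S).2 hp.2.1, fun c m =>
    hp.2.2 c ⟨m, m.2.trans_le h⟩⟩

lemma IsPiecewiseAffine.refine {N : ℕ} (h : n ≤ N) {f : D.Space → ℝ} {v : D.Cell n → ℝ}
    (hf : IsPiecewiseAffine f v) : IsPiecewiseAffine f fun S : D.Cell N => v (parent h S) :=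
  fun S p hp q hq => hf _ p (block_subset_parent h S hp) q (block_subset_parent h S hq)

lemma ae_μ_of_ae_preMeasure {P : D.Space → Prop} (hP : MeasurableSet {x | P x})
    (h : ∀ᵐ p ∂D.preMeasure, P (D.wormholeMap p)) : ∀ᵐ x ∂D.μ, P x := by
  rw [μ_eq_map]
  exact (ae_map_iff D.measurable_wormholeMap.aemeasurable hP).2 h

lemma ae_preMeasure_of_ae_μ {P : D.Space → Prop} (h : ∀ᵐ x ∂D.μ, P x) :
    ∀ᵐ p ∂D.preMeasure, P (D.wormholeMap p) :=
  ae_of_ae_map D.measurable_wormholeMap.aemeasurable (by rwa [← μ_eq_map])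

/-- Equality may fail at the heights i / d_N interior to coarser cells, where the finer function is
0. -/
lemma grad_parent_ae {N : ℕ} (h : n ≤ N) (v : D.Cell n → ℝ) :
    (grad fun S : D.Cell N => v (parent h S)) =ᵐ[D.μ] grad v := by
  refine ae_μ_of_ae_preMeasure (measurableSet_eq_fun (measurable_grad _) (measurable_grad _)) ?_
  filter_upwards [ae_exists_mem_openBlock (D := D) n, ae_exists_mem_openBlock (D := D) N] with p hp hp'
  obtain ⟨S, hS⟩ := hp
  obtain ⟨S', hS'⟩ := hp'
  rw [grad_wormholeMap hS, grad_wormholeMap hS',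
    openBlock_unique hS (block_subset_parent h S' (openBlock_subset _ hS'))]

/-- Continuous functions oscillate little on small blocks. -/
lemma exists_forall_block_abs_sub_le {ψ : D.Pre → ℝ} (hψ : Continuous ψ) {ε : ℝ} (hε : 0 < ε) :
    ∃ N, ∀ n ≥ N, ∀ S : D.Cell n, ∀ p ∈ block S, ∀ q ∈ block S, |ψ p - ψ q| ≤ ε := by
  by_contra! hcon
  choose ν hν S p hp q hq hlt using hcon
  -- By compactness one sequence of points has a limit along a subsequence; the blocks shrink, so
  -- the other sequence has the same limit, contradicting continuity.
  obtain ⟨x, φ, hφ, hx⟩ := CompactSpace.tendsto_subseq p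
  have hνt : Tendsto (fun l => ν (φ l)) atTop atTop :=
    tendsto_atTop_mono (fun l => (hφ.id_le l).trans (hν (φ l))) tendsto_id
  have hy : Tendsto (q ∘ φ) atTop (𝓝 x) := by
    rw [nhds_prod_eq, tendsto_prod_iff']
    have hx' := (nhds_prod_eq (x := x.1) (y := x.2)) ▸ hx
    rw [tendsto_prod_iff'] at hx'
    constructor
    · rw [tendsto_subtype_rng] at hx' ⊢
      have h0 : Tendsto (fun l => (((q ∘ φ) l).1 : ℝ) - ((p ∘ φ) l).1) atTop (𝓝 0) := by
        refine squeeze_zero_norm (fun l => ?_) ((tendsto_inv_d (D := D)).comp hνt)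
        have h1 := hp (φ l)
        have h2 := hq (φ l)
        simp only [Function.comp, Real.norm_eq_abs]
        have h3 : (((S (φ l)).1 : ℕ) + 1 : ℝ) / D.d (ν (φ l)) =
          ((S (φ l)).1 : ℕ) / D.d (ν (φ l)) + 1 / D.d (ν (φ l)) := add_div _ _ _
        rw [abs_le]
        constructor <;> linarith [h1.1, h1.2.1, h2.1, h2.2.1]
      simpa using h0.add hx'.1
    · rw [tendsto_pi_nhds] at hx' ⊢
      intro c
      have h1 := hx'.2 c
      rw [tendsto_pi_nhds] at h1 ⊢
      intro m
      refine (h1 m).congr' ?_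
      filter_upwards [hνt.eventually_gt_atTop m] with l hl
      exact ((hp (φ l)).2.2 c ⟨m, hl⟩).trans ((hq (φ l)).2.2 c ⟨m, hl⟩).symm
  have h := ((hψ.tendsto x).comp hx).sub ((hψ.tendsto x).comp hy)
  rw [sub_self] at h
  have h2 := h.abs.eventually (gt_mem_nhds (by simpa using hε))
  obtain ⟨l, hl⟩ := h2.exists
  exact absurd hl (not_lt.2 (hlt (φ l)).le)

/-! ### Interpolation between fibre averages. -/

section Interpolation

/-- The average of `f` at a given height over the points with prescribed first digits. -/
noncomputable def fiberAverage (f : D.Space → ℝ) (a : Fin D.k → Fin n → Bool) (x : I) : ℝ :=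
  ∫ w, f (D.wormholeMap (x, overwrite a w)) ∂digitMeasure D.k

/-- The height `i / d_n`. -/
noncomputable def node (D : LaaksoData) (n i : ℕ) : I := projIcc 0 1 zero_le_one ((i : ℝ) / D.d n)

lemma node_of_le {i : ℕ} (h : i ≤ D.d n) : (node D n i : ℝ) = i / D.d n := by
  unfold node
  rw [projIcc_of_mem zero_le_one (x := (i : ℝ) / D.d n)]
  refine ⟨by positivity, ?_⟩
  rw [div_le_one (d_pos_real n)]
  exact_mod_cast h

/-- The interpolation of level `n`, on `I × K^k`. -/
noncomputable def interpPre (n : ℕ) (f : D.Space → ℝ) (p : D.Pre) : ℝ :=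
  let a : Fin D.k → Fin n → Bool := fun c m => p.2 c m
  let i := ⌊(p.1 : ℝ) * D.d n⌋₊
  fiberAverage f a (node D n i) + (p.1 * D.d n - i) *
    (fiberAverage f a (node D n (i + 1)) - fiberAverage f a (node D n i))

lemma interpPre_of_eq (f : D.Space → ℝ) {p : D.Pre} {i : ℕ} (h : (p.1 : ℝ) * D.d n = i) :
    interpPre n f p = fiberAverage f (fun c (m : Fin n) => p.2 c m) p.1 := by
  have hi : node D n i = p.1 := by
    unfold node
    rw [← h, mul_div_cancel_right₀ _ (d_pos_real n).ne', projIcc_val]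
  unfold interpPre
  simp [h, hi]

lemma interpPre_of_mem (f : D.Space → ℝ) {S : D.Cell n} {p : D.Pre} (hp : p ∈ block S) :
    interpPre n f p = fiberAverage f S.2 (node D n S.1) + (p.1 * D.d n - (S.1 : ℕ)) *
      (fiberAverage f S.2 (node D n (S.1 + 1)) - fiberAverage f S.2 (node D n S.1)) := by
  rw [mem_block_iff] at hp
  have ha : (fun c (m : Fin n) => p.2 c m) = S.2 := by funext c m; exact hp.2.2 c m
  -- At the top of the block the floor already belongs to the next interval, but the two formulas
  -- agree at the common node.
  rcases hp.2.1.eq_or_lt with h | h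
  · have h' : (p.1 : ℝ) * D.d n = ((S.1 + 1 : ℕ) : ℝ) := by rw [h]; push_cast; ring
    have hi : node D n (S.1 + 1) = p.1 := by
      unfold node
      rw [← h', mul_div_cancel_right₀ _ (d_pos_real n).ne', projIcc_val]
    rw [interpPre_of_eq f h', ha, h, hi]
    ring
  · have hfl : ⌊(p.1 : ℝ) * D.d n⌋₊ = S.1 := by
      rw [Nat.floor_eq_iff (le_trans (Nat.cast_nonneg _) hp.1)]
      exact ⟨hp.1, h⟩
    unfold interpPre
    simp only [ha, hfl]

/-- The interpolation of level `n` of a function: its values at the heights `i / d_n` are averages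
over the points with given first `n` digits. -/
noncomputable def interp (n : ℕ) (f : D.Space → ℝ) : D.Space → ℝ :=
  Quotient.lift (interpPre n f) (by
    intro p q h
    obtain ⟨h1, h2⟩ := Rel.int_or_digits h n
    rcases h2 with ⟨z, hz⟩ | h2
    · have hz0 : (0 : ℝ) ≤ z := by
        rw [← hz]; exact mul_nonneg p.1.2.1 (d_pos_real n).le
      lift z to ℕ using by exact_mod_cast hz0
      have hz' : (p.1 : ℝ) * D.d n = (z : ℕ) := by rw [hz]; simp
      rw [interpPre_of_eq f hz', interpPre_of_eq f (h1 ▸ hz')]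
      unfold fiberAverage
      congr 1
      funext w
      congr 1
      -- The points obtained by prescribing the digits of p and of q are identified by the same
      -- wormhole, so the integrands agree pointwise.
      refine wormholeMap_eq_iff.2 ?_
      rcases h with rfl | ⟨-, l, hl, hw⟩
      · exact Or.inl rfl
      · refine Or.inr ⟨h1, l, hl, fun c m hm => ?_⟩
        by_cases hmn : m < n <;> simp [overwrite, hmn, hw c m hm]
    · unfold interpPre
      have ha : (fun c (m : Fin n) => p.2 c m) = fun c (m : Fin n) => q.2 c m := by
        funext c m; exact h2 c m m.2
      simp only [ha, h1])

lemma interp_wormholeMap (f : D.Space → ℝ) (p : D.Pre) :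
    interp n f (D.wormholeMap p) = interpPre n f p := rfl

/-- The slopes of the interpolation. -/
noncomputable def interpSlope (n : ℕ) (f : D.Space → ℝ) (S : D.Cell n) : ℝ :=
  D.d n * (fiberAverage f S.2 (node D n (S.1 + 1)) - fiberAverage f S.2 (node D n S.1))

lemma isPiecewiseAffine_interp (n : ℕ) (f : D.Space → ℝ) :
    IsPiecewiseAffine (interp n f) (interpSlope n f) := by
  intro S p hp q hq
  rw [interp_wormholeMap, interp_wormholeMap, interpPre_of_mem f hp, interpPre_of_mem f hq]
  unfold interpSlope
  ring

lemma node_mem_block (S : D.Cell n) (w : Fin D.k → ℕ → Bool) :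
    (node D n S.1, overwrite S.2 w) ∈ block S ∧ (node D n (S.1 + 1), overwrite S.2 w) ∈ block S := by
  have h1 := node_of_le (D := D) (n := n) (i := S.1) S.1.2.le
  have h2 := node_of_le (D := D) (n := n) (i := S.1 + 1) S.1.2
  have hd := d_pos_real (D := D) n
  rw [mem_block_iff, mem_block_iff]
  simp only [h1, h2, div_mul_cancel₀ _ hd.ne']
  refine ⟨⟨le_rfl, by linarith, fun c m => overwrite_apply_lt _ _ _ _⟩, ?_, ?_,
    fun c m => overwrite_apply_lt _ _ _ _⟩ <;> push_cast <;> linarith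

lemma integrable_fiber {f : D.Space → ℝ} (hf : Continuous f) (a : Fin D.k → Fin n → Bool) (x : I) :
    Integrable (fun w => f (D.wormholeMap (x, overwrite a w))) (digitMeasure D.k) := by
  have hc : Continuous fun w => f (D.wormholeMap (x, overwrite a w)) :=
    hf.comp (D.continuous_wormholeMap.comp (continuous_const.prodMk (continuous_overwrite a)))
  obtain ⟨C, hC⟩ := isCompact_univ.exists_bound_of_continuousOn hc.continuousOn
  exact Integrable.of_bound hc.aestronglyMeasurable C
    (Eventually.of_forall fun w => hC w (mem_univ w))

lemma abs_fiberAverage_sub_le {f : D.Space → ℝ} (hf : Continuous f) (a : Fin D.k → Fin n → Bool)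
    (x : I) {c ε : ℝ} (h : ∀ w, |f (D.wormholeMap (x, overwrite a w)) - c| ≤ ε) :
    |fiberAverage f a x - c| ≤ ε := by
  unfold fiberAverage
  have e : ∫ w, f (D.wormholeMap (x, overwrite a w)) ∂digitMeasure D.k - c =
      ∫ w, (f (D.wormholeMap (x, overwrite a w)) - c) ∂digitMeasure D.k := by
    rw [integral_sub (integrable_fiber hf a x) (integrable_const c)]
    simp
  rw [e, ← Real.norm_eq_abs]
  refine (norm_integral_le_of_norm_le_const (Eventually.of_forall h)).trans ?_
  simp

/-- On a block the interpolation is a convex combination of two averages of values of f on that same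
block. -/
lemma abs_interp_sub_le {f : D.Space → ℝ} (hf : Continuous f) {ε : ℝ}
    (h : ∀ S : D.Cell n, ∀ p ∈ block S, ∀ q ∈ block S,
      |f (D.wormholeMap p) - f (D.wormholeMap q)| ≤ ε) (x : D.Space) :
    |interp n f x - f x| ≤ ε := by
  obtain ⟨p, rfl⟩ := D.surjective_wormholeMap x
  obtain ⟨S, hS⟩ := exists_mem_block n p
  rw [interp_wormholeMap, interpPre_of_mem f hS]
  have h0 := abs_fiberAverage_sub_le hf S.2 (node D n S.1)
    fun w => h S _ (node_mem_block S w).1 p hS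
  have h1 := abs_fiberAverage_sub_le hf S.2 (node D n (S.1 + 1))
    fun w => h S _ (node_mem_block S w).2 p hS
  rw [mem_block_iff] at hS
  set A := fiberAverage f S.2 (node D n S.1)
  set B := fiberAverage f S.2 (node D n (S.1 + 1))
  set θ : ℝ := p.1 * D.d n - (S.1 : ℕ)
  have hθ0 : 0 ≤ θ := sub_nonneg.2 hS.1
  have hθ1 : θ ≤ 1 := by simp only [θ]; linarith [hS.2.1]
  have e : A + θ * (B - A) - f (D.wormholeMap p) =
      (1 - θ) * (A - f (D.wormholeMap p)) + θ * (B - f (D.wormholeMap p)) := by ring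
  rw [abs_le] at h0 h1 ⊢
  rw [e]
  constructor <;> nlinarith

/-- Continuous functions are uniform limits of their interpolations. -/
lemma exists_forall_abs_interp_sub_le {f : D.Space → ℝ} (hf : Continuous f) {ε : ℝ} (hε : 0 < ε) :
    ∃ N, ∀ n ≥ N, ∀ x, |interp n f x - f x| ≤ ε := by
  obtain ⟨N, hN⟩ := exists_forall_block_abs_sub_le (hf.comp D.continuous_wormholeMap) hε
  exact ⟨N, fun n hn x => abs_interp_sub_le hf (hN n hn) x⟩

/-- If `f` vanishes at the heights `0` and `1`, so do its interpolations. -/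
lemma interp_eq_zero {f : D.Space → ℝ} (hf : ∀ x, D.height x = 0 ∨ D.height x = 1 → f x = 0)
    {x : D.Space} (hx : D.height x = 0 ∨ D.height x = 1) : interp n f x = 0 := by
  obtain ⟨p, rfl⟩ := D.surjective_wormholeMap x
  have hx' : (p.1 : ℝ) = 0 ∨ (p.1 : ℝ) = 1 := hx
  have hi : ∃ i : ℕ, (p.1 : ℝ) * D.d n = i := by
    rcases hx' with h | h
    · exact ⟨0, by simp [h]⟩
    · exact ⟨D.d n, by simp [h]⟩
  obtain ⟨i, hi⟩ := hi
  rw [interp_wormholeMap, interpPre_of_eq f hi]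
  unfold fiberAverage
  have : ∀ w, f (D.wormholeMap (p.1, overwrite (fun c (m : Fin n) => p.2 c m) w)) = 0 :=
    fun w => hf _ hx
  simp [this]

end Interpolation

end LaaksoData

/-! ### Rectifiable paths -/

namespace LaaksoData

variable {D : LaaksoData} {n : ℕ}

lemma continuous_height : Continuous D.height :=
  continuous_iff_wormholeMap.2 (continuous_subtype_val.comp continuous_fst)

/-- The variation of a path with respect to the geodesic metric. -/
noncomputable abbrev geodesicVariation (γ : ℝ → D.Space) (s : Set ℝ) : ℝ≥0∞ :=
  letI := D.geodesicMetric
  eVariationOn γ s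

/-- The variation of the height along a path. -/
noncomputable abbrev heightVariation (γ : ℝ → D.Space) (s : Set ℝ) : ℝ≥0∞ :=
  eVariationOn (fun t => D.height (γ t)) s

lemma edist_height_le (x y : D.Space) :
    edist (D.height x) (D.height y) ≤ D.geodesicMetric.edist x y := by
  refine le_iInf fun γ => ?_
  have := eVariationOn.edist_le (fun t : I => D.height (γ t)) (mem_univ (0 : I)) (mem_univ (1 : I))
  simpa using this

lemma geodesic_edist_le {γ : ℝ → D.Space} {s t : ℝ} (hst : s ≤ t) (hγ : ContinuousOn γ (Icc s t)) :
    D.geodesicMetric.edist (γ s) (γ t) ≤ heightVariation γ (Icc s t) := by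
  have hm : ∀ u : I, s + u * (t - s) ∈ Icc s t := fun u =>
    ⟨by nlinarith [u.2.1], by nlinarith [u.2.2]⟩
  refine iInf_le_of_le
    { toFun := fun u : I => γ (s + u * (t - s))
      continuous_toFun := hγ.comp_continuous (by fun_prop) hm
      source' := by simp
      target' := by simp } ?_
  exact eVariationOn.comp_le_of_monotoneOn (fun u => D.height (γ u))
    (fun u : I => s + (u : ℝ) * (t - s))
    (fun a _ b _ hab => by
      have : (a : ℝ) ≤ b := hab
      simp only
      nlinarith) (fun u _ => hm u)

/-- The distance between two points of the path is at most the height variation of the subpath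
joining them, and conversely the height is 1-Lipschitz. So arc length is computed from a real-valued
function. -/
lemma geodesicVariation_eq {γ : ℝ → D.Space} {s t : ℝ} (hγ : ContinuousOn γ (Icc s t)) :
    geodesicVariation γ (Icc s t) = heightVariation γ (Icc s t) := by
  refine le_antisymm (iSup_le ?_) ?_
  · rintro ⟨m, u, hu, hus⟩
    calc ∑ i ∈ Finset.range m, D.geodesicMetric.edist (γ (u (i + 1))) (γ (u i))
        ≤ ∑ i ∈ Finset.range m, heightVariation γ (Icc (u i) (u (i + 1))) := by
          refine Finset.sum_le_sum fun i _ => ?_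
          rw [D.geodesicMetric.edist_comm]
          exact geodesic_edist_le (hu i.le_succ)
            (hγ.mono (Icc_subset_Icc (hus i).1 (hus (i + 1)).2))
      _ = heightVariation γ (Icc (u 0) (u m)) := eVariationOn.sum' _ hu
      _ ≤ _ := eVariationOn.mono _ (Icc_subset_Icc (hus 0).1 (hus m).2)
  · let := D.geodesicMetric
    have h : LipschitzOnWith 1 D.height univ := fun x _ y _ => by
      simpa using edist_height_le x y
    simpa using! h.comp_eVariationOn_le (mapsTo_univ γ (Icc s t))

/-- The arc length parametrization of a rectifiable path. -/
lemma exists_arcLength {γ : ℝ → D.Space} (hγ : ContinuousOn γ (Icc 0 1))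
    (hl : D.pathLength γ ≠ ∞) :
    ∃ V ζ : ℝ → ℝ, V 0 = 0 ∧ ContinuousOn V (Icc 0 1) ∧
      (∀ s t, 0 ≤ s → s ≤ t → t ≤ 1 → V s ≤ V t ∧
        ENNReal.ofReal (V t - V s) = heightVariation γ (Icc s t)) ∧
      (∀ s ∈ Icc 0 (V 1), ζ s ∈ Icc (0 : ℝ) 1 ∧ V (ζ s) = s) ∧
      ∀ g, D.pathIntegral γ g = ∫⁻ s in Icc 0 (V 1), g (γ (ζ s)) := by
  let := D.geodesicMetric
  have hbv : BoundedVariationOn (fun t => D.height (γ t)) (Icc 0 1) := by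
    unfold BoundedVariationOn
    have := geodesicVariation_eq hγ
    unfold heightVariation at this
    rw [← this]
    exact hl
  have hloc : LocallyBoundedVariationOn γ (Icc 0 1) :=
    BoundedVariationOn.locallyBoundedVariationOn (f := γ) hl
  set V := variationOnFromTo γ (Icc 0 1) 0 with hV
  have h0 : V 0 = 0 := variationOnFromTo.self _ _ _
  have hdiff : ∀ s t, 0 ≤ s → s ≤ t → t ≤ 1 → V t - V s = (heightVariation γ (Icc s t)).toReal := by
    intro s t hs hst ht
    have hI : Icc (0 : ℝ) 1 ∩ Icc s t = Icc s t := inter_eq_right.2 (Icc_subset_Icc hs ht)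
    rw [← geodesicVariation_eq (hγ.mono (Icc_subset_Icc hs ht)), hV,
      variationOnFromTo.sub_right hloc ⟨le_rfl, zero_le_one⟩ ⟨hs.trans hst, ht⟩ ⟨hs, hst.trans ht⟩,
      variationOnFromTo.eq_of_le _ _ hst, hI]
  have hfin : ∀ s t, 0 ≤ s → t ≤ 1 → heightVariation γ (Icc s t) ≠ ∞ := fun s t hs ht =>
    ne_top_of_le_ne_top hbv (eVariationOn.mono _ (Icc_subset_Icc hs ht))
  have hle : ∀ s t, 0 ≤ s → s ≤ t → t ≤ 1 → V s ≤ V t := fun s t hs hst ht => by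
    rw [← sub_nonneg, hdiff s t hs hst ht]; exact ENNReal.toReal_nonneg
  -- The height is continuous and of bounded variation, so its variation over intervals shrinking to
  -- a point tends to 0.
  have hcont : ContinuousOn V (Icc 0 1) := by
    intro t ht
    have hc : ContinuousOn (fun t => D.height (γ t)) (Icc 0 1) :=
      continuous_height.comp_continuousOn hγ
    have hL := hbv.tendsto_eVariationOn_Icc_zero_left (x := t) ((hc t ht).mono inter_subset_left)
    have hR := hbv.tendsto_eVariationOn_Icc_zero_right t ((hc t ht).mono inter_subset_left)
    have hsum := (ENNReal.tendsto_toReal ENNReal.zero_ne_top).comp hL |>.add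
      ((ENNReal.tendsto_toReal ENNReal.zero_ne_top).comp hR)
    simp only [ENNReal.toReal_zero, add_zero] at hsum
    refine tendsto_iff_norm_sub_tendsto_zero.2 (squeeze_zero' (Eventually.of_forall fun _ =>
      norm_nonneg _) ?_ hsum)
    filter_upwards [self_mem_nhdsWithin] with y hy
    have hI : ∀ a b, 0 ≤ a → b ≤ 1 → Icc (0 : ℝ) 1 ∩ Icc a b = Icc a b := fun a b ha hb =>
      inter_eq_right.2 (Icc_subset_Icc ha hb)
    simp only [Function.comp, hI _ _ hy.1 ht.2, hI _ _ ht.1 hy.2]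
    rcases le_total y t with h | h
    · rw [Real.norm_eq_abs, abs_sub_comm, abs_of_nonneg (sub_nonneg.2 (hle y t hy.1 h ht.2)),
        hdiff y t hy.1 h ht.2]
      exact le_add_of_nonneg_right ENNReal.toReal_nonneg
    · rw [Real.norm_eq_abs, abs_of_nonneg (sub_nonneg.2 (hle t y ht.1 h hy.2)),
        hdiff t y ht.1 h hy.2]
      exact le_add_of_nonneg_left ENNReal.toReal_nonneg
  have hone : V 1 = (D.pathLength γ).toReal := by
    have := hdiff 0 1 le_rfl zero_le_one le_rfl
    rw [h0, sub_zero] at this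
    rw [this, ← geodesicVariation_eq hγ]
    rfl
  -- This right inverse is the one inside `naturalParameterization`, so the formula for the path
  -- integral becomes definitional.
  refine ⟨V, @Function.invFunOn _ _ ⟨0⟩ V (Icc 0 1), h0, hcont, fun s t hs hst ht =>
    ⟨hle s t hs hst ht, ?_⟩, fun s hs => ?_, fun g => ?_⟩
  · rw [hdiff s t hs hst ht, ENNReal.ofReal_toReal (hfin s t hs ht)]
  · have hmem : s ∈ V '' Icc 0 1 := by
      refine intermediate_value_Icc zero_le_one hcont ?_
      rwa [h0]
    have : Nonempty ℝ := ⟨0⟩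
    exact Function.invFunOn_pos hmem
  · rw [hone]
    rfl

/-- F - G has nonpositive slopes to the right of every point, so the mean value inequality applies.
One-sided information is enough to cross the break points of piecewise affine functions. -/
lemma le_of_forall_right_le {F G : ℝ → ℝ} {a b : ℝ} (hab : a ≤ b) (hF : ContinuousOn F (Icc a b))
    (hG : ContinuousOn G (Icc a b))
    (h : ∀ x ∈ Ico a b, ∀ᶠ z in 𝓝[>] x, F z - F x ≤ G z - G x) : F b - F a ≤ G b - G a := by
  have := image_le_of_liminf_slope_right_le_deriv_boundary (f := fun x => F x - G x) (a := a) (b := b)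
    (hF.sub hG) (B := fun _ => F a - G a) (B' := fun _ => 0) le_rfl continuousOn_const
    (fun x _ => hasDerivWithinAt_const _ _ _) (fun x hx r hr => by
      refine Eventually.frequently ?_
      filter_upwards [h x hx, self_mem_nhdsWithin] with z hz hxz
      refine lt_of_le_of_lt ?_ hr
      rw [slope_def_field]
      exact div_nonpos_of_nonpos_of_nonneg (by linarith) (sub_nonneg.2 (le_of_lt hxz)))
    ⟨hab, le_rfl⟩
  linarith

/-! ### Slopes of piecewise affine functions as upper gradients. -/

section Upper

variable {f : D.Space → ℝ} {v : D.Cell n → ℝ}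

lemma IsPiecewiseAffine.neg (hf : IsPiecewiseAffine f v) : IsPiecewiseAffine (-f) (-v) := by
  simpa using hf.smul (-1)

lemma exists_mem_block_right {x : ℝ} (hx : 0 ≤ x) (hx1 : x < 1) (w : Fin D.k → ℕ → Bool) :
    ∃ S : D.Cell n, ∃ y > x, ∀ t : I, x ≤ t → (t : ℝ) < y → (t, w) ∈ block S := by
  have hd := d_pos_real (D := D) n
  have h0 : 0 ≤ x * D.d n := by positivity
  refine ⟨(⟨⌊x * D.d n⌋₊, ?_⟩, fun c m => w c m), (⌊x * D.d n⌋₊ + 1) / D.d n, ?_, fun t h1 h2 => ?_⟩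
  · rw [Nat.floor_lt h0]
    nlinarith
  · rw [gt_iff_lt, lt_div_iff₀ hd]
    exact Nat.lt_floor_add_one _
  · rw [lt_div_iff₀ hd] at h2
    rw [mem_block_iff]
    exact ⟨(Nat.floor_le h0).trans (by simp only; nlinarith), h2.le, fun _ _ => rfl⟩

/-- Piecewise affine functions are Lipschitz along vertical lines. -/
lemma IsPiecewiseAffine.sub_line_le (hf : IsPiecewiseAffine f v) {C : ℝ}
    (hC : ∀ S, |v S| ≤ C) (w : Fin D.k → ℕ → Bool) {x y : I} (hxy : x ≤ y) :
    f (D.wormholeMap (y, w)) - f (D.wormholeMap (x, w)) ≤ C * (y - x) := by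
  have hxy' : (x : ℝ) ≤ y := hxy
  have hcF : Continuous fun t : ℝ => f (D.wormholeMap (projIcc 0 1 zero_le_one t, w)) :=
    hf.continuous.comp (D.continuous_wormholeMap.comp (continuous_projIcc.prodMk continuous_const))
  have := le_of_forall_right_le (F := fun t : ℝ => f (D.wormholeMap (projIcc 0 1 zero_le_one t, w)))
    (G := fun t => C * t) hxy' hcF.continuousOn (by fun_prop) (fun t ht => by
      have ht0 : 0 ≤ t := x.2.1.trans ht.1
      have ht1 : t < 1 := ht.2.trans_le y.2.2
      obtain ⟨S, z, hz, h⟩ := exists_mem_block_right (n := n) ht0 ht1 w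
      filter_upwards [Ioo_mem_nhdsGT (lt_min hz ht1)] with u hu
      have hu1 : u < z := hu.2.trans_le (min_le_left _ _)
      have hu2 : u < 1 := hu.2.trans_le (min_le_right _ _)
      have e1 : (projIcc 0 1 zero_le_one t : I) = ⟨t, ht0, ht1.le⟩ := projIcc_of_mem _ _
      have e2 : (projIcc 0 1 zero_le_one u : I) = ⟨u, (ht0.trans hu.1.le), hu2.le⟩ :=
        projIcc_of_mem _ _
      rw [e1, e2, hf S _ (h _ le_rfl hz) _ (h _ hu.1.le hu1), ← mul_sub]
      simp only
      have := (abs_le.1 (hC S)).2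
      have : t < u := hu.1
      nlinarith)
  simpa [← mul_sub] using this

lemma IsPiecewiseAffine.abs_line_sub_le (hf : IsPiecewiseAffine f v) {C : ℝ}
    (hC : ∀ S, |v S| ≤ C) (w : Fin D.k → ℕ → Bool) (x y : I) :
    |f (D.wormholeMap (y, w)) - f (D.wormholeMap (x, w))| ≤ C * |(y : ℝ) - x| := by
  wlog hxy : x ≤ y generalizing x y
  · rw [abs_sub_comm, abs_sub_comm (y : ℝ)]
    exact this y x (le_of_not_ge hxy)
  have hxy' : (x : ℝ) ≤ y := hxy
  rw [abs_of_nonneg (sub_nonneg.2 hxy'), abs_le]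
  have h1 := hf.sub_line_le hC w hxy
  have h2 := hf.neg.sub_line_le (C := C) (by simpa using hC) w hxy
  simp only [Pi.neg_apply] at h2
  constructor <;> linarith

/-- Near a given point, a piecewise affine function is Lipschitz with respect to the height. -/
lemma IsPiecewiseAffine.eventually_abs_sub_le (hf : IsPiecewiseAffine f v) {C : ℝ}
    (hC : ∀ S, |v S| ≤ C) (x : D.Space) :
    ∀ᶠ y in 𝓝 x, |f y - f x| ≤ C * |D.height y - D.height x| := by
  obtain ⟨p, rfl⟩ := D.surjective_wormholeMap x
  -- At the height of p only the first n digits matter, so f takes finitely many values there and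
  -- its value at p is isolated among them.
  have hfin : (range fun a : Fin D.k → Fin n → Bool =>
      f (D.wormholeMap (p.1, overwrite a p.2))).Finite := finite_range _
  have hdig : ∀ w, f (D.wormholeMap (p.1, w)) ∈ range fun a : Fin D.k → Fin n → Bool =>
      f (D.wormholeMap (p.1, overwrite a p.2)) := by
    intro w
    refine ⟨fun c m => w c m, ?_⟩
    obtain ⟨S, hS⟩ := exists_mem_block n (p.1, w)
    have hS' : (p.1, overwrite (fun c (m : Fin n) => w c m) p.2) ∈ block S := by
      refine ⟨hS.1, hS.2.1, fun c m => ?_⟩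
      rw [← hS.2.2 c m]
      exact overwrite_apply_lt (fun c (m : Fin n) => w c m) p.2 c m
    have := hf S _ hS' _ hS
    simp only [sub_self, mul_zero] at this
    simp only
    linarith
  have hclosed := (hfin.subset (sdiff_subset (t := {f (D.wormholeMap p)}))).isClosed
  obtain ⟨ε, hε, hball⟩ := Metric.isOpen_iff.1 hclosed.isOpen_compl (f (D.wormholeMap p)) (by simp)
  have h1 : ∀ᶠ y in 𝓝 (D.wormholeMap p), |f y - f (D.wormholeMap p)| < ε / 2 := by
    have := hf.continuous.continuousAt.eventually (Metric.ball_mem_nhds (f (D.wormholeMap p))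
      (half_pos hε))
    simpa [Real.dist_eq] using this
  have h2 : ∀ᶠ y in 𝓝 (D.wormholeMap p),
      C * |D.height y - D.height (D.wormholeMap p)| < ε / 2 := by
    have hc : Continuous fun y => C * |D.height y - D.height (D.wormholeMap p)| := by
      have := continuous_height (D := D); fun_prop
    exact hc.continuousAt.eventually (gt_mem_nhds (by simpa using half_pos hε))
  filter_upwards [h1, h2] with y hy1 hy2
  obtain ⟨q, rfl⟩ := D.surjective_wormholeMap y
  have h3 := hf.abs_line_sub_le hC q.2 p.1 q.1
  -- The vertical line through q meets the height of p possibly at another point, but f has the same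
  -- value there: the two values are closer than ε.
  have h4 : f (D.wormholeMap (p.1, q.2)) = f (D.wormholeMap p) := by
    by_contra hne
    have h5 : f (D.wormholeMap (p.1, q.2)) ∈ Metric.ball (f (D.wormholeMap p)) ε := by
      rw [Metric.mem_ball, Real.dist_eq]
      have h6 : C * |(q.1 : ℝ) - p.1| < ε / 2 := hy2
      have h7 := abs_sub_le (f (D.wormholeMap (p.1, q.2))) (f (D.wormholeMap q))
        (f (D.wormholeMap p))
      rw [abs_sub_comm] at h3
      have e : D.wormholeMap q = D.wormholeMap (q.1, q.2) := rfl
      rw [← e] at h3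
      linarith
    exact hball h5 ⟨hdig q.2, hne⟩
  rw [h4] at h3
  exact h3

/-- Along a path, the increments of a piecewise affine function are controlled by the variation of
the height. -/
lemma IsPiecewiseAffine.abs_path_sub_le (hf : IsPiecewiseAffine f v) {C : ℝ} (hC : ∀ S, |v S| ≤ C)
    {γ : ℝ → D.Space} {V : ℝ → ℝ} {a b : ℝ} (hab : a ≤ b) (hγ : ContinuousOn γ (Icc a b))
    (hVc : ContinuousOn V (Icc a b))
    (hV : ∀ s t, a ≤ s → s ≤ t → t ≤ b → |D.height (γ t) - D.height (γ s)| ≤ V t - V s) :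
    |f (γ b) - f (γ a)| ≤ C * (V b - V a) := by
  have key : ∀ (g : D.Space → ℝ) (u : D.Cell n → ℝ), IsPiecewiseAffine g u → (∀ S, |u S| ≤ C) →
      g (γ b) - g (γ a) ≤ C * (V b - V a) := by
    intro g u hg hu
    have h := le_of_forall_right_le (F := fun t => g (γ t)) (G := fun t => C * V t) hab
      (hg.continuous.comp_continuousOn hγ) (continuousOn_const.mul hVc) (fun t ht => by
        have h1 : Tendsto γ (𝓝[>] t) (𝓝 (γ t)) := by
          have h2 := hγ t ⟨ht.1, ht.2.le⟩
          refine h2.mono_left ?_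
          rw [← nhdsWithin_Ioc_eq_nhdsGT ht.2]
          exact nhdsWithin_mono _ fun z hz => ⟨ht.1.trans hz.1.le, hz.2⟩
        filter_upwards [h1.eventually (hg.eventually_abs_sub_le hu (γ t)), Ioc_mem_nhdsGT ht.2]
          with z hz hz'
        have hC0 : 0 ≤ C := by
          obtain ⟨S, -⟩ := exists_mem_block (D := D) n (0, fun _ _ => false)
          exact (abs_nonneg _).trans (hC S)
        have h3 := hV t z ht.1 hz'.1.le hz'.2
        have h4 := mul_le_mul_of_nonneg_left h3 hC0
        have h5 := le_abs_self (g (γ z) - g (γ t))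
        linarith)
    linarith
  have h1 := key f v hf hC
  have h2 := key (-f) (-v) hf.neg (by simpa using hC)
  simp only [Pi.neg_apply] at h2
  rw [abs_le]
  constructor <;> linarith

/-- A path that avoids the heights `i / d_n` stays in an open cell. -/
lemma mem_openCell_of_path {γ : ℝ → D.Space} {a b : ℝ} (hab : a ≤ b)
    (hγ : ContinuousOn γ (Icc a b)) {S : D.Cell n} (ha : γ a ∈ openCell S)
    (hint : ∀ t ∈ Icc a b, ¬ ∃ z : ℤ, D.height (γ t) * D.d n = z) : γ b ∈ openCell S := by
  -- The image of the path is connected and, avoiding the heights i / d_n, covered by the disjoint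
  -- open cells.
  have hpre : IsPreconnected (γ '' Icc a b) := isPreconnected_Icc.image γ hγ
  have hsub := hpre.subset_left_of_subset_union (isOpen_openCell S)
    (v := ⋃ S' : D.Cell n, ⋃ _ : S' ≠ S, openCell S')
    (isOpen_iUnion fun S' => isOpen_iUnion fun _ => isOpen_openCell S') ?_ ?_
    ⟨γ a, mem_image_of_mem γ (left_mem_Icc.2 hab), ha⟩
  · exact hsub (mem_image_of_mem γ (right_mem_Icc.2 hab))
  · rw [disjoint_left]
    intro x hx hx'
    simp only [mem_iUnion] at hx'
    obtain ⟨S', hne, hx'⟩ := hx'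
    obtain ⟨p, hp, rfl⟩ := hx
    have hp' : p ∈ D.wormholeMap ⁻¹' openCell S' := hx'
    rw [preimage_openCell] at hp'
    exact hne (openBlock_unique hp' (openBlock_subset _ hp))
  · rintro _ ⟨t, ht, rfl⟩
    obtain ⟨p, hp⟩ := D.surjective_wormholeMap (γ t)
    have hi := hint t ht
    rw [← hp] at hi
    obtain ⟨S', hS'⟩ := exists_mem_openBlock (n := n) (p := p) hi
    rw [← hp]
    by_cases h : S' = S
    · exact Or.inl (h ▸ mem_image_of_mem _ hS')
    · exact Or.inr (mem_iUnion.2 ⟨S', mem_iUnion.2 ⟨h, mem_image_of_mem _ hS'⟩⟩)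

open Classical in
/-- The function that is `|v S|` on the open cell `S`, and `C` off the open cells. -/
noncomputable def gradBound (v : D.Cell n → ℝ) (C : ℝ) (x : D.Space) : ℝ :=
  if x ∈ ⋃ S : D.Cell n, openCell S then |grad v x| else C

lemma measurable_gradBound (v : D.Cell n → ℝ) (C : ℝ) : Measurable (gradBound v C) := by
  unfold gradBound
  exact Measurable.ite (MeasurableSet.iUnion fun S => (isOpen_openCell S).measurableSet)
    (measurable_grad v).abs measurable_const

lemma exists_ball_not_int {x : ℝ} (N : ℕ) (hx : ¬ ∃ z : ℤ, x * N = z) :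
    ∃ ρ > 0, ∀ y, |y - x| < ρ → ¬ ∃ z : ℤ, y * N = z := by
  have hcl : IsClosed (range ((↑) : ℤ → ℝ)) := Int.isClosedEmbedding_coe_real.isClosed_range
  have hop : IsOpen ((fun y : ℝ => y * N) ⁻¹' (range ((↑) : ℤ → ℝ))ᶜ) :=
    hcl.isOpen_compl.preimage (by fun_prop)
  have hx' : x ∈ (fun y : ℝ => y * N) ⁻¹' (range ((↑) : ℤ → ℝ))ᶜ := by
    rintro ⟨z, hz⟩
    exact hx ⟨z, hz.symm⟩
  obtain ⟨ρ, hρ, h⟩ := Metric.isOpen_iff.1 hop x hx'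
  refine ⟨ρ, hρ, fun y hy => ?_⟩
  rintro ⟨z, hz⟩
  exact h (by rwa [Metric.mem_ball, Real.dist_eq]) ⟨z, hz.symm⟩

/-- The modulus of the slope is an upper gradient of a piecewise affine function. -/
theorem IsPiecewiseAffine.isUpperGradient (hf : IsPiecewiseAffine f v) {C : ℝ}
    (hC : ∀ S, |v S| ≤ C) : D.IsUpperGradient f fun x => ENNReal.ofReal (gradBound v C x) := by
  refine ⟨(measurable_gradBound v C).ennreal_ofReal, fun γ hγ hl => ?_⟩
  obtain ⟨V, ζ, hV0, hVc, hV, hζ, hint⟩ := exists_arcLength hγ hl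
  have hC0 : 0 ≤ C := by
    obtain ⟨S, -⟩ := exists_mem_block (D := D) n (0, fun _ _ => false)
    exact (abs_nonneg _).trans (hC S)
  have hh : ∀ s t, 0 ≤ s → s ≤ t → t ≤ 1 →
      |D.height (γ t) - D.height (γ s)| ≤ V t - V s := by
    intro s t hs hst ht
    have h1 := eVariationOn.edist_le (fun t => D.height (γ t)) (s := Icc s t) ⟨hst, le_rfl⟩
      ⟨le_rfl, hst⟩
    obtain ⟨h2, h3⟩ := hV s t hs hst ht
    unfold heightVariation at h3
    rw [← h3, edist_dist, Real.dist_eq, ENNReal.ofReal_le_ofReal_iff (sub_nonneg.2 h2)] at h1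
    exact h1
  have hpath : ∀ s t, 0 ≤ s → s ≤ t → t ≤ 1 → |f (γ t) - f (γ s)| ≤ C * (V t - V s) :=
    fun s t hs hst ht => hf.abs_path_sub_le hC hst (hγ.mono (Icc_subset_Icc hs ht))
      (hVc.mono (Icc_subset_Icc hs ht)) fun s' t' hs' hst' ht' =>
        hh s' t' (hs.trans hs') hst' (ht'.trans ht)
  set l := V 1 with hl1
  have hl0 : 0 ≤ l := by
    have := (hV 0 1 le_rfl zero_le_one le_rfl).1
    rwa [hV0] at this
  have hζmono : ∀ s ∈ Icc 0 l, ∀ t ∈ Icc 0 l, s < t → ζ s ≤ ζ t := by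
    intro s hs t ht hst
    by_contra! hlt
    have := (hV _ _ (hζ t ht).1.1 hlt.le (hζ s hs).1.2).1
    rw [(hζ t ht).2, (hζ s hs).2] at this
    linarith
  -- Along arc length f is Lipschitz, hence absolutely continuous, and its increment is the integral
  -- of a derivative still to be bounded by the local slope.
  set F : ℝ → ℝ := fun s => f (γ (ζ s)) with hF
  have hFle : ∀ s ∈ Icc 0 l, ∀ t ∈ Icc 0 l, |F t - F s| ≤ C * |t - s| := by
    intro s hs t ht
    wlog hst : s < t generalizing s t
    · rcases (not_lt.1 hst).eq_or_lt with rfl | h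
      · simp
      · rw [abs_sub_comm, abs_sub_comm t]; exact this t ht s hs h
    have := hpath _ _ (hζ s hs).1.1 (hζmono s hs t ht hst) (hζ t ht).1.2
    rwa [(hζ s hs).2, (hζ t ht).2, ← abs_of_pos (sub_pos.2 hst)] at this
  have hLip : LipschitzOnWith C.toNNReal F (uIcc 0 l) := by
    rw [uIcc_of_le hl0]
    refine LipschitzOnWith.of_dist_le_mul fun s hs t ht => ?_
    rw [Real.dist_eq, Real.dist_eq, Real.coe_toNNReal _ hC0]
    exact hFle t ht s hs
  have hAC := hLip.absolutelyContinuousOnInterval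
  have hFTC := hAC.integral_deriv_eq_sub
  have hderiv : ∀ s ∈ Ioo 0 l, |deriv F s| ≤ gradBound v C (γ (ζ s)) := by
    intro s hs
    have hsI : s ∈ Icc 0 l := Ioo_subset_Icc_self hs
    unfold gradBound
    split_ifs with hmem
    · rw [mem_iUnion] at hmem
      obtain ⟨S, hS⟩ := hmem
      rw [grad_of_mem hS, ← Real.norm_eq_abs]
      have hni : ¬ ∃ z : ℤ, D.height (γ (ζ s)) * D.d n = z := by
        obtain ⟨p, hp, hpe⟩ := hS
        rw [← hpe]
        exact not_int_of_mem_openBlock hp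
      obtain ⟨ρ, hρ, hball⟩ := exists_ball_not_int _ hni
      refine norm_deriv_le_of_lip' (abs_nonneg _) ?_
      filter_upwards [Ioo_mem_nhds hs.1 hs.2, Metric.ball_mem_nhds s hρ] with t ht htρ
      have htI : t ∈ Icc 0 l := Ioo_subset_Icc_self ht
      rw [Metric.mem_ball, Real.dist_eq] at htρ
      -- The height moves by at most the arc length, which is less than ρ; so between the two
      -- parameters no height i / d_n is met.
      have hclaim : ∀ s' ∈ Icc 0 l, ∀ t' ∈ Icc 0 l, s' < t' → |t' - s'| < ρ → (s' = s ∨ t' = s) →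
          ∀ u ∈ Icc (ζ s') (ζ t'), ¬ ∃ z : ℤ, D.height (γ u) * D.d n = z := by
        intro s' hs' t' ht' hst' hρ' hor u hu
        refine hball _ (lt_of_le_of_lt ?_ hρ')
        rw [abs_of_pos (sub_pos.2 hst')]
        have e1 := (hζ s' hs').2
        have e2 := (hζ t' ht').2
        have hu0 : 0 ≤ u := (hζ s' hs').1.1.trans hu.1
        have hu1 : u ≤ 1 := hu.2.trans (hζ t' ht').1.2
        have h1 := (hV _ _ (hζ s' hs').1.1 hu.1 hu1).1
        have h2 := (hV _ _ hu0 hu.2 (hζ t' ht').1.2).1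
        rcases hor with rfl | rfl
        · have := hh _ _ (hζ s' hs').1.1 hu.1 hu1
          linarith
        · rw [abs_sub_comm]
          have := hh _ _ hu0 hu.2 (hζ t' ht').1.2
          linarith
      have haff : γ (ζ t) ∈ openCell S := by
        rcases lt_trichotomy s t with h | rfl | h
        · exact mem_openCell_of_path (hζmono s hsI t htI h)
            (hγ.mono (Icc_subset_Icc (hζ s hsI).1.1 (hζ t htI).1.2)) hS
            (hclaim s hsI t htI h htρ (Or.inl rfl))
        · exact hS
        -- For t < s the connectedness argument runs from t to s: the open cell containing the point
        -- at t also contains the point at s, hence is S.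
        · have hcl := hclaim t htI s hsI h (by rwa [abs_sub_comm]) (Or.inr rfl)
          have hts := hζmono t htI s hsI h
          have hni' := hcl (ζ t) ⟨le_rfl, hts⟩
          obtain ⟨q, hq⟩ := D.surjective_wormholeMap (γ (ζ t))
          rw [← hq] at hni'
          obtain ⟨S', hS'⟩ := exists_mem_openBlock (n := n) (p := q) hni'
          have hS'' : γ (ζ t) ∈ openCell S' := hq ▸ mem_image_of_mem _ hS'
          have h1 := mem_openCell_of_path hts
            (hγ.mono (Icc_subset_Icc (hζ t htI).1.1 (hζ s hsI).1.2)) hS'' hcl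
          obtain ⟨p, hp, hpe⟩ := hS
          rw [← hpe] at h1
          have h2 : p ∈ D.wormholeMap ⁻¹' openCell S' := h1
          rw [preimage_openCell] at h2
          rwa [← openBlock_unique h2 (openBlock_subset _ hp)]
      obtain ⟨p, hp, hpe⟩ := hS
      obtain ⟨q, hq, hqe⟩ := haff
      have h3 := hf S p (openBlock_subset _ hp) q (openBlock_subset _ hq)
      have h4 : |(q.1 : ℝ) - p.1| ≤ |t - s| := by
        have e1 : D.height (γ (ζ s)) = p.1 := by rw [← hpe]; rfl
        have e2 : D.height (γ (ζ t)) = q.1 := by rw [← hqe]; rfl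
        rw [← e1, ← e2]
        rcases lt_trichotomy s t with h | rfl | h
        · have := hh _ _ (hζ s hsI).1.1 (hζmono s hsI t htI h) (hζ t htI).1.2
          rw [(hζ s hsI).2, (hζ t htI).2] at this
          exact this.trans (le_abs_self _)
        · simp
        · have := hh _ _ (hζ t htI).1.1 (hζmono t htI s hsI h) (hζ s hsI).1.2
          rw [(hζ s hsI).2, (hζ t htI).2] at this
          rw [abs_sub_comm, abs_sub_comm t]
          exact this.trans (le_abs_self _)
      simp only [hF]
      rw [← hpe, ← hqe, h3, Real.norm_eq_abs, Real.norm_eq_abs, abs_mul]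
      exact mul_le_mul_of_nonneg_left h4 (abs_nonneg _)
    -- Off the open cells only the global Lipschitz bound is used; this set is null for μ, so the
    -- constant C does not affect the gradient in L².
    · rw [← Real.norm_eq_abs]
      refine norm_deriv_le_of_lip' hC0 ?_
      filter_upwards [Ioo_mem_nhds hs.1 hs.2] with t ht
      exact hFle s hsI t (Ioo_subset_Icc_self ht)
  -- The right inverse ζ need not return the end points 0 and 1, but γ has zero variation in
  -- between, so f does not see the difference.
  have hend : f (γ 1) - f (γ 0) = F l - F 0 := by
    have h0I : (0 : ℝ) ∈ Icc 0 l := ⟨le_rfl, hl0⟩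
    have hlI : l ∈ Icc 0 l := ⟨hl0, le_rfl⟩
    have h1 := hpath _ _ (hζ l hlI).1.1 (hζ l hlI).1.2 le_rfl
    have h2 := hpath _ _ le_rfl (hζ 0 h0I).1.1 (hζ 0 h0I).1.2
    rw [(hζ l hlI).2, ← hl1, sub_self, mul_zero] at h1
    rw [(hζ 0 h0I).2, hV0, sub_self, mul_zero] at h2
    have h3 := abs_eq_zero.1 (le_antisymm h1 (abs_nonneg _))
    have h4 := abs_eq_zero.1 (le_antisymm h2 (abs_nonneg _))
    simp only [hF]
    linarith
  rw [hint, abs_sub_comm, hend, ← hFTC, ← Real.norm_eq_abs, intervalIntegral.integral_of_le hl0,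
    integral_Ioc_eq_integral_Ioo]
  refine (ofReal_norm _).trans_le ((enorm_integral_le_lintegral_enorm _).trans ?_)
  refine (setLIntegral_mono' measurableSet_Ioo fun s hs => ?_).trans
    (lintegral_mono_set Ioo_subset_Icc_self)
  rw [← ofReal_norm, Real.norm_eq_abs]
  exact ENNReal.ofReal_le_ofReal (hderiv s hs)

end Upper

/-- The upper gradient inequality along vertical lines. -/
theorem IsUpperGradient.le_lintegral_line {f : D.Space → ℝ} {g : D.Space → ℝ≥0∞}
    (h : D.IsUpperGradient f g) (w : Fin D.k → ℕ → Bool) {x y : ℝ} (hx : 0 ≤ x) (hxy : x ≤ y)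
    (hy : y ≤ 1) :
    ENNReal.ofReal |f (D.wormholeMap (projIcc 0 1 zero_le_one x, w)) -
      f (D.wormholeMap (projIcc 0 1 zero_le_one y, w))| ≤
      ∫⁻ t in Icc x y, g (D.wormholeMap (projIcc 0 1 zero_le_one t, w)) := by
  rcases hxy.eq_or_lt with rfl | hlt
  · simp
  set γ : ℝ → D.Space :=
    fun t => D.wormholeMap (projIcc 0 1 zero_le_one (x + t * (y - x)), w) with hγ
  have hcont : Continuous γ := D.continuous_wormholeMap.comp
    ((continuous_projIcc.comp (by fun_prop)).prodMk continuous_const)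
  have hht : ∀ t ∈ Icc (0 : ℝ) 1, D.height (γ t) = x + t * (y - x) := by
    intro t ht
    have : (projIcc 0 1 zero_le_one (x + t * (y - x)) : I) = ⟨x + t * (y - x),
        by nlinarith [ht.1], by nlinarith [ht.2]⟩ := projIcc_of_mem _ _
    simp only [hγ]
    rw [this]
    rfl
  have hmono : MonotoneOn (fun t => D.height (γ t)) (Icc 0 1) := fun s hs t ht hst => by
    simp only
    rw [hht s hs, hht t ht]
    nlinarith
  have hvar : ∀ t ∈ Icc (0 : ℝ) 1, heightVariation γ (Icc 0 t) = ENNReal.ofReal (t * (y - x)) := by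
    intro t ht
    have := hmono.eVariationOn_eq (a := 0) (b := t) ⟨le_rfl, zero_le_one⟩ ht
    rw [inter_eq_right.2 (Icc_subset_Icc le_rfl ht.2), hht t ht, hht 0 ⟨le_rfl, zero_le_one⟩] at this
    rw [heightVariation, this]
    congr 1
    ring
  have hlen : D.pathLength γ ≠ ∞ := by
    have e : D.pathLength γ = heightVariation γ (Icc 0 1) := geodesicVariation_eq hcont.continuousOn
    rw [e, hvar 1 ⟨zero_le_one, le_rfl⟩]
    exact ENNReal.ofReal_ne_top
  obtain ⟨V, ζ, hV0, -, hV, hζ, hint⟩ := exists_arcLength hcont.continuousOn hlen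
  -- The height is affine in t, so the arc length is explicit and inverting it gives back the
  -- vertical line.
  have hVt : ∀ t ∈ Icc (0 : ℝ) 1, V t = t * (y - x) := by
    intro t ht
    obtain ⟨h1, h2⟩ := hV 0 t le_rfl ht.1 ht.2
    rw [hvar t ht, hV0, sub_zero] at h2
    rw [hV0] at h1
    exact (ENNReal.ofReal_eq_ofReal_iff h1 (mul_nonneg ht.1 (sub_nonneg.2 hxy))).1 h2
  have h1 := h.le_integral γ hcont.continuousOn hlen
  rw [hint, hVt 1 ⟨zero_le_one, le_rfl⟩, one_mul] at h1
  have e0 : γ 0 = D.wormholeMap (projIcc 0 1 zero_le_one x, w) := by simp [hγ]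
  have e1 : γ 1 = D.wormholeMap (projIcc 0 1 zero_le_one y, w) := by simp [hγ]
  rw [e0, e1] at h1
  refine h1.trans_eq ?_
  have e2 : ∫⁻ s in Icc 0 (y - x), g (γ (ζ s)) =
      ∫⁻ s in Icc 0 (y - x), g (D.wormholeMap (projIcc 0 1 zero_le_one (x + s), w)) := by
    refine setLIntegral_congr_fun measurableSet_Icc fun s hs => ?_
    have hs' : s ∈ Icc 0 (V 1) := by rwa [hVt 1 ⟨zero_le_one, le_rfl⟩, one_mul]
    obtain ⟨h2, h3⟩ := hζ s hs'
    rw [hVt _ h2] at h3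
    simp only [hγ, h3]
  rw [e2]
  have hmp := (measurePreserving_add_left (volume : Measure ℝ) x).setLIntegral_comp_preimage_emb
    (measurableEmbedding_addLeft x)
    (fun t => g (D.wormholeMap (projIcc 0 1 zero_le_one t, w))) (Icc x y)
  rw [← hmp]
  simp

end LaaksoData

/-! ### Square integrable functions -/

section SquareIntegrable

variable {X : Type*} [MeasurableSpace X] {μ : Measure X}

lemma lintegral_sq_eq (u : Lp ℝ 2 μ) :
    ∫⁻ x, ENNReal.ofReal |u x| ^ 2 ∂μ = ENNReal.ofReal (‖u‖ ^ 2) := by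
  rw [ENNReal.ofReal_pow (norm_nonneg _), Lp.norm_def, ENNReal.ofReal_toReal (Lp.eLpNorm_ne_top u),
    eLpNorm_eq_lintegral_rpow_enorm_toReal (by norm_num) (by norm_num), ← ENNReal.rpow_natCast,
    ← ENNReal.rpow_mul]
  simp only [ENNReal.toReal_ofNat, Nat.cast_ofNat, one_div, ENNReal.rpow_ofNat]
  rw [inv_mul_cancel₀ (by norm_num), ENNReal.rpow_one]
  refine lintegral_congr fun x => ?_
  rw [← Real.norm_eq_abs, ofReal_norm]

lemma tendsto_zero_iff_lintegral_sq {ι : Type*} {l : Filter ι} {w : ι → Lp ℝ 2 μ} :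
    Tendsto w l (𝓝 0) ↔ Tendsto (fun n => ∫⁻ x, ENNReal.ofReal |w n x| ^ 2 ∂μ) l (𝓝 0) := by
  simp only [lintegral_sq_eq]
  rw [tendsto_zero_iff_norm_tendsto_zero]
  constructor
  · intro h
    have := ENNReal.tendsto_ofReal (h.pow 2)
    simpa using this
  · intro h
    have h1 := (ENNReal.tendsto_toReal ENNReal.zero_ne_top).comp h
    simp only [Function.comp_def, ENNReal.toReal_zero, ENNReal.toReal_ofReal (sq_nonneg ‖w _‖)] at h1
    have h2 := (Real.continuous_sqrt.tendsto 0).comp h1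
    simpa [Function.comp_def, Real.sqrt_sq (norm_nonneg _)] using h2

lemma memLp_two_of_lintegral_sq {f : X → ℝ} (hf : AEStronglyMeasurable f μ)
    (h : ∫⁻ x, ENNReal.ofReal |f x| ^ 2 ∂μ ≠ ∞) : MemLp f 2 μ := by
  refine ⟨hf, ?_⟩
  rw [eLpNorm_lt_top_iff_lintegral_rpow_enorm_lt_top (by norm_num) (by norm_num)]
  refine lt_of_le_of_lt (le_of_eq ?_) h.lt_top
  refine lintegral_congr fun x => ?_
  rw [← Real.norm_eq_abs, ofReal_norm]
  simp

lemma lintegral_sq_le_lintegral_sq [IsProbabilityMeasure μ] {f : X → ℝ≥0∞}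
    (hf : AEMeasurable f μ) : (∫⁻ x, f x ∂μ) ^ 2 ≤ ∫⁻ x, f x ^ 2 ∂μ := by
  have h := ENNReal.lintegral_mul_le_Lp_mul_Lq μ Real.HolderConjugate.two_two hf
    (g := fun _ => 1) aemeasurable_const
  simp only [Pi.mul_apply, mul_one, ENNReal.one_rpow, lintegral_const, measure_univ, one_div] at h
  calc (∫⁻ x, f x ∂μ) ^ 2 ≤ ((∫⁻ a, f a ^ (2 : ℝ) ∂μ) ^ (2⁻¹ : ℝ)) ^ 2 := by gcongr
    _ = _ := by
      rw [← ENNReal.rpow_natCast, ← ENNReal.rpow_mul]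
      simp

lemma add_sq_le_two_mul (a b : ℝ≥0∞) : (a + b) ^ 2 ≤ 2 * (a ^ 2 + b ^ 2) := by
  have := ENNReal.rpow_add_le_mul_rpow_add_rpow a b (p := 2) (by norm_num)
  norm_num at this
  exact this

/-- The order interval of square integrable functions bounded by `G` in modulus. -/
lemma convex_Icc_Lp (G : Lp ℝ 2 μ) : Convex ℝ (Icc (-G) G) := by
  intro a ha b hb s t hs ht hst
  have key : ∀ a : Lp ℝ 2 μ, a ∈ Icc (-G) G ↔ ∀ᵐ x ∂μ, |a x| ≤ G x := by
    intro a
    rw [mem_Icc, ← Lp.coeFn_le, ← Lp.coeFn_le]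
    constructor
    · rintro ⟨h1, h2⟩
      filter_upwards [h1, h2, Lp.coeFn_neg G] with x h1 h2 h3
      rw [h3, Pi.neg_apply] at h1
      exact abs_le.2 ⟨h1, h2⟩
    · intro h
      constructor
      · filter_upwards [h, Lp.coeFn_neg G] with x h h3
        rw [h3, Pi.neg_apply]
        exact (abs_le.1 h).1
      · filter_upwards [h] with x h using (abs_le.1 h).2
  rw [key] at ha hb ⊢
  filter_upwards [ha, hb, Lp.coeFn_add (s • a) (t • b), Lp.coeFn_smul s a, Lp.coeFn_smul t b]
    with x h1 h2 h3 h4 h5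
  rw [h3, Pi.add_apply, h4, h5, Pi.smul_apply, Pi.smul_apply, smul_eq_mul, smul_eq_mul]
  rw [abs_le] at h1 h2 ⊢
  have e : G x = s * G x + t * G x := by rw [← add_mul, hst, one_mul]
  rw [e]
  constructor <;> nlinarith

/-- If the moduli of the images of a sequence are asymptotically bounded by `p` in `L²`, then
suitable convex combinations of tails converge, and the limit is bounded by `p`. -/
theorem exists_convexHull_tail_tendsto {E : Type*} [AddCommGroup E] [Module ℝ E]
    (π : E →ₗ[ℝ] Lp ℝ 2 μ) (x : ℕ → E) {p : X → ℝ≥0∞} (hp : AEMeasurable p μ)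
    (hp2 : ∫⁻ a, p a ^ 2 ∂μ ≠ ∞) (R : ℕ → X → ℝ≥0∞)
    (hR : Tendsto (fun n => ∫⁻ a, R n a ^ 2 ∂μ) atTop (𝓝 0))
    (h : ∀ n, ∀ᵐ a ∂μ, ENNReal.ofReal |π (x n) a| ≤ p a + R n a) :
    ∃ (y : ℕ → E) (V : Lp ℝ 2 μ), (∀ n, y n ∈ convexHull ℝ (x '' Ici n)) ∧
      Tendsto (fun n => π (y n)) atTop (𝓝 V) ∧ ∀ᵐ a ∂μ, ENNReal.ofReal |V a| ≤ p a := by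
  have hfin : ∀ᵐ a ∂μ, p a < ∞ := by
    filter_upwards [ae_lt_top' (hp.pow_const 2) hp2] with a ha
    by_contra! h
    rw [top_le_iff.1 h] at ha
    simp at ha
  have hG2 : MemLp (fun a => (p a).toReal) 2 μ := by
    refine memLp_two_of_lintegral_sq hp.ennreal_toReal.aestronglyMeasurable ?_
    refine ne_top_of_le_ne_top hp2 (lintegral_mono fun a => ?_)
    simp only
    gcongr
    rw [abs_of_nonneg ENNReal.toReal_nonneg]
    exact ENNReal.ofReal_toReal_le
  set G : Lp ℝ 2 μ := hG2.toLp _ with hG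
  have hGae : G =ᵐ[μ] fun a => (p a).toReal := hG2.coeFn_toLp
  -- Truncation to the order interval [-G, G] costs at most `R n`, which tends to 0 in L²; this
  -- bounds the norms.
  set W : ℕ → Lp ℝ 2 μ := fun n => (π (x n) ⊓ G) ⊔ (-G) with hW
  have hG0 : -G ≤ G := by
    rw [← Lp.coeFn_le]
    filter_upwards [hGae, Lp.coeFn_neg G] with a h1 h2
    rw [h2, Pi.neg_apply, h1]
    exact neg_le_self ENNReal.toReal_nonneg
  have hWmem : ∀ n, W n ∈ Icc (-G) G := fun n => ⟨le_sup_right, sup_le inf_le_right hG0⟩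
  have hVW : Tendsto (fun n => π (x n) - W n) atTop (𝓝 0) := by
    rw [tendsto_zero_iff_lintegral_sq]
    refine tendsto_of_tendsto_of_tendsto_of_le_of_le tendsto_const_nhds hR (fun _ => zero_le)
      fun n => lintegral_mono_ae ?_
    filter_upwards [h n, hfin, hGae, Lp.coeFn_neg G, Lp.coeFn_sub (π (x n)) (W n),
      Lp.coeFn_sup (π (x n) ⊓ G) (-G), Lp.coeFn_inf (π (x n)) G] with a h1 h2 h3 h4 h5 h6 h7
    gcongr
    rw [h5, Pi.sub_apply, hW]
    simp only
    rw [h6, Pi.sup_apply, h7, Pi.inf_apply, h4, Pi.neg_apply, h3]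
    set s := (π (x n)) a
    set g := (p a).toReal with hg
    have hg0 : 0 ≤ g := ENNReal.toReal_nonneg
    have hpg : p a = ENNReal.ofReal g := (ENNReal.ofReal_toReal h2.ne).symm
    have h8 : |s - max (min s g) (-g)| ≤ max (|s| - g) 0 := by
      rcases le_total s g with h9 | h9 <;> rcases le_total (-g) s with h10 | h10
      · rw [min_eq_left h9, max_eq_left h10]; simp
      · rw [min_eq_left h9, max_eq_right h10, abs_of_nonpos (by linarith)]
        refine le_max_of_le_left ?_
        linarith [neg_le_abs s]
      · rw [min_eq_right h9, max_eq_left (by linarith), abs_of_nonneg (by linarith)]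
        refine le_max_of_le_left ?_
        linarith [le_abs_self s]
      · rw [min_eq_right h9, max_eq_left (by linarith), abs_of_nonneg (by linarith)]
        refine le_max_of_le_left ?_
        linarith [le_abs_self s]
    refine (ENNReal.ofReal_le_ofReal h8).trans ?_
    have h9 : ENNReal.ofReal (max (|s| - g) 0) = ENNReal.ofReal (|s| - g) := by
      rcases le_total (|s| - g) 0 with h | h
      · rw [max_eq_right h, ENNReal.ofReal_zero, ENNReal.ofReal_of_nonpos h]
      · rw [max_eq_left h]
    rw [h9, ENNReal.ofReal_sub _ hg0, ← hpg]
    exact tsub_le_iff_left.2 h1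
  obtain ⟨B, hB⟩ := hVW.norm.bddAbove_range
  obtain ⟨y, hy, hcau⟩ := exists_convexHull_tail_cauchySeq π x (B + ‖G‖) (fun n => by
    have h1 : ‖π (x n) - W n‖ ≤ B := hB ⟨n, rfl⟩
    have h2 : ‖W n‖ ≤ ‖G‖ := by
      refine norm_le_norm_of_abs_le_abs ?_
      have h3 : |W n| ≤ G := abs_le'.2 ⟨(hWmem n).2, neg_le.1 (hWmem n).1⟩
      exact h3.trans (le_abs_self G)
    calc ‖π (x n)‖ = ‖(π (x n) - W n) + W n‖ := by rw [sub_add_cancel]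
      _ ≤ _ := norm_add_le _ _
      _ ≤ _ := by gcongr)
  obtain ⟨V, hV⟩ := cauchySeq_tendsto_of_complete hcau
  refine ⟨y, V, hy, hV, ?_⟩
  have hmem : V ∈ Icc (-G) G := by
    -- The order interval is closed and convex. Each closed convex thickening contains a tail of the
    -- sequence, hence the combinations of later tails and their limit; the thickenings intersect in
    -- the interval.
    have hcl : IsClosed (Icc (-G) G) := isClosed_Icc
    rw [← hcl.closure_eq, Metric.closure_eq_iInter_cthickening]
    simp only [mem_iInter]
    intro ε hε
    have hev : ∀ᶠ n in atTop, π (x n) ∈ Metric.cthickening ε (Icc (-G) G) := by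
      have := hVW.norm.eventually (gt_mem_nhds (by simpa using hε))
      filter_upwards [this] with n hn
      refine Metric.mem_cthickening_of_dist_le _ (W n) _ _ (hWmem n) ?_
      rw [dist_eq_norm]
      exact hn.le
    obtain ⟨N, hN⟩ := eventually_atTop.1 hev
    refine Metric.isClosed_cthickening.mem_of_tendsto hV ?_
    filter_upwards [eventually_ge_atTop N] with n hn
    have hc : Convex ℝ (π ⁻¹' Metric.cthickening ε (Icc (-G) G)) :=
      ((convex_Icc_Lp G).cthickening ε).linear_preimage π
    refine convexHull_min ?_ hc (hy n)
    rintro _ ⟨m, hm, rfl⟩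
    exact hN m (hn.trans hm)
  rw [mem_Icc, ← Lp.coeFn_le, ← Lp.coeFn_le] at hmem
  filter_upwards [hmem.1, hmem.2, Lp.coeFn_neg G, hGae, hfin] with a h1 h2 h3 h4 h5
  rw [h3, Pi.neg_apply] at h1
  rw [← ENNReal.ofReal_toReal h5.ne, ← h4]
  exact ENNReal.ofReal_le_ofReal (abs_le.2 ⟨h1, h2⟩)

end SquareIntegrable

/-! ### Piecewise affine functions in `L²` -/

namespace LaaksoData

variable {D : LaaksoData} {n : ℕ}

instance : CompactSpace D.Space := inferInstanceAs (CompactSpace (Quotient D.setoid))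

lemma exists_abs_le {f : D.Space → ℝ} (hf : Continuous f) : ∃ C, ∀ x, |f x| ≤ C := by
  obtain ⟨C, hC⟩ := isCompact_univ.exists_bound_of_continuousOn hf.continuousOn
  exact ⟨C, fun x => hC x (mem_univ x)⟩

lemma memLp_of_continuous {f : D.Space → ℝ} (hf : Continuous f) : MemLp f 2 D.μ := by
  obtain ⟨C, hC⟩ := exists_abs_le hf
  exact MemLp.of_bound hf.measurable.aestronglyMeasurable C (Eventually.of_forall hC)

lemma abs_grad_le (v : D.Cell n → ℝ) (x : D.Space) : |grad v x| ≤ ∑ S, |v S| := by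
  unfold grad
  refine (Finset.abs_sum_le_sum_abs _ _).trans (Finset.sum_le_sum fun S _ => ?_)
  by_cases h : x ∈ openCell S
  · rw [indicator_of_mem h]
  · rw [indicator_of_notMem h]; simp

lemma memLp_grad (v : D.Cell n → ℝ) : MemLp (grad v) 2 D.μ :=
  MemLp.of_bound (measurable_grad v).aestronglyMeasurable _ (Eventually.of_forall (abs_grad_le v))

lemma grad_add (v w : D.Cell n → ℝ) : grad (v + w) = grad v + grad w := by
  funext x
  simp only [grad, Pi.add_apply, ← Finset.sum_add_distrib]
  exact Finset.sum_congr rfl fun S _ => by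
    by_cases h : x ∈ openCell S <;> simp [h]

lemma grad_smul (c : ℝ) (v : D.Cell n → ℝ) : grad (c • v) = c • grad v := by
  funext x
  simp only [grad, Pi.smul_apply, smul_eq_mul, Finset.mul_sum]
  exact Finset.sum_congr rfl fun S _ => by
    by_cases h : x ∈ openCell S <;> simp [h]

lemma integral_μ {E : Type*} [NormedAddCommGroup E] [NormedSpace ℝ E] {F : D.Space → E}
    (hF : AEStronglyMeasurable F D.μ) :
    ∫ x, F x ∂D.μ = ∫ p, F (D.wormholeMap p) ∂D.preMeasure := by
  rw [μ_eq_map] at hF ⊢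
  exact integral_map D.measurable_wormholeMap.aemeasurable hF

lemma integral_unitInterval (G : I → ℝ) :
    ∫ x : I, G x = ∫ x in Icc (0 : ℝ) 1, G (projIcc 0 1 zero_le_one x) := by
  have := integral_subtype_comap (μ := (volume : Measure ℝ)) (measurableSet_Icc (a := (0:ℝ)) (b := 1))
    (fun x => G (projIcc 0 1 zero_le_one x))
  rw [← this]
  simp only [projIcc_val]
  rfl

/-! ### Piecewise affine test functions determine elements of L². -/

section Density

/-- A continuous cut-off function vanishing exactly at the heights `i / d_n`. -/
noncomputable def cutoff (D : LaaksoData) (n N : ℕ) (x : ℝ) : ℝ :=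
  min 1 (N * |Real.sin (Real.pi * (x * D.d n))|)

lemma cutoff_eq_zero {x : ℝ} {N : ℕ} (h : ∃ z : ℤ, x * D.d n = z) : cutoff D n N x = 0 := by
  obtain ⟨z, hz⟩ := h
  unfold cutoff
  rw [hz, mul_comm Real.pi, Real.sin_int_mul_pi]
  simp

lemma abs_cutoff_le (N : ℕ) (x : ℝ) : |cutoff D n N x| ≤ 1 := by
  unfold cutoff
  rw [abs_of_nonneg (le_min zero_le_one (by positivity))]
  exact min_le_left _ _

lemma tendsto_cutoff {x : ℝ} (h : ¬ ∃ z : ℤ, x * D.d n = z) :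
    Tendsto (fun N => cutoff D n N x) atTop (𝓝 1) := by
  have hs : 0 < |Real.sin (Real.pi * (x * D.d n))| := by
    rw [abs_pos]
    intro h0
    obtain ⟨z, hz⟩ := Real.sin_eq_zero_iff.1 h0
    refine h ⟨z, ?_⟩
    have := Real.pi_pos.ne'
    rw [mul_comm] at hz
    exact (mul_left_cancel₀ this hz).symm
  have ht := (tendsto_natCast_atTop_atTop (R := ℝ)).atTop_mul_const hs
  refine tendsto_const_nhds.congr' ?_
  filter_upwards [ht.eventually_ge_atTop 1] with N hN
  exact (min_eq_left hN).symm

/-- Replace all digits from the `n`-th on by zeros. -/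
def truncDigits (n : ℕ) (w : Fin D.k → ℕ → Bool) : Fin D.k → ℕ → Bool :=
  fun c m => if m < n then w c m else false

lemma continuous_truncDigits (n : ℕ) : Continuous (truncDigits (D := D) n) := by
  unfold truncDigits
  refine continuous_pi fun c => continuous_pi fun m => ?_
  by_cases h : m < n
  · simp only [h, if_true]; fun_prop
  · simp only [h, if_false]; fun_prop

lemma tendsto_truncDigits (w : Fin D.k → ℕ → Bool) :
    Tendsto (fun n => truncDigits n w) atTop (𝓝 w) := by
  rw [tendsto_pi_nhds]
  intro c
  rw [tendsto_pi_nhds]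
  intro m
  refine tendsto_const_nhds.congr' ?_
  filter_upwards [eventually_gt_atTop m] with n hn
  simp [truncDigits, hn]

/-- The function on the Laakso space obtained from `ψ` by truncating digits and cutting off. -/
noncomputable def cutoffLift (ψ : D.Pre → ℝ) (n N : ℕ) : D.Space → ℝ :=
  Quotient.lift (fun p : D.Pre => cutoff D n N p.1 * ψ (p.1, truncDigits n p.2)) (by
    intro p q h
    obtain ⟨h1, h2⟩ := Rel.int_or_digits h n
    -- Wormholes affecting one of the first n digits lie where the cut-off vanishes; deeper ones
    -- leave the retained digits unchanged.
    rcases h2 with h2 | h2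
    · have h3 : ∃ z : ℤ, (q.1 : ℝ) * D.d n = z := h1 ▸ h2
      simp only [cutoff_eq_zero h2, cutoff_eq_zero h3, zero_mul]
    · have : truncDigits n p.2 = truncDigits n q.2 := by
        funext c m
        by_cases hm : m < n <;> simp [truncDigits, hm, h2 c m]
      simp only [h1, this])

lemma continuous_cutoffLift {ψ : D.Pre → ℝ} (hψ : Continuous ψ) (n N : ℕ) :
    Continuous (cutoffLift ψ n N) := by
  refine continuous_iff_wormholeMap.2 ?_
  change Continuous fun p : D.Pre => cutoff D n N p.1 * ψ (p.1, truncDigits n p.2)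
  have h1 : Continuous fun p : D.Pre => cutoff D n N p.1 := by
    unfold cutoff
    fun_prop
  exact h1.mul (hψ.comp (continuous_fst.prodMk ((continuous_truncDigits n).comp continuous_snd)))

/-- A square integrable function orthogonal to all piecewise affine functions that vanish at the
heights `0` and `1` is zero. -/
theorem eq_zero_of_forall_integral_eq_zero {z : Lp ℝ 2 D.μ}
    (h : ∀ (n : ℕ) (f : D.Space → ℝ) (v : D.Cell n → ℝ), IsPiecewiseAffine f v →
      (∀ x, D.height x = 0 ∨ D.height x = 1 → f x = 0) → ∫ x, f x * z x ∂D.μ = 0) : z = 0 := by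
  have hz1 : Integrable z D.μ := (Lp.memLp z).integrable one_le_two
  have hbdd : ∀ {f : D.Space → ℝ}, Continuous f → Integrable (fun x => f x * z x) D.μ := by
    intro f hf
    obtain ⟨C, hC⟩ := exists_abs_le hf
    exact hz1.bdd_mul (c := C) hf.measurable.aestronglyMeasurable (Eventually.of_forall hC)
  -- Uniform approximation by interpolations, which keep the zero boundary values, extends the
  -- orthogonality to continuous functions.
  have hcont : ∀ f : D.Space → ℝ, Continuous f →
      (∀ x, D.height x = 0 ∨ D.height x = 1 → f x = 0) → ∫ x, f x * z x ∂D.μ = 0 := by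
    intro f hf hf0
    rw [← abs_nonpos_iff]
    refine le_of_forall_pos_le_add fun ε hε => ?_
    set A := ∫ x, |z x| ∂D.μ with hA
    have hA0 : 0 ≤ A := integral_nonneg fun _ => abs_nonneg _
    obtain ⟨N, hN⟩ := exists_forall_abs_interp_sub_le hf (ε := ε / (A + 1)) (by positivity)
    have h1 := h N _ _ (isPiecewiseAffine_interp N f) fun x hx => interp_eq_zero hf0 hx
    have hic := (isPiecewiseAffine_interp N f).continuous
    have e : ∫ x, f x * z x ∂D.μ = ∫ x, (f x - interp N f x) * z x ∂D.μ := by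
      simp only [sub_mul]
      rw [integral_sub (hbdd hf) (hbdd hic), h1, sub_zero]
    rw [e, ← Real.norm_eq_abs]
    refine (norm_integral_le_integral_norm _).trans ?_
    calc ∫ x, ‖(f x - interp N f x) * z x‖ ∂D.μ ≤ ∫ x, ε / (A + 1) * |z x| ∂D.μ := by
          refine integral_mono (hbdd (hf.sub hic)).norm (hz1.abs.const_mul _) fun x => ?_
          simp only [norm_mul, Real.norm_eq_abs]
          gcongr
          rw [abs_sub_comm]
          exact hN N le_rfl x
      _ = ε / (A + 1) * A := integral_const_mul _ _
      _ ≤ 0 + ε := by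
          rw [div_mul_eq_mul_div, zero_add]
          exact div_le_of_le_mul₀ (by positivity) hε.le (by nlinarith)
  have hzm : Measurable fun p => z (D.wormholeMap p) :=
    (Lp.stronglyMeasurable z).measurable.comp D.measurable_wormholeMap
  have hz2 : MemLp (fun p => z (D.wormholeMap p)) 2 D.preMeasure :=
    (Lp.memLp z).comp_measurePreserving
      ⟨D.measurable_wormholeMap, (μ_eq_map (D := D)).symm⟩
  have hzP : Integrable (fun p => z (D.wormholeMap p)) D.preMeasure := hz2.integrable one_le_two
  -- A continuous ψ on I × K^k need not descend to L, but its truncated cut-offs do, and they vanish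
  -- at the end heights. Letting first N and then n tend to infinity recovers ψ under the integral.
  have hψ : ∀ ψ : C(D.Pre, ℝ), ∫ p, ψ p * z (D.wormholeMap p) ∂D.preMeasure = 0 := by
    intro ψ
    obtain ⟨C, hC⟩ := isCompact_univ.exists_bound_of_continuousOn ψ.continuous.continuousOn
    have hC' : ∀ p, |ψ p| ≤ C := fun p => hC p (mem_univ p)
    have hstep : ∀ n, ∫ p, ψ (p.1, truncDigits n p.2) * z (D.wormholeMap p) ∂D.preMeasure = 0 := by
      intro n
      have hlim : Tendsto (fun N => ∫ p, cutoffLift ψ n N (D.wormholeMap p) *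
          z (D.wormholeMap p) ∂D.preMeasure) atTop
          (𝓝 (∫ p, ψ (p.1, truncDigits n p.2) * z (D.wormholeMap p) ∂D.preMeasure)) := by
        refine tendsto_integral_of_dominated_convergence (fun p => C * |z (D.wormholeMap p)|)
          (fun N => (((continuous_cutoffLift ψ.continuous n N).comp
            D.continuous_wormholeMap).measurable.mul hzm).aestronglyMeasurable)
          (hzP.abs.const_mul C) (fun N => Eventually.of_forall fun p => ?_) ?_
        · rw [norm_mul]
          refine mul_le_mul_of_nonneg_right ?_ (norm_nonneg _)
          · change |cutoff D n N p.1 * ψ (p.1, truncDigits n p.2)| ≤ C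
            rw [abs_mul]
            calc _ ≤ 1 * |ψ (p.1, truncDigits n p.2)| := by gcongr; exact abs_cutoff_le _ _
              _ ≤ C := by rw [one_mul]; exact hC' _
        · filter_upwards [ae_not_int (D := D) n] with p hp
          have := ((tendsto_cutoff hp).mul_const (ψ (p.1, truncDigits n p.2))).mul_const
            (z (D.wormholeMap p))
          rw [one_mul] at this
          exact this
      have hzero : ∀ N, ∫ p, cutoffLift ψ n N (D.wormholeMap p) *
          z (D.wormholeMap p) ∂D.preMeasure = 0 := by
        intro N
        have hc := continuous_cutoffLift ψ.continuous n N
        rw [← integral_μ (F := fun x => cutoffLift ψ n N x * z x) (hbdd hc).aestronglyMeasurable]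
        refine hcont _ hc fun x hx => ?_
        obtain ⟨p, rfl⟩ := D.surjective_wormholeMap x
        change cutoff D n N p.1 * ψ (p.1, truncDigits n p.2) = 0
        have hx' : (p.1 : ℝ) = 0 ∨ (p.1 : ℝ) = 1 := hx
        rw [cutoff_eq_zero, zero_mul]
        rcases hx' with h0 | h0
        · exact ⟨0, by simp [h0]⟩
        · exact ⟨D.d n, by simp [h0]⟩
      simp only [hzero] at hlim
      exact (tendsto_nhds_unique hlim tendsto_const_nhds)
    have hlim : Tendsto (fun n => ∫ p, ψ (p.1, truncDigits n p.2) *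
        z (D.wormholeMap p) ∂D.preMeasure) atTop
        (𝓝 (∫ p, ψ p * z (D.wormholeMap p) ∂D.preMeasure)) := by
      refine tendsto_integral_of_dominated_convergence (fun p => C * |z (D.wormholeMap p)|)
        (fun n => ((ψ.continuous.comp (continuous_fst.prodMk
          ((continuous_truncDigits n).comp continuous_snd))).measurable.mul hzm).aestronglyMeasurable)
        (hzP.abs.const_mul C) (fun N => Eventually.of_forall fun p => ?_)
        (Eventually.of_forall fun p => ?_)
      · rw [norm_mul]
        exact mul_le_mul_of_nonneg_right (hC' _) (norm_nonneg _)
      · refine Tendsto.mul_const _ ((ψ.continuous.tendsto p).comp ?_)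
        exact tendsto_const_nhds.prodMk_nhds (tendsto_truncDigits p.2)
    simp only [hstep] at hlim
    exact (tendsto_nhds_unique hlim tendsto_const_nhds)
  set z' : Lp ℝ 2 D.preMeasure := hz2.toLp _ with hz'
  have hdense := ContinuousMap.toLp_denseRange (p := 2) ℝ D.preMeasure (𝕜 := ℝ) (by norm_num)
  have hz'0 : z' = 0 := by
    refine Dense.eq_zero_of_inner_right ℝ hdense ?_
    rintro _ ⟨ψ, rfl⟩
    rw [L2.inner_def]
    have : (fun p => inner ℝ (ContinuousMap.toLp 2 D.preMeasure ℝ ψ p) (z' p)) =ᵐ[D.preMeasure]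
        fun p => ψ p * z (D.wormholeMap p) := by
      filter_upwards [ContinuousMap.coeFn_toLp (p := 2) D.preMeasure (𝕜 := ℝ) ψ, hz2.coeFn_toLp]
        with p h1 h2
      rw [h1, h2]
      simp [mul_comm]
    rw [integral_congr_ae this, hψ ψ]
  have hae : ∀ᵐ p ∂D.preMeasure, z (D.wormholeMap p) = 0 := by
    have := hz2.coeFn_toLp
    rw [← hz', hz'0] at this
    filter_upwards [this, Lp.coeFn_zero ℝ 2 D.preMeasure] with p h1 h2
    rw [← h1, h2, Pi.zero_apply]
  have := ae_μ_of_ae_preMeasure (measurableSet_eq_fun (Lp.stronglyMeasurable z).measurable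
    measurable_const) hae
  exact (Lp.eq_zero_iff_ae_eq_zero).2 this

end Density

/-! ### Integration by parts along vertical lines. -/

section IntegrationByParts

lemma IsPiecewiseAffine.hasDerivAt_line {f : D.Space → ℝ} {v : D.Cell n → ℝ}
    (hf : IsPiecewiseAffine f v) (w : Fin D.k → ℕ → Bool) {x : ℝ} (hx : x ∈ Ioo (0 : ℝ) 1)
    (hint : ¬ ∃ z : ℤ, x * D.d n = z) :
    HasDerivAt (fun t => f (D.wormholeMap (projIcc 0 1 zero_le_one t, w)))
      (grad v (D.wormholeMap (projIcc 0 1 zero_le_one x, w))) x := by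
  have hval : ∀ t ∈ Ioo (0 : ℝ) 1, ((projIcc 0 1 zero_le_one t : I) : ℝ) = t := fun t ht => by
    rw [projIcc_of_mem zero_le_one (Ioo_subset_Icc_self ht)]
  have hint' : ¬ ∃ z : ℤ, (((projIcc 0 1 zero_le_one x : I), w).1 : ℝ) * D.d n = z := by
    simpa only [hval x hx] using hint
  obtain ⟨S, hS⟩ := exists_mem_openBlock (D := D) (n := n)
    (p := ((projIcc 0 1 zero_le_one x : I), w)) hint'
  rw [grad_wormholeMap hS]
  have hcont : Continuous fun t : ℝ => ((projIcc 0 1 zero_le_one t : I), w) :=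
    continuous_projIcc.prodMk continuous_const
  have hev : (fun t => f (D.wormholeMap (projIcc 0 1 zero_le_one t, w))) =ᶠ[𝓝 x]
      fun t => f (D.wormholeMap (projIcc 0 1 zero_le_one x, w)) + v S * (t - x) := by
    filter_upwards [hcont.continuousAt.preimage_mem_nhds ((isOpen_openBlock S).mem_nhds hS),
      Ioo_mem_nhds hx.1 hx.2] with t ht ht'
    have := hf S _ (openBlock_subset _ hS) _ (openBlock_subset _ ht)
    simp only [hval x hx, hval t ht'] at this
    linarith
  refine HasDerivAt.congr_of_eventuallyEq ?_ hev
  have := ((hasDerivAt_id x).sub_const x).const_mul (v S)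
  simpa using this.const_add (f (D.wormholeMap (projIcc 0 1 zero_le_one x, w)))

lemma IsPiecewiseAffine.absolutelyContinuous_line {f : D.Space → ℝ} {v : D.Cell n → ℝ}
    (hf : IsPiecewiseAffine f v) (w : Fin D.k → ℕ → Bool) :
    AbsolutelyContinuousOnInterval
      (fun t => f (D.wormholeMap (projIcc 0 1 zero_le_one t, w))) 0 1 := by
  have hC : ∀ S, |v S| ≤ ∑ S, |v S| := fun S =>
    Finset.single_le_sum (f := fun S => |v S|) (fun _ _ => abs_nonneg _) (Finset.mem_univ S)
  have h0 : 0 ≤ ∑ S, |v S| := Finset.sum_nonneg fun _ _ => abs_nonneg _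
  refine LipschitzOnWith.absolutelyContinuousOnInterval (K := (∑ S, |v S|).toNNReal) ?_
  rw [uIcc_of_le zero_le_one]
  refine LipschitzOnWith.of_dist_le_mul fun s hs t ht => ?_
  rw [Real.dist_eq, Real.dist_eq, Real.coe_toNNReal _ h0]
  have := hf.abs_line_sub_le hC w (projIcc 0 1 zero_le_one t) (projIcc 0 1 zero_le_one s)
  have hval : ∀ t ∈ Icc (0 : ℝ) 1, ((projIcc 0 1 zero_le_one t : I) : ℝ) = t := fun t ht => by
    rw [projIcc_of_mem zero_le_one ht]
  rwa [hval s hs, hval t ht] at this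

lemma ae_not_int_real (n : ℕ) : ∀ᵐ x : ℝ, ¬ ∃ z : ℤ, x * D.d n = z := by
  have hc : (range fun z : ℤ => (z : ℝ) / D.d n).Countable := countable_range _
  filter_upwards [hc.ae_notMem volume] with x hx
  rintro ⟨z, hz⟩
  exact hx ⟨z, by simp only [← hz]; exact mul_div_cancel_right₀ _ (d_pos_real n).ne'⟩

/-- On each vertical line fφ is absolutely continuous, vanishes at both ends, and has the integrand
as derivative off countably many heights. Fubini's theorem then gives 0; this identity is what makes
the slope operator closable. -/
theorem integral_mul_grad_add {f φ : D.Space → ℝ} {v w : D.Cell n → ℝ}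
    (hf : IsPiecewiseAffine f v) (hφ : IsPiecewiseAffine φ w)
    (hφ0 : ∀ x, D.height x = 0 ∨ D.height x = 1 → φ x = 0) :
    ∫ x, (f x * grad w x + φ x * grad v x) ∂D.μ = 0 := by
  have hm : Measurable fun x => f x * grad w x + φ x * grad v x :=
    (hf.continuous.measurable.mul (measurable_grad w)).add
      (hφ.continuous.measurable.mul (measurable_grad v))
  obtain ⟨A, hA⟩ := exists_abs_le hf.continuous
  obtain ⟨B, hB⟩ := exists_abs_le hφ.continuous
  have hbd : ∀ x, |f x * grad w x + φ x * grad v x| ≤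
      A * ∑ S, |w S| + B * ∑ S, |v S| := fun x => by
    refine (abs_add_le _ _).trans (add_le_add ?_ ?_) <;> rw [abs_mul]
    · exact mul_le_mul (hA x) (abs_grad_le w x) (abs_nonneg _) ((abs_nonneg _).trans (hA x))
    · exact mul_le_mul (hB x) (abs_grad_le v x) (abs_nonneg _) ((abs_nonneg _).trans (hB x))
  rw [integral_μ hm.aestronglyMeasurable]
  have hint : Integrable (fun p : D.Pre => f (D.wormholeMap p) * grad w (D.wormholeMap p) +
      φ (D.wormholeMap p) * grad v (D.wormholeMap p))
      ((volume : Measure I).prod (digitMeasure D.k)) :=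
    Integrable.of_bound (hm.comp D.measurable_wormholeMap).aestronglyMeasurable _
      (Eventually.of_forall fun p => hbd _)
  refine (integral_prod_symm _ hint).trans ?_
  refine integral_eq_zero_of_ae (Eventually.of_forall fun ω => ?_)
  simp only [Pi.zero_apply]
  rw [integral_unitInterval, integral_Icc_eq_integral_Ioc,
    ← intervalIntegral.integral_of_le zero_le_one]
  set F := fun t => f (D.wormholeMap (projIcc 0 1 zero_le_one t, ω)) with hF
  set Φ := fun t => φ (D.wormholeMap (projIcc 0 1 zero_le_one t, ω)) with hΦ
  have hAF : AbsolutelyContinuousOnInterval F 0 1 := hf.absolutelyContinuous_line ω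
  have hAΦ : AbsolutelyContinuousOnInterval Φ 0 1 := hφ.absolutelyContinuous_line ω
  have h1 := (hAF.fun_mul hAΦ).integral_deriv_eq_sub
  have e0 : Φ 0 = 0 := hφ0 _ (Or.inl (by
    change ((projIcc 0 1 zero_le_one (0 : ℝ) : I) : ℝ) = 0; simp))
  have e1 : Φ 1 = 0 := hφ0 _ (Or.inr (by
    change ((projIcc 0 1 zero_le_one (1 : ℝ) : I) : ℝ) = 1; simp))
  rw [e0, e1, mul_zero, mul_zero, sub_zero] at h1
  refine Eq.trans ?_ h1
  refine intervalIntegral.integral_congr_ae ?_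
  have hne : ∀ᵐ x : ℝ, x ≠ 1 := by simp [ae_iff]
  filter_upwards [ae_not_int_real (D := D) n, hne] with x hx hx1 hxI
  rw [uIoc_of_le zero_le_one] at hxI
  have hxo : x ∈ Ioo (0 : ℝ) 1 := ⟨hxI.1, hxI.2.lt_of_ne hx1⟩
  have h2 := (hf.hasDerivAt_line ω hxo hx).mul (hφ.hasDerivAt_line ω hxo hx)
  have h3 : deriv (fun y => F y * Φ y) x = _ := h2.deriv
  rw [h3]
  ring

end IntegrationByParts

end LaaksoData

/-! ### The closure of the slope operator -/

namespace LaaksoData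

variable {D : LaaksoData} {n : ℕ}

/-! ### Averages of upper gradients over cells. -/

section CellAverage

/-- The averages of `g` over the cells of level `n`, as a function on the open cells. -/
noncomputable def cellAverage (n : ℕ) (g : D.Space → ℝ≥0∞) (x : D.Space) : ℝ≥0∞ :=
  ∑ S : D.Cell n, (openCell S).indicator
    (fun _ => ∫⁻ p, g (D.wormholeMap (par S p)) ∂D.preMeasure) x

lemma cellAverage_wormholeMap (g : D.Space → ℝ≥0∞) {S : D.Cell n} {p : D.Pre}
    (hp : p ∈ openBlock S) : cellAverage n g (D.wormholeMap p) =
      ∫⁻ p, g (D.wormholeMap (par S p)) ∂D.preMeasure := by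
  unfold cellAverage
  rw [Finset.sum_eq_single S]
  · exact indicator_of_mem (mem_image_of_mem _ hp) _
  · intro S' _ hS'
    refine indicator_of_notMem (fun h => hS' ?_) _
    have : p ∈ D.wormholeMap ⁻¹' openCell S' := h
    rw [preimage_openCell] at this
    exact openBlock_unique this (openBlock_subset _ hp)
  · simp

lemma measurable_cellAverage (n : ℕ) (g : D.Space → ℝ≥0∞) : Measurable (cellAverage n g) := by
  unfold cellAverage
  exact Finset.measurable_fun_sum _ fun S _ =>
    measurable_const.indicator (isOpen_openCell S).measurableSet

lemma sum_lintegral_cell (n : ℕ) {F : D.Space → ℝ≥0∞} (hF : Measurable F) :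
    ∑ S : D.Cell n, ∫⁻ p, F (D.wormholeMap (par S p)) ∂D.preMeasure =
      Fintype.card (D.Cell n) * ∫⁻ x, F x ∂D.μ := by
  rw [μ_eq_map, lintegral_map hF D.measurable_wormholeMap]
  exact sum_lintegral_par n (hF.comp D.measurable_wormholeMap)

lemma card_cell_pos (n : ℕ) : 0 < Fintype.card (D.Cell n) := by
  obtain ⟨S, -⟩ := exists_mem_block (D := D) n (0, fun _ _ => false)
  exact Fintype.card_pos_iff.2 ⟨S⟩

/-- Jensen's inequality on every cell, summed over the cells. -/
lemma lintegral_cellAverage_sq_le (n : ℕ) {g : D.Space → ℝ≥0∞} (hg : Measurable g) :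
    ∫⁻ x, cellAverage n g x ^ 2 ∂D.μ ≤ ∫⁻ x, g x ^ 2 ∂D.μ := by
  have hm : (Fintype.card (D.Cell n) : ℝ≥0∞) ≠ 0 := by
    exact_mod_cast (card_cell_pos (D := D) n).ne'
  refine (ENNReal.mul_le_mul_iff_right hm (ENNReal.natCast_ne_top _)).1 ?_
  rw [← sum_lintegral_cell n ((measurable_cellAverage n g).pow_const 2),
    ← sum_lintegral_cell n (hg.pow_const 2)]
  refine Finset.sum_le_sum fun S _ => ?_
  have : ∫⁻ p, cellAverage n g (D.wormholeMap (par S p)) ^ 2 ∂D.preMeasure =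
      ∫⁻ _, (∫⁻ p, g (D.wormholeMap (par S p)) ∂D.preMeasure) ^ 2 ∂D.preMeasure := by
    refine lintegral_congr_ae ?_
    filter_upwards [ae_par_mem_openBlock S] with p hp
    rw [cellAverage_wormholeMap g hp]
  rw [this, lintegral_const, measure_univ, mul_one]
  exact lintegral_sq_le_lintegral_sq
    (hg.comp (D.measurable_wormholeMap.comp (measurable_par S))).aemeasurable

lemma measurable_curry {g : D.Space → ℝ≥0∞} (hg : Measurable g)
    (a : Fin D.k → Fin n → Bool) {e : ℝ → ℝ} (he : Measurable e) :
    Measurable fun q : (Fin D.k → ℕ → Bool) × ℝ =>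
      g (D.wormholeMap (projIcc 0 1 zero_le_one (e q.2), overwrite a q.1)) :=
  hg.comp (D.measurable_wormholeMap.comp
    ((continuous_projIcc.measurable.comp (he.comp measurable_snd)).prodMk
      ((measurable_overwrite a).comp measurable_fst)))

/-- The slopes of the interpolation are bounded by the averages of upper gradients. -/
lemma IsUpperGradient.interpSlope_le {f : D.Space → ℝ} {g : D.Space → ℝ≥0∞}
    (h : D.IsUpperGradient f g) (hf : Continuous f) (S : D.Cell n) :
    ENNReal.ofReal |interpSlope n f S| ≤
      ∫⁻ p, g (D.wormholeMap (par S p)) ∂D.preMeasure := by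
  have hd := d_pos_real (D := D) n
  have hlt : ((S.1 : ℕ) : ℝ) / D.d n ≤ ((S.1 + 1 : ℕ) : ℝ) / D.d n := by
    gcongr; simp
  have h1 : ((S.1 + 1 : ℕ) : ℝ) / D.d n ≤ 1 := by
    rw [div_le_one hd]
    exact_mod_cast S.1.2
  have hline : ∀ w, ENNReal.ofReal |f (D.wormholeMap (node D n (S.1 + 1), overwrite S.2 w)) -
      f (D.wormholeMap (node D n S.1, overwrite S.2 w))| ≤
      ∫⁻ x in Ico (((S.1 : ℕ) : ℝ) / D.d n) (((S.1 + 1 : ℕ) : ℝ) / D.d n),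
        g (D.wormholeMap (projIcc 0 1 zero_le_one x, overwrite S.2 w)) := by
    -- Each vertical line through the block contributes an increment of f, bounded by the upper
    -- gradient; the slope is d_n times the mean increment.
    intro w
    rw [abs_sub_comm, restrict_Ico_eq_restrict_Icc]
    exact h.le_lintegral_line (overwrite S.2 w) (by positivity) hlt h1
  unfold interpSlope fiberAverage
  rw [← integral_sub (integrable_fiber hf _ _) (integrable_fiber hf _ _), abs_mul,
    abs_of_pos hd, ENNReal.ofReal_mul hd.le, ENNReal.ofReal_natCast,
    lintegral_par S (F := fun p => g (D.wormholeMap p)) (h.measurable.comp D.measurable_wormholeMap)]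
  calc _ ≤ (D.d n : ℝ≥0∞) * ∫⁻ w, (∫⁻ x in Ico (((S.1 : ℕ) : ℝ) / D.d n)
        (((S.1 + 1 : ℕ) : ℝ) / D.d n), g (D.wormholeMap (projIcc 0 1 zero_le_one x,
          overwrite S.2 w))) ∂digitMeasure D.k := by
        gcongr
        rw [← Real.norm_eq_abs, ofReal_norm]
        refine (enorm_integral_le_lintegral_enorm _).trans (lintegral_mono fun w => ?_)
        rw [← ofReal_norm, Real.norm_eq_abs]
        exact hline w
    _ = ∫⁻ w, (∫⁻ t in Icc (0 : ℝ) 1, g (D.wormholeMap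
        (projIcc 0 1 zero_le_one (((S.1 : ℕ) + t) / D.d n), overwrite S.2 w))) ∂digitMeasure D.k := by
        rw [← lintegral_const_mul' _ _ (ENNReal.natCast_ne_top _)]
        refine lintegral_congr fun w => ?_
        rw [lintegral_Ico_div (D.d_pos n) S.1
          (fun x => g (D.wormholeMap (projIcc 0 1 zero_le_one x, overwrite S.2 w)))]
    _ = _ := by
        rw [lintegral_lintegral_swap]
        exact (measurable_curry h.measurable S.2
          (e := fun t => (((S.1 : ℕ) : ℝ) + t) / D.d n) (by fun_prop)).aemeasurable

end CellAverage

/-! ### The closed slope operator. -/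

section Graph

/-- Piecewise affine functions together with their slopes. -/
noncomputable def affineSub (D : LaaksoData) : Submodule ℝ ((D.Space → ℝ) × Lp ℝ 2 D.μ) where
  carrier := {q | ∃ n, ∃ v : D.Cell n → ℝ, IsPiecewiseAffine q.1 v ∧ q.2 =ᵐ[D.μ] grad v}
  zero_mem' := by
    refine ⟨0, 0, fun S p _ q _ => by simp, ?_⟩
    filter_upwards [Lp.coeFn_zero ℝ 2 D.μ] with x hx
    simp only [Prod.snd_zero, hx, grad, Pi.zero_apply, indicator_zero, Finset.sum_const_zero]
  add_mem' := by
    rintro q r ⟨n, v, hv, hv'⟩ ⟨m, w, hw, hw'⟩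
    have hn := le_max_left n m
    have hm := le_max_right n m
    refine ⟨max n m, _, (hv.refine hn).add (hw.refine hm), ?_⟩
    rw [grad_add]
    exact (Lp.coeFn_add _ _).trans
      ((hv'.trans (grad_parent_ae hn v).symm).add (hw'.trans (grad_parent_ae hm w).symm))
  smul_mem' := by
    rintro c q ⟨n, v, hv, hv'⟩
    refine ⟨n, c • v, hv.smul c, ?_⟩
    rw [grad_smul]
    exact (Lp.coeFn_smul _ _).trans (hv'.const_smul c)

lemma continuous_of_mem_affineSub {q : (D.Space → ℝ) × Lp ℝ 2 D.μ} (hq : q ∈ affineSub D) :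
    Continuous q.1 := by
  obtain ⟨n, v, hv, -⟩ := hq
  exact hv.continuous

lemma IsPiecewiseAffine.mem_affineSub {f : D.Space → ℝ} {v : D.Cell n → ℝ}
    (hf : IsPiecewiseAffine f v) : (f, (memLp_grad v).toLp _) ∈ affineSub D :=
  ⟨n, v, hf, (memLp_grad v).coeFn_toLp⟩

/-- The slope operator on classes of piecewise affine functions. -/
noncomputable def affineGraph (D : LaaksoData) : Submodule ℝ (Lp ℝ 2 D.μ × Lp ℝ 2 D.μ) where
  carrier := {q | ∃ f, (f, q.2) ∈ affineSub D ∧ q.1 =ᵐ[D.μ] f}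
  zero_mem' := ⟨0, (affineSub D).zero_mem, Lp.coeFn_zero ℝ 2 D.μ⟩
  add_mem' := by
    rintro q r ⟨f, hf, hf'⟩ ⟨g, hg, hg'⟩
    exact ⟨f + g, (affineSub D).add_mem hf hg, (Lp.coeFn_add _ _).trans (hf'.add hg')⟩
  smul_mem' := by
    rintro c q ⟨f, hf, hf'⟩
    exact ⟨c • f, (affineSub D).smul_mem c hf, (Lp.coeFn_smul _ _).trans (hf'.const_smul c)⟩

/-- The closure of the slope operator. -/
noncomputable def slopeGraph (D : LaaksoData) : Submodule ℝ (Lp ℝ 2 D.μ × Lp ℝ 2 D.μ) :=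
  (affineGraph D).topologicalClosure

lemma isClosed_slopeGraph : IsClosed (slopeGraph D : Set (Lp ℝ 2 D.μ × Lp ℝ 2 D.μ)) :=
  Submodule.isClosed_topologicalClosure _

lemma affineGraph_le : affineGraph D ≤ slopeGraph D := Submodule.le_topologicalClosure _

lemma inner_toLp (z : Lp ℝ 2 D.μ) {f : D.Space → ℝ} (hf : MemLp f 2 D.μ) :
    inner ℝ (hf.toLp f) z = ∫ x, f x * z x ∂D.μ := by
  rw [L2.inner_def]
  refine integral_congr_ae ?_
  filter_upwards [hf.coeFn_toLp] with x hx
  rw [hx]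
  simp [mul_comm]

/-- Piecewise affine functions are dense in `L²`. -/
theorem dense_affine : Dense {u : Lp ℝ 2 D.μ | ∃ V, (u, V) ∈ affineGraph D} := by
  have e : {u : Lp ℝ 2 D.μ | ∃ V, (u, V) ∈ affineGraph D} =
      ((affineGraph D).map (LinearMap.fst ℝ _ _) : Set (Lp ℝ 2 D.μ)) := by
    ext u
    simp
  rw [e, Submodule.dense_iff_topologicalClosure_eq_top, Submodule.topologicalClosure_eq_top_iff,
    Submodule.eq_bot_iff]
  intro z hz
  refine eq_zero_of_forall_integral_eq_zero fun n f v hf _ => ?_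
  rw [← inner_toLp z (memLp_of_continuous hf.continuous)]
  refine (Submodule.mem_orthogonal _ _).1 hz _
    ⟨((memLp_of_continuous hf.continuous).toLp _, (memLp_grad v).toLp _), ?_, rfl⟩
  exact ⟨f, hf.mem_affineSub, (memLp_of_continuous hf.continuous).coeFn_toLp⟩

lemma dense_slopeGraph : Dense {u : Lp ℝ 2 D.μ | ∃ V, (u, V) ∈ slopeGraph D} :=
  dense_affine.mono (by rintro u ⟨V, hV⟩; exact ⟨V, affineGraph_le hV⟩)

/-- The slope operator is closable. -/
theorem slopeGraph_eq_zero {V : Lp ℝ 2 D.μ} (h : (0, V) ∈ slopeGraph D) : V = 0 := by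
  refine eq_zero_of_forall_integral_eq_zero fun n φ w hφ hφ0 => ?_
  rw [← inner_toLp V (memLp_of_continuous hφ.continuous)]
  set Φ := (memLp_of_continuous hφ.continuous).toLp φ
  -- Integration by parts is a closed condition and passes to the closure. With first component 0 it
  -- says that V is orthogonal to all φ.
  have key : ∀ q ∈ slopeGraph D,
      inner ℝ ((memLp_grad w).toLp _) q.1 + inner ℝ Φ q.2 = 0 := by
    intro q hq
    have hcl : IsClosed {q : Lp ℝ 2 D.μ × Lp ℝ 2 D.μ |
        inner ℝ ((memLp_grad w).toLp _) q.1 + inner ℝ Φ q.2 = 0} :=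
      isClosed_eq (by fun_prop) continuous_const
    refine closure_minimal (s := (affineGraph D : Set (Lp ℝ 2 D.μ × Lp ℝ 2 D.μ))) ?_ hcl hq
    rintro ⟨u, W⟩ ⟨f, ⟨m, v, hv, hW⟩, hu⟩
    simp only [mem_ofPred_eq]
    have hn := le_max_left n m
    have hm := le_max_right n m
    have hibp := integral_mul_grad_add (hv.refine hm) (hφ.refine hn) hφ0
    have h1 : MemLp (fun x => φ x) 2 D.μ := memLp_of_continuous hφ.continuous
    rw [inner_toLp u (memLp_grad w), inner_toLp W (memLp_of_continuous hφ.continuous)]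
    refine (integral_add ((memLp_grad w).integrable_mul (Lp.memLp u))
      (h1.integrable_mul (Lp.memLp W))).symm.trans (Eq.trans ?_ hibp)
    refine integral_congr_ae ?_
    filter_upwards [hu, hW, grad_parent_ae hn w, grad_parent_ae hm v] with x e1 e2 e3 e4
    simp only [Pi.mul_apply] at e1 e2 ⊢
    rw [e1, e2, e3, e4]
    ring
  simpa using key _ h

lemma slopeGraph_unique {u V W : Lp ℝ 2 D.μ} (hV : (u, V) ∈ slopeGraph D)
    (hW : (u, W) ∈ slopeGraph D) : V = W := by
  have := (slopeGraph D).sub_mem hV hW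
  rw [Prod.mk_sub_mk, sub_self] at this
  exact sub_eq_zero.1 (slopeGraph_eq_zero this)

/-- The cell averages of a square integrable function converge to it. -/
lemma tendsto_cellAverage {g : D.Space → ℝ≥0∞} (hg : Measurable g)
    (hg2 : ∫⁻ x, g x ^ 2 ∂D.μ ≠ ∞) :
    Tendsto (fun n => ∫⁻ x, (cellAverage n g x - g x) ^ 2 ∂D.μ) atTop (𝓝 0) := by
  have hfin : ∀ᵐ a ∂D.μ, g a < ∞ := by
    filter_upwards [ae_lt_top (hg.pow_const 2) hg2] with a ha
    by_contra! h
    rw [top_le_iff.1 h] at ha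
    simp at ha
  have hG2 : MemLp (fun a => (g a).toReal) 2 D.μ := by
    refine memLp_two_of_lintegral_sq hg.ennreal_toReal.aestronglyMeasurable ?_
    refine ne_top_of_le_ne_top hg2 (lintegral_mono fun a => ?_)
    simp only
    gcongr
    rw [abs_of_nonneg ENNReal.toReal_nonneg]
    exact ENNReal.ofReal_toReal_le
  rw [ENNReal.tendsto_atTop_zero]
  intro η hη
  rcases eq_or_ne η ∞ with rfl | hηt
  · exact ⟨0, fun _ _ => le_top⟩
  have hη0 : 0 < η.toReal := ENNReal.toReal_pos hη.ne' hηt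
  -- The final bound is 2(ε² + 2(ε² + ε²)) = 10 ε².
  set ε : ℝ := Real.sqrt (η.toReal / 10) with hε
  have hε0 : 0 < ε := Real.sqrt_pos.2 (by positivity)
  have hε2 : ε ^ 2 = η.toReal / 10 := Real.sq_sqrt (by positivity)
  obtain ⟨u, hu, ⟨V, c, hc, huc⟩⟩ := Metric.dense_iff.1 dense_affine (hG2.toLp _) ε hε0
  have hcc : Continuous c := continuous_of_mem_affineSub hc
  rw [Metric.mem_ball, dist_comm, dist_eq_norm] at hu
  -- h is the distance of g to the positive part of the continuous approximation c; since g ≥ 0 it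
  -- is at most |g - c|.
  set h : D.Space → ℝ≥0∞ :=
    fun x => (g x - ENNReal.ofReal (c x)) + (ENNReal.ofReal (c x) - g x) with hh
  have hcm : Measurable fun x => ENNReal.ofReal (c x) := hcc.measurable.ennreal_ofReal
  have hhm : Measurable h := (hg.sub hcm).add (hcm.sub hg)
  have hh2 : ∫⁻ x, h x ^ 2 ∂D.μ ≤ ENNReal.ofReal (ε ^ 2) := by
    refine le_trans ?_ (ENNReal.ofReal_le_ofReal (pow_le_pow_left₀ (norm_nonneg _) hu.le 2))
    rw [← lintegral_sq_eq]
    refine lintegral_mono_ae ?_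
    filter_upwards [hG2.coeFn_toLp, huc, Lp.coeFn_sub (hG2.toLp _) u, hfin] with x h1 h2 h3 h4
    gcongr
    rw [h3, Pi.sub_apply, h1, h2, hh]
    simp only
    set r := (g x).toReal
    have hr : g x = ENNReal.ofReal r := (ENNReal.ofReal_toReal h4.ne).symm
    have hr0 : 0 ≤ r := ENNReal.toReal_nonneg
    rw [hr]
    rcases le_total r (c x) with h5 | h5
    · rw [tsub_eq_zero_of_le (ENNReal.ofReal_le_ofReal h5), zero_add, ← ENNReal.ofReal_sub _ hr0,
        abs_sub_comm, abs_of_nonneg (sub_nonneg.2 h5)]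
    · rw [tsub_eq_zero_of_le (ENNReal.ofReal_le_ofReal h5), add_zero,
        abs_of_nonneg (sub_nonneg.2 h5)]
      rcases le_total 0 (c x) with h6 | h6
      · rw [← ENNReal.ofReal_sub _ h6]
      · rw [ENNReal.ofReal_of_nonpos h6, tsub_zero]
        exact ENNReal.ofReal_le_ofReal (by linarith)
  obtain ⟨N, hN⟩ := exists_forall_block_abs_sub_le (hcc.comp D.continuous_wormholeMap) hε0
  refine ⟨N, fun n hn => ?_⟩
  -- Replacing g by c costs h in the average and h at the point, and c oscillates by at most ε on
  -- the cell. The truncated subtraction asks only for this upper estimate.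
  have hpt : ∀ᵐ x ∂D.μ, cellAverage n g x - g x ≤
      ENNReal.ofReal ε + (cellAverage n h x + h x) := by
    refine ae_μ_of_ae_preMeasure (measurableSet_le ((measurable_cellAverage n g).sub hg)
      (measurable_const.add ((measurable_cellAverage n h).add hhm))) ?_
    filter_upwards [ae_exists_mem_openBlock (D := D) n] with p hp
    obtain ⟨S, hS⟩ := hp
    rw [cellAverage_wormholeMap g hS, cellAverage_wormholeMap h hS]
    rw [tsub_le_iff_left]
    have hA : ∫⁻ q, g (D.wormholeMap (par S q)) ∂D.preMeasure ≤
        (ENNReal.ofReal (c (D.wormholeMap p)) + ENNReal.ofReal ε) +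
          ∫⁻ q, h (D.wormholeMap (par S q)) ∂D.preMeasure := by
      have hcomp : Measurable fun q => h (D.wormholeMap (par S q)) :=
        hhm.comp (D.measurable_wormholeMap.comp (measurable_par S))
      calc _ ≤ ∫⁻ q, ((ENNReal.ofReal (c (D.wormholeMap p)) + ENNReal.ofReal ε) +
            h (D.wormholeMap (par S q))) ∂D.preMeasure := by
            refine lintegral_mono_ae ?_
            filter_upwards [ae_par_mem_openBlock S] with q hq
            have h1 := (abs_le.1 (hN n hn S _ (openBlock_subset _ hq) p
              (openBlock_subset _ hS))).2
            simp only [Function.comp] at h1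
            calc g (D.wormholeMap (par S q)) ≤ ENNReal.ofReal (c (D.wormholeMap (par S q))) +
                  (g (D.wormholeMap (par S q)) - ENNReal.ofReal (c (D.wormholeMap (par S q)))) :=
                  le_add_tsub
              _ ≤ _ := by
                  refine add_le_add ?_ le_self_add
                  refine (ENNReal.ofReal_le_ofReal (by linarith :
                    c (D.wormholeMap (par S q)) ≤ c (D.wormholeMap p) + ε)).trans ?_
                  exact ENNReal.ofReal_add_le
        _ = _ := by
            rw [lintegral_add_right _ hcomp, lintegral_const, measure_univ, mul_one]
    have hB : ENNReal.ofReal (c (D.wormholeMap p)) ≤ g (D.wormholeMap p) + h (D.wormholeMap p) := by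
      refine le_add_tsub.trans (add_le_add_right ?_ _)
      exact le_add_self
    calc _ ≤ _ := hA
      _ ≤ (g (D.wormholeMap p) + h (D.wormholeMap p) + ENNReal.ofReal ε) +
          ∫⁻ q, h (D.wormholeMap (par S q)) ∂D.preMeasure := by gcongr
      _ = _ := by ring
  calc ∫⁻ x, (cellAverage n g x - g x) ^ 2 ∂D.μ
      ≤ ∫⁻ x, (2 * (ENNReal.ofReal ε ^ 2 + 2 * (cellAverage n h x ^ 2 + h x ^ 2))) ∂D.μ := by
        refine lintegral_mono_ae ?_
        filter_upwards [hpt] with x hx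
        refine (pow_le_pow_left' hx 2).trans ((add_sq_le_two_mul _ _).trans ?_)
        gcongr
        exact add_sq_le_two_mul _ _
    _ = 2 * (ENNReal.ofReal ε ^ 2 + 2 * (∫⁻ x, cellAverage n h x ^ 2 ∂D.μ +
          ∫⁻ x, h x ^ 2 ∂D.μ)) := by
        have m1 := (measurable_cellAverage n h).pow_const 2
        have m2 := hhm.pow_const 2
        rw [lintegral_const_mul _ (by fun_prop), lintegral_add_left measurable_const,
          lintegral_const, measure_univ, mul_one, lintegral_const_mul _ (by fun_prop),
          lintegral_add_left m1]
    _ ≤ 2 * (ENNReal.ofReal (ε ^ 2) + 2 * (ENNReal.ofReal (ε ^ 2) + ENNReal.ofReal (ε ^ 2))) := by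
        rw [← ENNReal.ofReal_pow hε0.le]
        gcongr
        exact (lintegral_cellAverage_sq_le n hhm).trans hh2
    _ = ENNReal.ofReal (10 * ε ^ 2) := by
        rw [ENNReal.ofReal_mul (by norm_num)]
        norm_num
        ring
    _ = η := by
        rw [hε2, mul_div_cancel₀ _ (by norm_num), ENNReal.ofReal_toReal hηt]

end Graph

end LaaksoData

/-! ### Minimal generalized upper gradients -/

/-- Balls are convex, so a ball containing a tail contains its convex combinations. -/
lemma tendsto_of_mem_convexHull_tail {E F : Type*} [AddCommGroup E] [Module ℝ E]
    [NormedAddCommGroup F] [NormedSpace ℝ F] (π : E →ₗ[ℝ] F) {x y : ℕ → E} {u : F}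
    (hy : ∀ n, y n ∈ convexHull ℝ (x '' Ici n)) (h : Tendsto (fun n => π (x n)) atTop (𝓝 u)) :
    Tendsto (fun n => π (y n)) atTop (𝓝 u) := by
  rw [Metric.tendsto_atTop] at h ⊢
  intro ε hε
  obtain ⟨N, hN⟩ := h ε hε
  refine ⟨N, fun n hn => ?_⟩
  have hc : Convex ℝ (π ⁻¹' Metric.ball u ε) := (convex_ball u ε).linear_preimage π
  have : y n ∈ π ⁻¹' Metric.ball u ε := by
    refine convexHull_min ?_ hc (hy n)
    rintro _ ⟨m, hm, rfl⟩
    exact hN m (hn.trans hm)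
  exact this

namespace LaaksoData

variable {D : LaaksoData} {n : ℕ}

lemma toLp_mem_slopeGraph_of_tendsto {f : D.Space → ℝ} (hf : Continuous f)
    {y : ℕ → (D.Space → ℝ) × Lp ℝ 2 D.μ} {V : Lp ℝ 2 D.μ} (hy : ∀ n, y n ∈ affineSub D)
    (hu : ∀ ε > 0, ∃ N, ∀ n ≥ N, ∀ x, |(y n).1 x - f x| ≤ ε)
    (hV : Tendsto (fun n => (y n).2) atTop (𝓝 V)) :
    ((memLp_of_continuous hf).toLp f, V) ∈ slopeGraph D := by
  have hyc : ∀ n, MemLp (y n).1 2 D.μ := fun n =>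
    memLp_of_continuous (continuous_of_mem_affineSub (hy n))
  have hlim : Tendsto (fun n => (hyc n).toLp (y n).1) atTop
      (𝓝 ((memLp_of_continuous hf).toLp f)) := by
    rw [Metric.tendsto_atTop]
    intro ε hε
    obtain ⟨N, hN⟩ := hu (ε / 2) (half_pos hε)
    refine ⟨N, fun n hn => ?_⟩
    rw [dist_eq_norm, ← MemLp.toLp_sub]
    refine lt_of_le_of_lt (Lp.norm_le_of_ae_bound (C := ε / 2) (half_pos hε).le ?_) ?_
    · filter_upwards [((hyc n).sub (memLp_of_continuous hf)).coeFn_toLp] with x hx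
      rw [hx]
      exact hN n hn x
    · simp [measureUnivNNReal]
      linarith
  refine isClosed_slopeGraph.mem_of_tendsto (hlim.prodMk_nhds hV) (Eventually.of_forall fun n => ?_)
  exact affineGraph_le ⟨(y n).1, hy n, (hyc n).coeFn_toLp⟩

/-- A continuous function with a square integrable upper gradient is approximated by piecewise
affine functions uniformly and in energy. -/
theorem IsUpperGradient.exists_affine_approx {f : D.Space → ℝ} {g : D.Space → ℝ≥0∞}
    (h : D.IsUpperGradient f g) (hf : Continuous f) (hg2 : ∫⁻ x, g x ^ 2 ∂D.μ ≠ ∞) :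
    ∃ (y : ℕ → (D.Space → ℝ) × Lp ℝ 2 D.μ) (V : Lp ℝ 2 D.μ), (∀ n, y n ∈ affineSub D) ∧
      (∀ ε > 0, ∃ N, ∀ n ≥ N, ∀ x, |(y n).1 x - f x| ≤ ε) ∧
      Tendsto (fun n => (y n).2) atTop (𝓝 V) ∧ ∀ᵐ a ∂D.μ, ENNReal.ofReal |V a| ≤ g a := by
  -- Functions and slopes are combined with the same weights; keeping functions rather than classes
  -- preserves uniform convergence.
  set x : ℕ → (D.Space → ℝ) × Lp ℝ 2 D.μ := fun n =>
    (interp n f, (memLp_grad (interpSlope n f)).toLp _) with hx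
  have hxm : ∀ n, x n ∈ affineSub D := fun n => (isPiecewiseAffine_interp n f).mem_affineSub
  obtain ⟨y, V, hy, hV, hVg⟩ := exists_convexHull_tail_tendsto (LinearMap.snd ℝ _ _) x
    h.measurable.aemeasurable hg2 (fun n a => cellAverage n g a - g a)
    (tendsto_cellAverage h.measurable hg2) (fun n => by
      have hae : ∀ᵐ a ∂D.μ, ENNReal.ofReal |grad (interpSlope n f) a| ≤
          g a + (cellAverage n g a - g a) := by
        refine ae_μ_of_ae_preMeasure (measurableSet_le
          (measurable_grad _).abs.ennreal_ofReal
          (h.measurable.add ((measurable_cellAverage n g).sub h.measurable))) ?_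
        filter_upwards [ae_exists_mem_openBlock (D := D) n] with p hp
        obtain ⟨S, hS⟩ := hp
        rw [grad_wormholeMap hS]
        refine le_trans ?_ le_add_tsub
        rw [cellAverage_wormholeMap g hS]
        exact h.interpSlope_le hf S
      filter_upwards [hae, (memLp_grad (interpSlope n f)).coeFn_toLp] with a h1 h2
      simp only [hx, LinearMap.snd_apply]
      rw [h2]
      exact h1)
  refine ⟨y, V, fun n => ?_, fun ε hε => ?_, hV, hVg⟩
  · refine convexHull_min ?_ (affineSub D).convex (hy n)
    rintro _ ⟨m, -, rfl⟩
    exact hxm m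
  · obtain ⟨N, hN⟩ := exists_forall_abs_interp_sub_le hf hε
    refine ⟨N, fun n hn => ?_⟩
    -- Being uniformly ε-close to f is a convex condition on the first component.
    have hc : Convex ℝ {q : (D.Space → ℝ) × Lp ℝ 2 D.μ | ∀ z, |q.1 z - f z| ≤ ε} := by
      intro a ha b hb s t hs ht hst z
      have h1 := abs_le.1 (ha z)
      have h2 := abs_le.1 (hb z)
      have e : (s • a + t • b).1 z - f z = s * (a.1 z - f z) + t * (b.1 z - f z) := by
        simp only [Prod.fst_add, Prod.smul_fst, Pi.add_apply, Pi.smul_apply, smul_eq_mul]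
        linear_combination (f z) * hst
      have e2 : ε = s * ε + t * ε := by rw [← add_mul, hst, one_mul]
      rw [e, abs_le]
      constructor <;> nlinarith
    have hmem : y n ∈ {q : (D.Space → ℝ) × Lp ℝ 2 D.μ | ∀ z, |q.1 z - f z| ≤ ε} := by
      refine convexHull_min ?_ hc (hy n)
      rintro _ ⟨m, hm, rfl⟩
      exact hN m (hn.trans hm)
    exact hmem

lemma IsUpperGradient.exists_slope {f : D.Space → ℝ} {g : D.Space → ℝ≥0∞}
    (h : D.IsUpperGradient f g) (hf : Continuous f) (hg2 : ∫⁻ x, g x ^ 2 ∂D.μ ≠ ∞) :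
    ∃ V, ((memLp_of_continuous hf).toLp f, V) ∈ slopeGraph D ∧
      ∀ᵐ a ∂D.μ, ENNReal.ofReal |V a| ≤ g a := by
  obtain ⟨y, V, hy, hu, hV, hVg⟩ := h.exists_affine_approx hf hg2
  exact ⟨V, toLp_mem_slopeGraph_of_tendsto hf hy hu hV, hVg⟩

/-- A generalized upper gradient bounds the slope. -/
theorem IsGeneralizedUpperGradient.exists_slope {u : Lp ℝ 2 D.μ} {q : D.Space → ℝ≥0∞}
    (h : D.IsGeneralizedUpperGradient u q) :
    ∃ V, (u, V) ∈ slopeGraph D ∧ ∀ᵐ a ∂D.μ, ENNReal.ofReal |V a| ≤ q a := by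
  obtain ⟨hq, hq2, f, g, hfg, hfu, hgq⟩ := h
  set R : ℕ → D.Space → ℝ≥0∞ := fun n x => (g n x - q x) + (q x - g n x) with hR
  have hgR : ∀ n x, g n x ≤ q x + R n x := fun n x =>
    le_add_tsub.trans (add_le_add_right le_self_add _)
  -- The first few gradients may fail to be square integrable; from N on they have finite L²
  -- distance to q.
  obtain ⟨N, hN⟩ := eventually_atTop.1 (hgq.eventually (gt_mem_nhds (zero_lt_one (α := ℝ≥0∞))))
  have hg2 : ∀ n, ∫⁻ x, g (n + N) x ^ 2 ∂D.μ ≠ ∞ := by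
    intro n
    have hRn : ∫⁻ x, R (n + N) x ^ 2 ∂D.μ ≠ ∞ :=
      ((hN (n + N) (Nat.le_add_left _ _)).trans ENNReal.one_lt_top).ne
    refine ne_top_of_le_ne_top (b := 2 * (∫⁻ x, q x ^ 2 ∂D.μ + ∫⁻ x, R (n + N) x ^ 2 ∂D.μ)) ?_ ?_
    · exact ENNReal.mul_ne_top (by norm_num) (ENNReal.add_ne_top.2 ⟨hq2, hRn⟩)
    · rw [← lintegral_add_left (hq.pow_const 2), ← lintegral_const_mul' _ _ (by norm_num)]
      exact lintegral_mono fun x => (pow_le_pow_left' (hgR _ x) 2).trans (add_sq_le_two_mul _ _)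
  have hex := fun n => (hfg (n + N)).2.exists_slope (hfg (n + N)).1 (hg2 n)
  choose V hV hVg using hex
  set x : ℕ → Lp ℝ 2 D.μ × Lp ℝ 2 D.μ := fun n =>
    ((memLp_of_continuous (hfg (n + N)).1).toLp (f (n + N)), V n) with hx
  -- The slopes of the approximating functions are bounded by q up to an error tending to 0 in L²,
  -- so Mazur's argument applies a second time, now inside the closed graph.
  obtain ⟨y, W, hy, hW, hWq⟩ := exists_convexHull_tail_tendsto (LinearMap.snd ℝ _ _) x
    hq.aemeasurable hq2 (fun n => R (n + N)) (hgq.comp (tendsto_add_atTop_nat N)) (fun n => by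
      filter_upwards [hVg n] with a ha using ha.trans (hgR _ a))
  refine ⟨W, ?_, hWq⟩
  have hfst : Tendsto (fun n => (x n).1) atTop (𝓝 u) := by
    rw [← tendsto_sub_nhds_zero_iff, tendsto_zero_iff_lintegral_sq]
    refine (hfu.comp (tendsto_add_atTop_nat N)).congr fun n => lintegral_congr_ae ?_
    filter_upwards [Lp.coeFn_sub ((memLp_of_continuous (hfg (n + N)).1).toLp (f (n + N))) u,
      (memLp_of_continuous (hfg (n + N)).1).coeFn_toLp] with a h1 h2
    simp only [hx]
    rw [h1, Pi.sub_apply, h2]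
  have hyfst := tendsto_of_mem_convexHull_tail (LinearMap.fst ℝ _ _) hy hfst
  refine isClosed_slopeGraph.mem_of_tendsto (hyfst.prodMk_nhds hW) (Eventually.of_forall fun n => ?_)
  refine convexHull_min ?_ (slopeGraph D).convex (hy n)
  rintro _ ⟨m, -, rfl⟩
  exact hV m

lemma gradBound_ae (v : D.Cell n → ℝ) (C : ℝ) :
    (fun x => gradBound v C x) =ᵐ[D.μ] fun x => |grad v x| := by
  refine ae_μ_of_ae_preMeasure (measurableSet_eq_fun (measurable_gradBound v C)
    (measurable_grad v).abs) ?_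
  filter_upwards [ae_exists_mem_openBlock (D := D) n] with p hp
  obtain ⟨S, hS⟩ := hp
  unfold gradBound
  rw [if_pos (mem_iUnion.2 ⟨S, mem_image_of_mem _ hS⟩)]

lemma exists_isUpperGradient_of_mem_affineSub {f : D.Space → ℝ} {W : Lp ℝ 2 D.μ}
    (h : (f, W) ∈ affineSub D) : ∃ g, D.IsUpperGradient f g ∧
      ∀ᵐ a ∂D.μ, g a = ENNReal.ofReal |W a| := by
  obtain ⟨n, v, hv, hW⟩ := h
  refine ⟨_, hv.isUpperGradient (C := ∑ S, |v S|) fun S => Finset.single_le_sum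
    (f := fun S => |v S|) (fun _ _ => abs_nonneg _) (Finset.mem_univ S), ?_⟩
  filter_upwards [hW, gradBound_ae v (∑ S, |v S|)] with a h1 h2
  rw [h2, h1]

lemma ofReal_abs_sub_add_le (a b : ℝ) : (ENNReal.ofReal |a| - ENNReal.ofReal |b|) +
    (ENNReal.ofReal |b| - ENNReal.ofReal |a|) ≤ ENNReal.ofReal |a - b| := by
  rw [← ENNReal.ofReal_sub _ (abs_nonneg _), ← ENNReal.ofReal_sub _ (abs_nonneg _)]
  have h1 := abs_sub_abs_le_abs_sub a b
  have h2 := abs_sub_abs_le_abs_sub b a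
  rw [abs_sub_comm b] at h2
  rcases le_total |a| |b| with h | h
  · rw [ENNReal.ofReal_of_nonpos (sub_nonpos.2 h), zero_add]
    exact ENNReal.ofReal_le_ofReal h2
  · rw [ENNReal.ofReal_of_nonpos (sub_nonpos.2 h), add_zero]
    exact ENNReal.ofReal_le_ofReal h1

/-- The modulus of the slope is a generalized upper gradient. -/
theorem isGeneralizedUpperGradient_of_mem {u V : Lp ℝ 2 D.μ} (h : (u, V) ∈ slopeGraph D)
    {q : D.Space → ℝ≥0∞} (hq : Measurable q) (hqV : ∀ᵐ a ∂D.μ, q a = ENNReal.ofReal |V a|) :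
    D.IsGeneralizedUpperGradient u q := by
  have hq2 : ∫⁻ x, q x ^ 2 ∂D.μ = ENNReal.ofReal (‖V‖ ^ 2) := by
    rw [← lintegral_sq_eq]
    refine lintegral_congr_ae ?_
    filter_upwards [hqV] with a ha
    rw [ha]
  refine ⟨hq, hq2 ▸ ENNReal.ofReal_ne_top, ?_⟩
  have h' : (u, V) ∈ closure (affineGraph D : Set (Lp ℝ 2 D.μ × Lp ℝ 2 D.μ)) := h
  obtain ⟨x, hx, hlim⟩ := mem_closure_iff_seq_limit.1 h'
  choose f hf hfx using hx
  have hex := fun n => exists_isUpperGradient_of_mem_affineSub (hf n)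
  choose g hg hgae using hex
  have h1 : Tendsto (fun n => (x n).1 - u) atTop (𝓝 0) :=
    tendsto_sub_nhds_zero_iff.2 ((continuous_fst.tendsto _).comp hlim)
  have h2 : Tendsto (fun n => (x n).2 - V) atTop (𝓝 0) :=
    tendsto_sub_nhds_zero_iff.2 ((continuous_snd.tendsto _).comp hlim)
  rw [tendsto_zero_iff_lintegral_sq] at h1 h2
  refine ⟨f, g, fun n => ⟨continuous_of_mem_affineSub (hf n), hg n⟩, ?_, ?_⟩
  · refine h1.congr fun n => lintegral_congr_ae ?_
    filter_upwards [Lp.coeFn_sub (x n).1 u, hfx n] with a e1 e2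
    rw [e1, Pi.sub_apply, e2]
  · refine tendsto_of_tendsto_of_tendsto_of_le_of_le tendsto_const_nhds h2 (fun _ => zero_le)
      fun n => lintegral_mono_ae ?_
    filter_upwards [hgae n, hqV, Lp.coeFn_sub (x n).2 V] with a e1 e2 e3
    rw [e1, e2, e3, Pi.sub_apply]
    exact pow_le_pow_left' (ofReal_abs_sub_add_le _ _) 2

lemma measurable_ofReal_abs (V : Lp ℝ 2 D.μ) : Measurable fun x => ENNReal.ofReal |V x| :=
  (Lp.stronglyMeasurable V).measurable.abs.ennreal_ofReal

/-- The minimal generalized upper gradient is the modulus of the slope. -/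
theorem isMGUG_iff {u : Lp ℝ 2 D.μ} {p : D.Space → ℝ≥0∞} : D.IsMGUG u p ↔
    Measurable p ∧ ∃ V, (u, V) ∈ slopeGraph D ∧ ∀ᵐ a ∂D.μ, p a = ENNReal.ofReal |V a| := by
  constructor
  · rintro ⟨h1, h2⟩
    obtain ⟨V, hV, hVp⟩ := h1.exists_slope
    refine ⟨h1.1, V, hV, ?_⟩
    have h3 := h2 _ (isGeneralizedUpperGradient_of_mem hV (measurable_ofReal_abs V)
      (Eventually.of_forall fun _ => rfl))
    filter_upwards [hVp, h3] with a h4 h5 using le_antisymm h5 h4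
  · rintro ⟨hp, V, hV, hpV⟩
    refine ⟨isGeneralizedUpperGradient_of_mem hV hp hpV, fun q hq => ?_⟩
    obtain ⟨W, hW, hWq⟩ := hq.exists_slope
    rw [slopeGraph_unique hW hV] at hWq
    filter_upwards [hWq, hpV] with a h1 h2 using h2.trans_le h1

/-- A minimal square integrable upper gradient of a continuous function is its minimal generalized
upper gradient. -/
theorem IsMinimalUpperGradient.isMGUG {f : D.Space → ℝ} {p : D.Space → ℝ≥0∞} (hf : Continuous f)
    (h : D.IsMinimalUpperGradient f p) (hp2 : ∫⁻ x, p x ^ 2 ∂D.μ ≠ ∞) {u : Lp ℝ 2 D.μ}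
    (hu : u =ᵐ[D.μ] f) : D.IsMGUG u p := by
  -- This yields |V| ≤ p; what remains is the opposite inequality, from the minimality of p.
  obtain ⟨y, V, hy, hunif, hV, hVp⟩ := h.1.exists_affine_approx hf hp2
  have hmem := toLp_mem_slopeGraph_of_tendsto hf hy hunif hV
  have hu' : (memLp_of_continuous hf).toLp f = u :=
    Lp.ext ((memLp_of_continuous hf).coeFn_toLp.trans hu.symm)
  rw [hu'] at hmem
  refine isMGUG_iff.2 ⟨h.1.measurable, V, hmem, ?_⟩
  have hex := fun n => exists_isUpperGradient_of_mem_affineSub (hy n)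
  choose g hg hgae using hex
  obtain ⟨ns, hns, hae⟩ := (tendstoInMeasure_of_tendsto_Lp hV).exists_seq_tendsto_ae
  have hpt : ∀ x, Tendsto (fun n => (y n).1 x) atTop (𝓝 (f x)) := fun x => by
    rw [Metric.tendsto_atTop]
    intro ε hε
    obtain ⟨N, hN⟩ := hunif (ε / 2) (half_pos hε)
    exact ⟨N, fun n hn => by rw [Real.dist_eq]; linarith [hN n hn x]⟩
  -- The approximations converge at every point, so the upper gradient inequality passes to the
  -- limit with the supremum of a tail on the right.
  have hsup : ∀ m, D.IsUpperGradient f fun x => ⨆ i, g (ns (i + m)) x := by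
    intro m
    refine ⟨Measurable.iSup fun i => (hg _).measurable, fun γ hγ hl => ?_⟩
    have hns' : Tendsto (fun i => ns (i + m)) atTop atTop :=
      hns.tendsto_atTop.comp (tendsto_add_atTop_nat m)
    have hlim : Tendsto (fun i => ENNReal.ofReal |(y (ns (i + m))).1 (γ 0) -
        (y (ns (i + m))).1 (γ 1)|) atTop (𝓝 (ENNReal.ofReal |f (γ 0) - f (γ 1)|)) :=
      ENNReal.tendsto_ofReal (((hpt (γ 0)).comp hns').sub ((hpt (γ 1)).comp hns')).abs
    refine le_of_tendsto' hlim fun i => ((hg _).le_integral γ hγ hl).trans ?_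
    exact lintegral_mono fun s => le_iSup (fun i => g (ns (i + m)) _) i
  -- Minimality holds for every tail, so p is at most the upper limit, which is |V| along the
  -- subsequence.
  have hle : ∀ᵐ a ∂D.μ, ∀ m, p a ≤ ⨆ i, g (ns (i + m)) a := ae_all_iff.2 fun m => h.2 _ (hsup m)
  filter_upwards [hle, hVp, hae, ae_all_iff.2 hgae] with a h1 h2 h3 h4
  refine le_antisymm ?_ h2
  have h5 : Tendsto (fun i => g (ns i) a) atTop (𝓝 (ENNReal.ofReal |V a|)) := by
    simp only [h4]
    exact ENNReal.tendsto_ofReal h3.abs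
  rw [← h5.limsup_eq, limsup_eq_iInf_iSup_of_nat']
  exact le_iInf h1

end LaaksoData

/-! ### The Dirichlet form -/

namespace LaaksoData

variable {D : LaaksoData} {n : ℕ}

/-- The slope operator: the closed operator with graph `slopeGraph`. -/
noncomputable def slope (D : LaaksoData) : Lp ℝ 2 D.μ →ₗ.[ℝ] Lp ℝ 2 D.μ :=
  (slopeGraph D).toLinearPMap

lemma slope_mem_slopeGraph (u : (slope D).domain) : ((u : Lp ℝ 2 D.μ), slope D u) ∈ slopeGraph D :=
  Submodule.mem_graph_toLinearPMap (fun x hx h0 => slopeGraph_eq_zero (by rw [← h0]; exact hx)) u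

lemma mem_slope_domain {u : Lp ℝ 2 D.μ} : u ∈ (slope D).domain ↔ ∃ V, (u, V) ∈ slopeGraph D := by
  constructor
  · exact fun h => ⟨_, slope_mem_slopeGraph ⟨u, h⟩⟩
  · rintro ⟨V, hV⟩
    exact ⟨(u, V), hV, rfl⟩

lemma slope_eq {u V : Lp ℝ 2 D.μ} (h : (u, V) ∈ slopeGraph D) (hu : u ∈ (slope D).domain) :
    slope D ⟨u, hu⟩ = V :=
  slopeGraph_unique (slope_mem_slopeGraph ⟨u, hu⟩) h

lemma abs_clamp_sub_le (a b : ℝ) : |max 0 (min a 1) - max 0 (min b 1)| ≤ |a - b| := by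
  refine (abs_max_sub_max_le_max 0 _ 0 _).trans ?_
  rw [sub_self, abs_zero, max_eq_right (abs_nonneg _)]
  refine (abs_min_sub_min_le_max a 1 b 1).trans ?_
  rw [sub_self, abs_zero, max_eq_left (abs_nonneg _)]

/-- Generalized upper gradients survive the unit contraction. -/
lemma IsGeneralizedUpperGradient.clamp {u v : Lp ℝ 2 D.μ} {q : D.Space → ℝ≥0∞}
    (h : D.IsGeneralizedUpperGradient u q) (hv : v =ᵐ[D.μ] fun x => max 0 (min (u x) 1)) :
    D.IsGeneralizedUpperGradient v q := by
  obtain ⟨hq, hq2, f, g, hfg, hfu, hgq⟩ := h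
  refine ⟨hq, hq2, fun n x => max 0 (min (f n x) 1), g, fun n => ⟨?_, ?_⟩, ?_, hgq⟩
  · have := (hfg n).1
    fun_prop
  · refine ⟨(hfg n).2.measurable, fun γ hγ hl => le_trans ?_ ((hfg n).2.le_integral γ hγ hl)⟩
    exact ENNReal.ofReal_le_ofReal (abs_clamp_sub_le _ _)
  · refine tendsto_of_tendsto_of_tendsto_of_le_of_le tendsto_const_nhds hfu (fun _ => zero_le)
      fun n => lintegral_mono_ae ?_
    filter_upwards [hv] with x hx
    rw [hx]
    exact pow_le_pow_left' (ENNReal.ofReal_le_ofReal (abs_clamp_sub_le _ _)) 2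

/-- The form `∫ ⟨∂u, ∂v⟩ dμ`. -/
noncomputable def slopeForm (D : LaaksoData) : DirichletForm D.μ where
  domain := (slope D).domain
  form := (innerₗ (Lp ℝ 2 D.μ)).compl₁₂ (slope D).toFun (slope D).toFun
  dense := by
    have : ((slope D).domain : Set (Lp ℝ 2 D.μ)) = {u | ∃ V, (u, V) ∈ slopeGraph D} := by
      ext u
      exact mem_slope_domain
    rw [this]
    exact dense_slopeGraph
  symm u v := real_inner_comm ((slope D).toFun v) ((slope D).toFun u)
  nonneg u := real_inner_self_nonneg (x := (slope D).toFun u)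
  closed u hu := by
    simp only [LinearMap.compl₁₂_apply, innerₗ_apply_apply, real_inner_self_eq_norm_sq] at hu ⊢
    have hsub : ∀ a b, (slope D).toFun (a - b) = slope D a - slope D b := fun a b =>
      (slope D).toFun.map_sub a b
    -- Form Cauchy sequences are Cauchy in the graph of ∂, which is closed.
    have hcau : CauchySeq fun n => ((u n : Lp ℝ 2 D.μ), slope D (u n)) := by
      rw [Metric.cauchySeq_iff]
      intro ε hε
      obtain ⟨N, hN⟩ := hu (ε ^ 2) (by positivity)
      refine ⟨N, fun m hm n hn => ?_⟩
      have h := hN m hm n hn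
      rw [hsub] at h
      have h1 : ‖slope D (u m) - slope D (u n)‖ < ε :=
        lt_of_pow_lt_pow_left₀ 2 hε.le (by nlinarith [sq_nonneg ‖u m - u n‖])
      have h2 : ‖u m - u n‖ < ε :=
        lt_of_pow_lt_pow_left₀ 2 hε.le (by nlinarith [sq_nonneg ‖slope D (u m) - slope D (u n)‖])
      rw [Prod.dist_eq, dist_eq_norm, dist_eq_norm]
      exact max_lt h2 h1
    obtain ⟨⟨w, V⟩, hlim⟩ := cauchySeq_tendsto_of_complete hcau
    have hmem : (w, V) ∈ slopeGraph D := isClosed_slopeGraph.mem_of_tendsto hlim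
      (Eventually.of_forall fun n => slope_mem_slopeGraph (u n))
    have hw : w ∈ (slope D).domain := mem_slope_domain.2 ⟨V, hmem⟩
    refine ⟨⟨w, hw⟩, ?_⟩
    have h1 : Tendsto (fun n => slope D (u n) - V) atTop (𝓝 0) :=
      tendsto_sub_nhds_zero_iff.2 ((continuous_snd.tendsto _).comp hlim)
    have h2 : Tendsto (fun n => (u n : Lp ℝ 2 D.μ) - w) atTop (𝓝 0) :=
      tendsto_sub_nhds_zero_iff.2 ((continuous_fst.tendsto _).comp hlim)
    have h3 := (h1.norm.pow 2).add (h2.norm.pow 2)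
    simp only [norm_zero, ne_eq, OfNat.ofNat_ne_zero, not_false_eq_true, zero_pow, add_zero] at h3
    refine h3.congr fun n => ?_
    rw [hsub, slope_eq hmem hw]
    rfl
  markov u v hv := by
    have hu := slope_mem_slopeGraph u
    have hq := isGeneralizedUpperGradient_of_mem hu (measurable_ofReal_abs (slope D u))
      (Eventually.of_forall fun _ => rfl)
    -- |∂u| stays a generalized upper gradient after clamping, so it bounds the slope of the clamped
    -- function.
    obtain ⟨W, hW, hWle⟩ := (hq.clamp hv).exists_slope
    have hvd : v ∈ (slope D).domain := mem_slope_domain.2 ⟨W, hW⟩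
    refine ⟨hvd, ?_⟩
    simp only [LinearMap.compl₁₂_apply, innerₗ_apply_apply, real_inner_self_eq_norm_sq]
    have e : (slope D).toFun ⟨v, hvd⟩ = W := slope_eq hW hvd
    rw [e]
    refine pow_le_pow_left₀ (norm_nonneg _) (Lp.norm_le_norm_of_ae_le ?_) 2
    filter_upwards [hWle] with x hx
    exact (ENNReal.ofReal_le_ofReal_iff (abs_nonneg _)).1 hx

lemma slopeForm_apply {u v V W : Lp ℝ 2 D.μ} (hu : (u, V) ∈ slopeGraph D)
    (hv : (v, W) ∈ slopeGraph D) (hu' : u ∈ (slopeForm D).domain)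
    (hv' : v ∈ (slopeForm D).domain) : (slopeForm D).form ⟨u, hu'⟩ ⟨v, hv'⟩ = inner ℝ V W := by
  have e1 : (slope D).toFun ⟨u, hu'⟩ = V := slope_eq hu hu'
  have e2 : (slope D).toFun ⟨v, hv'⟩ = W := slope_eq hv hv'
  change inner ℝ ((slope D).toFun ⟨u, hu'⟩) ((slope D).toFun ⟨v, hv'⟩) = _
  rw [e1, e2]

lemma slopeForm_self {u V : Lp ℝ 2 D.μ} (hu : (u, V) ∈ slopeGraph D)
    (hu' : u ∈ (slopeForm D).domain) : (slopeForm D).form ⟨u, hu'⟩ ⟨u, hu'⟩ = ‖V‖ ^ 2 := by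
  rw [slopeForm_apply hu hu, real_inner_self_eq_norm_sq]

theorem isMGUGForm_slopeForm : D.IsMGUGForm (slopeForm D) where
  mem_domain u := by
    refine mem_slope_domain.trans ⟨?_, ?_⟩
    · rintro ⟨V, hV⟩
      exact ⟨_, isMGUG_iff.2 ⟨measurable_ofReal_abs V, V, hV, Eventually.of_forall fun _ => rfl⟩⟩
    · rintro ⟨p, hp⟩
      obtain ⟨-, V, hV, -⟩ := isMGUG_iff.1 hp
      exact ⟨V, hV⟩
  form_self u p hp := by
    obtain ⟨-, V, hV, hpV⟩ := isMGUG_iff.1 hp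
    rw [slopeForm_self hV u.2, ← lintegral_sq_eq]
    refine lintegral_congr_ae ?_
    filter_upwards [hpV] with x hx
    rw [hx]

lemma IsPiecewiseAffine.mem_slopeGraph {f : D.Space → ℝ} {v : D.Cell n → ℝ}
    (hf : IsPiecewiseAffine f v) {u : Lp ℝ 2 D.μ} (hu : u =ᵐ[D.μ] f) :
    (u, (memLp_grad v).toLp _) ∈ slopeGraph D :=
  affineGraph_le ⟨f, hf.mem_affineSub, hu⟩

/-- The height itself has slope 1. -/
theorem isNonzero_slopeForm : (slopeForm D).IsNonzero := by
  have hf : IsPiecewiseAffine D.height (fun _ : D.Cell 0 => (1 : ℝ)) := fun S p _ q _ => by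
    rw [one_mul]
    rfl
  have hm := hf.mem_slopeGraph (memLp_of_continuous continuous_height).coeFn_toLp
  have hd := mem_slope_domain.2 ⟨_, hm⟩
  refine ⟨⟨_, hd⟩, ⟨_, hd⟩, ?_⟩
  rw [slopeForm_self hm hd]
  intro h0
  have h1 : (memLp_grad (fun _ : D.Cell 0 => (1 : ℝ))).toLp _ = 0 :=
    norm_eq_zero.1 ((pow_eq_zero_iff two_ne_zero).1 h0)
  have h2 := (memLp_grad (fun _ : D.Cell 0 => (1 : ℝ))).coeFn_toLp
  rw [h1] at h2
  have h3 : ∀ᵐ x ∂D.μ, grad (fun _ : D.Cell 0 => (1 : ℝ)) x = 0 := by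
    filter_upwards [h2, Lp.coeFn_zero ℝ 2 D.μ] with x e1 e2
    rw [← e1, e2, Pi.zero_apply]
  obtain ⟨p, hp1, S, hS⟩ :=
    ((ae_preMeasure_of_ae_μ h3).and (ae_exists_mem_openBlock (D := D) 0)).exists
  rw [grad_wormholeMap hS] at hp1
  exact one_ne_zero hp1

/-- Piecewise affine functions are continuous and form a core by the construction of ∂ as a closure;
interpolation makes them uniformly dense, and L is compact. -/
theorem isRegular_slopeForm : (slopeForm D).IsRegular where
  dense_domain u ε hε := by
    have hu := slope_mem_slopeGraph u
    have h' : ((u : Lp ℝ 2 D.μ), slope D u) ∈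
        closure (affineGraph D : Set (Lp ℝ 2 D.μ × Lp ℝ 2 D.μ)) := hu
    obtain ⟨⟨w, W⟩, ⟨f, hf, hwf⟩, hdist⟩ := Metric.mem_closure_iff.1 h' (Real.sqrt (ε / 2))
      (Real.sqrt_pos.2 (half_pos hε))
    have hmem : (w, W) ∈ slopeGraph D := affineGraph_le ⟨f, hf, hwf⟩
    have hw : w ∈ (slopeForm D).domain := mem_slope_domain.2 ⟨W, hmem⟩
    refine ⟨⟨w, hw⟩, ⟨f, continuous_of_mem_affineSub hf, HasCompactSupport.of_compactSpace _, hwf⟩, ?_⟩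
    have h1 : (slopeForm D).form (u - ⟨w, hw⟩) (u - ⟨w, hw⟩) = ‖slope D u - W‖ ^ 2 :=
      slopeForm_self ((slopeGraph D).sub_mem hu hmem) (u - ⟨w, hw⟩).2
    have h2 : ‖u - ⟨w, hw⟩‖ = ‖(u : Lp ℝ 2 D.μ) - w‖ := rfl
    rw [h1, h2]
    rw [Prod.dist_eq, max_lt_iff, dist_eq_norm, dist_eq_norm, Real.lt_sqrt (norm_nonneg _),
      Real.lt_sqrt (norm_nonneg _)] at hdist
    linarith [hdist.1, hdist.2]
  dense_continuous g hg _ ε hε := by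
    obtain ⟨N, hN⟩ := exists_forall_abs_interp_sub_le hg (half_pos hε)
    have hpa := isPiecewiseAffine_interp N g
    have hm := memLp_of_continuous hpa.continuous
    refine ⟨interp N g, hpa.continuous, HasCompactSupport.of_compactSpace _,
      ⟨hm, mem_slope_domain.2 ⟨_, hpa.mem_slopeGraph hm.coeFn_toLp⟩⟩, fun x => ?_⟩
    rw [abs_sub_comm]
    exact (hN N le_rfl x).trans_lt (half_lt_self hε)

/-- The constant 1 has slope 0, hence lies in the kernel of the generator and is fixed by the
semigroup. -/
theorem isConservative_slopeForm : (slopeForm D).IsConservative := by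
  obtain ⟨T, hT0, hTadd, hTc, hTg, hT1⟩ :=
    exists_semigroup_of_graph (slopeGraph D) isClosed_slopeGraph dense_slopeGraph
  refine ⟨T, ⟨hT0, hTadd, hTc, fun u w => (hTg u w).trans ?_⟩, fun t _ => hT1 _ ?_ t⟩
  · constructor
    · rintro ⟨V, hV, h⟩
      have hu : u ∈ (slopeForm D).domain := mem_slope_domain.2 ⟨V, hV⟩
      refine ⟨hu, fun v => ?_⟩
      have hv := slope_mem_slopeGraph v
      rw [slopeForm_apply hV hv hu v.2]
      exact h _ hv
    · rintro ⟨hu, h⟩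
      have hV := slope_mem_slopeGraph ⟨u, hu⟩
      refine ⟨_, hV, ?_⟩
      rintro ⟨v, W⟩ hq
      have hv : v ∈ (slopeForm D).domain := mem_slope_domain.2 ⟨W, hq⟩
      rw [← h ⟨v, hv⟩, slopeForm_apply hV hq hu hv]
  · have hf : IsPiecewiseAffine (fun _ : D.Space => (1 : ℝ)) (0 : D.Cell 0 → ℝ) :=
      fun S p _ q _ => by simp
    have h1 : Lp.const 2 D.μ (1 : ℝ) =ᵐ[D.μ] fun _ => (1 : ℝ) := Lp.coeFn_const 2 D.μ 1
    have h2 := hf.mem_slopeGraph h1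
    have h3 : (memLp_grad (0 : D.Cell 0 → ℝ)).toLp _ = 0 := by
      rw [Lp.eq_zero_iff_ae_eq_zero]
      filter_upwards [(memLp_grad (0 : D.Cell 0 → ℝ)).coeFn_toLp] with x hx
      rw [hx]
      simp [grad]
    rwa [h3] at h2

/-- The energy of a function whose slope is `V`. -/
lemma energy_slopeForm {f : D.Space → ℝ} (hf : MemLp f 2 D.μ) {V : Lp ℝ 2 D.μ}
    (h : (hf.toLp f, V) ∈ slopeGraph D) :
    (slopeForm D).Mem f ∧ (slopeForm D).energy f = ‖V‖ ^ 2 := by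
  have hm : (slopeForm D).Mem f := ⟨hf, mem_slope_domain.2 ⟨V, h⟩⟩
  refine ⟨hm, ?_⟩
  unfold DirichletForm.energy
  rw [dif_pos hm]
  exact slopeForm_self h _

lemma Mem.exists_slope {f : D.Space → ℝ} (h : (slopeForm D).Mem f) :
    ∃ (hf : MemLp f 2 D.μ) (V : Lp ℝ 2 D.μ), (hf.toLp f, V) ∈ slopeGraph D := by
  obtain ⟨hf, hd⟩ := h
  exact ⟨hf, mem_slope_domain.1 hd⟩

end LaaksoData

/-! ### Folding maps -/

section Pullback

variable {X : Type*} [MeasurableSpace X] {μ : Measure X}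

/-- Composition with a map that does not concentrate the measure, followed by multiplication by a
bounded function, is a bounded operator on `L²`. -/
lemma exists_continuousLinearMap_comp {θ : X → X} (hθ : Measurable θ) {c : ℝ≥0}
    (hc : μ.map θ ≤ c • μ) {a : X → ℝ} (ha : Measurable a) (ha1 : ∀ x, |a x| ≤ 1) :
    ∃ C : Lp ℝ 2 μ →L[ℝ] Lp ℝ 2 μ, ∀ u, C u =ᵐ[μ] fun x => a x * u (θ x) := by
  have hq : Measure.QuasiMeasurePreserving θ μ μ :=
    ⟨hθ, (Measure.absolutelyContinuous_of_le hc).trans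
      (Measure.AbsolutelyContinuous.smul_left Measure.AbsolutelyContinuous.rfl c)⟩
  have hle : ∀ u : Lp ℝ 2 μ, eLpNorm (fun x => a x * u (θ x)) 2 μ ≤
      (c : ℝ≥0∞) ^ (1 / 2 : ℝ) * eLpNorm u 2 μ := by
    intro u
    calc eLpNorm (fun x => a x * u (θ x)) 2 μ ≤ eLpNorm (u ∘ θ) 2 μ := by
          refine eLpNorm_mono fun x => ?_
          rw [norm_mul, Real.norm_eq_abs]
          exact mul_le_of_le_one_left (norm_nonneg _) (ha1 x)
      _ = eLpNorm u 2 (μ.map θ) := (eLpNorm_map_measure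
          ((Lp.aestronglyMeasurable u).mono_ac hq.absolutelyContinuous) hθ.aemeasurable).symm
      _ ≤ eLpNorm u 2 (c • μ) := eLpNorm_mono_measure _ hc
      _ = _ := by
          rw [show c • μ = (c : ℝ≥0∞) • μ from rfl,
            eLpNorm_smul_measure_of_ne_top (by norm_num)]
          simp
  have hm : ∀ u : Lp ℝ 2 μ, MemLp (fun x => a x * u (θ x)) 2 μ := fun u =>
    ⟨ha.aestronglyMeasurable.mul ((Lp.aestronglyMeasurable u).comp_quasiMeasurePreserving hq),
      (hle u).trans_lt (ENNReal.mul_lt_top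
        (ENNReal.rpow_lt_top_of_nonneg (by norm_num) ENNReal.coe_ne_top) (Lp.eLpNorm_lt_top u))⟩
  let C : Lp ℝ 2 μ →ₗ[ℝ] Lp ℝ 2 μ :=
    { toFun := fun u => (hm u).toLp _
      map_add' := fun u v => by
        ext1
        filter_upwards [(hm (u + v)).coeFn_toLp, Lp.coeFn_add ((hm u).toLp _) ((hm v).toLp _),
          (hm u).coeFn_toLp, (hm v).coeFn_toLp, hq.ae (Lp.coeFn_add u v)] with x h1 h2 h3 h4 h5
        rw [h1, h2, Pi.add_apply, h3, h4, h5, Pi.add_apply, mul_add]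
      map_smul' := fun s u => by
        ext1
        filter_upwards [(hm (s • u)).coeFn_toLp, Lp.coeFn_smul s ((hm u).toLp _),
          (hm u).coeFn_toLp, hq.ae (Lp.coeFn_smul s u)] with x h1 h2 h3 h5
        rw [h1, RingHom.id_apply, h2, Pi.smul_apply, h3, h5, Pi.smul_apply, smul_eq_mul,
          smul_eq_mul]
        ring }
  refine ⟨C.mkContinuous ((c : ℝ≥0∞) ^ (1 / 2 : ℝ)).toReal fun u => ?_,
    fun u => (hm u).coeFn_toLp⟩
  change ‖(hm u).toLp _‖ ≤ _
  rw [Lp.norm_toLp, Lp.norm_def, ← ENNReal.toReal_mul]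
  exact ENNReal.toReal_mono (ENNReal.mul_ne_top
    (ENNReal.rpow_ne_top_of_nonneg (by norm_num) ENNReal.coe_ne_top) (Lp.eLpNorm_ne_top u)) (hle u)

end Pullback

namespace LaaksoData

variable {D : LaaksoData} {n : ℕ}

/-- Up to scaling, the triangle wave is the norm on the circle ℝ / ℤ. -/
lemma continuous_triangle : Continuous triangle := by
  have h : triangle = fun t : ℝ => 2 * ‖((t / 2 : ℝ) : UnitAddCircle)‖ := by
    funext t
    rw [UnitAddCircle.norm_eq, triangle, ← abs_two, ← abs_mul, abs_two]
    congr 1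
    ring
  rw [h]
  exact continuous_const.mul (((AddCircle.continuous_mk' 1).comp
    (continuous_id.div_const (2 : ℝ))).norm)

lemma continuous_symFold (S : D.Cell n) (m : ℤ) (τ : Equiv.Perm (Fin D.k))
    (z : Fin D.k → ℕ → Bool) : Continuous (symFold S m τ z) := by
  refine Continuous.prodMk (Continuous.subtype_mk ?_ _) ?_
  · have := continuous_triangle
    fun_prop
  · refine (continuous_overwrite S.2).comp ?_
    refine continuous_pi fun c => continuous_pi fun l => ?_
    exact (continuous_of_discreteTopology (f := fun b => xor (z c l) b)).comp (by fun_prop)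

/-- The sign of the slope of the folding of the interval. -/
noncomputable def foldSign (m : ℤ) (T : D.Cell n) : ℝ :=
  if Even (((T.1 : ℕ) : ℤ) - m) then 1 else -1

/-- On a block of level n the argument of the triangle wave stays between consecutive integers; the
parity of the lower one selects the increasing or the decreasing branch. -/
lemma symFold_height (S : D.Cell n) (m : ℤ) (τ : Equiv.Perm (Fin D.k)) (z : Fin D.k → ℕ → Bool)
    {T : D.Cell n} {p : D.Pre} (hp : p ∈ block T) :
    ((symFold S m τ z p).1 : ℝ) * D.d n =
      (S.1 : ℕ) + if Even (((T.1 : ℕ) : ℤ) - m) then (p.1 : ℝ) * D.d n - (T.1 : ℕ)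
        else 1 - ((p.1 : ℝ) * D.d n - (T.1 : ℕ)) := by
  rw [mem_block_iff] at hp
  have e : (D.d n : ℝ) * p.1 - m =
      ((((T.1 : ℕ) : ℤ) - m : ℤ) : ℝ) + (p.1 * D.d n - (T.1 : ℕ)) := by push_cast; ring
  simp only [symFold]
  rw [div_mul_cancel₀ _ (d_pos_real n).ne', e]
  split_ifs with h
  · rw [triangle_even_add h (by linarith [hp.1]) (by linarith [hp.2.1])]
  · rw [triangle_odd_add h (by linarith [hp.1]) (by linarith [hp.2.1])]

lemma symFold_height_sub (S : D.Cell n) (m : ℤ) (τ : Equiv.Perm (Fin D.k))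
    (z : Fin D.k → ℕ → Bool) {T : D.Cell n} {p q : D.Pre} (hp : p ∈ block T) (hq : q ∈ block T) :
    ((symFold S m τ z q).1 : ℝ) - (symFold S m τ z p).1 = foldSign m T * ((q.1 : ℝ) - p.1) := by
  have h1 := symFold_height S m τ z hp
  have h2 := symFold_height S m τ z hq
  refine mul_right_cancel₀ (d_pos_real (D := D) n).ne' ?_
  rw [sub_mul, h1, h2]
  unfold foldSign
  split_ifs <;> ring

/-- Foldings map the cells of higher level onto cells. -/
lemma exists_symFold_mem_block {N : ℕ} (h : n ≤ N) (S : D.Cell n) (m : ℤ)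
    (τ : Equiv.Perm (Fin D.k)) (z : Fin D.k → ℕ → Bool) (T : D.Cell N) :
    ∃ T' : D.Cell N, (∀ p ∈ block T, symFold S m τ z p ∈ block T') ∧
      ∀ p ∈ openBlock T, symFold S m τ z p ∈ openBlock T' := by
  obtain ⟨e, he⟩ := D.d_dvd h
  have hcast : (D.d N : ℝ) = D.d n * e := by rw [he]; push_cast; rfl
  obtain ⟨b, hb, hb'⟩ : ∃ b : ℤ, (∀ p ∈ block T, (b : ℝ) ≤ (symFold S m τ z p).1 * D.d N ∧
      ((symFold S m τ z p).1 : ℝ) * D.d N ≤ b + 1) ∧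
      ∀ p ∈ openBlock T, (b : ℝ) < (symFold S m τ z p).1 * D.d N ∧
      ((symFold S m τ z p).1 : ℝ) * D.d N < b + 1 := by
    have key := fun (p : D.Pre) (hp : p ∈ block T) =>
      symFold_height S m τ z (block_subset_parent h T hp)
    -- With e = d_N / d_n and P the interval index of the parent of T, the index b of the image
    -- interval is (S - P)e + T on an increasing branch and (S + 1 + P)e - T - 1 on a decreasing
    -- one.
    by_cases hE : Even ((((parent h T).1 : ℕ) : ℤ) - m)
    · simp only [hE, if_true] at key
      refine ⟨((S.1 : ℕ) - ((parent h T).1 : ℕ)) * e + (T.1 : ℕ), fun p hp => ?_, fun p hp => ?_⟩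
      · have k := key p hp
        rw [mem_block_iff, hcast] at hp
        rw [hcast, ← mul_assoc, k]
        push_cast
        constructor <;> linarith [hp.1, hp.2.1]
      · have k := key p (openBlock_subset _ hp)
        rw [mem_openBlock_iff, hcast] at hp
        rw [hcast, ← mul_assoc, k]
        push_cast
        constructor <;> linarith [hp.1, hp.2.1]
    · simp only [hE, if_false] at key
      refine ⟨((S.1 : ℕ) + 1 + ((parent h T).1 : ℕ)) * e - (T.1 : ℕ) - 1, fun p hp => ?_,
        fun p hp => ?_⟩
      · have k := key p hp
        rw [mem_block_iff, hcast] at hp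
        rw [hcast, ← mul_assoc, k]
        push_cast
        constructor <;> linarith [hp.1, hp.2.1]
      · have k := key p (openBlock_subset _ hp)
        rw [mem_openBlock_iff, hcast] at hp
        rw [hcast, ← mul_assoc, k]
        push_cast
        constructor <;> linarith [hp.1, hp.2.1]
  -- An interior point of T shows that b is an admissible index: its image has height in [0, 1],
  -- strictly between b / d_N and (b + 1) / d_N.
  obtain ⟨p₀, hp₀⟩ := (ae_par_mem_openBlock T).exists
  have h0 := hb' _ hp₀
  have hI := (symFold S m τ z (par T p₀)).1.2
  have hN := d_pos_real (D := D) N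
  have hb0 : (-1 : ℤ) < b := by
    have : (-1 : ℝ) < b := by linarith [mul_nonneg hI.1 hN.le]
    exact_mod_cast this
  have hb1 : b < D.d N := by
    have : (b : ℝ) < D.d N := h0.1.trans_le (mul_le_of_le_one_left hN.le hI.2)
    exact_mod_cast this
  lift b to ℕ using by omega
  have hdig : ∀ p : D.Pre, (∀ c (l : Fin N), p.2 c l = T.2 c l) → ∀ c (l : Fin N),
      (symFold S m τ z p).2 c l = if hl : (l : ℕ) < n then S.2 c ⟨l, hl⟩
        else xor (z c l) (T.2 (τ c) l) := by
    intro p hp c l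
    by_cases hl : (l : ℕ) < n
    · simp [symFold, overwrite, hl]
    · simp [symFold, overwrite, hl, switchDigits, hp]
  refine ⟨(⟨b, by exact_mod_cast hb1⟩, fun c l => if hl : (l : ℕ) < n then S.2 c ⟨l, hl⟩
        else xor (z c l) (T.2 (τ c) l)), fun p hp => ?_, fun p hp => ?_⟩
  · rw [mem_block_iff]
    exact ⟨by exact_mod_cast (hb p hp).1, by exact_mod_cast (hb p hp).2, hdig p hp.2.2⟩
  · rw [mem_openBlock_iff]
    exact ⟨by exact_mod_cast (hb' p hp).1, by exact_mod_cast (hb' p hp).2, hdig p hp.2.2⟩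

/-- One term of the averaging identity is at most the whole sum. The resulting bounded density makes
composition with foldings continuous on L². -/
lemma map_par_le (S : D.Cell n) : D.preMeasure.map (fun p => D.wormholeMap (par S p)) ≤
    (Fintype.card (D.Cell n) : ℝ≥0) • D.μ := by
  have hm : Measurable fun p => D.wormholeMap (par S p) :=
    D.measurable_wormholeMap.comp (measurable_par S)
  refine Measure.le_iff.2 fun s hs => ?_
  have h := sum_lintegral_cell (D := D) n (F := s.indicator fun _ => 1)
    (measurable_const.indicator hs)
  rw [lintegral_indicator hs, setLIntegral_one] at h
  rw [Measure.smul_apply, ENNReal.smul_def, smul_eq_mul, ENNReal.coe_natCast, ← h,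
    ← setLIntegral_one, ← lintegral_indicator hs,
    lintegral_map (measurable_const.indicator hs) hm]
  exact Finset.single_le_sum (f := fun S : D.Cell n => ∫⁻ p, s.indicator (fun _ => (1 : ℝ≥0∞))
    (D.wormholeMap (par S p)) ∂D.preMeasure) (fun _ _ => zero_le) (Finset.mem_univ S)

lemma quasiMeasurePreserving_par (S : D.Cell n) : Measure.QuasiMeasurePreserving
    (fun p => D.wormholeMap (par S p)) D.preMeasure D.μ :=
  ⟨D.measurable_wormholeMap.comp (measurable_par S),
    (Measure.absolutelyContinuous_of_le (map_par_le S)).trans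
      (Measure.AbsolutelyContinuous.smul_left Measure.AbsolutelyContinuous.rfl _)⟩

/-! ### Slopes and energies under foldings. -/

section Folding

variable {S : D.Cell n} {m : ℤ} {τ : Equiv.Perm (Fin D.k)} {z : Fin D.k → ℕ → Bool}
  {θ : D.Space → D.Space}

lemma continuous_folding (hθ : ∀ p, θ (D.wormholeMap p) = D.wormholeMap (symFold S m τ z p)) :
    Continuous θ := by
  rw [continuous_iff_wormholeMap]
  simp only [hθ]
  exact D.continuous_wormholeMap.comp (continuous_symFold S m τ z)

lemma lintegral_folding (hθ : ∀ p, θ (D.wormholeMap p) = D.wormholeMap (symFold S m τ z p))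
    {F : D.Space → ℝ≥0∞} (hF : Measurable F) :
    ∫⁻ x, F (θ x) ∂D.μ = ∫⁻ p, F (D.wormholeMap (par S p)) ∂D.preMeasure := by
  have hm : Measurable fun x => F (θ x) := hF.comp (continuous_folding hθ).measurable
  rw [μ_eq_map, lintegral_map hm D.measurable_wormholeMap]
  simp only [hθ]
  exact lintegral_symFold S m τ z (F := fun p => F (D.wormholeMap p))
    (hF.comp D.measurable_wormholeMap)

lemma map_folding (hθ : ∀ p, θ (D.wormholeMap p) = D.wormholeMap (symFold S m τ z p)) :
    D.μ.map θ = D.preMeasure.map fun p => D.wormholeMap (par S p) := by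
  have hm : Measurable fun p => D.wormholeMap (par S p) :=
    D.measurable_wormholeMap.comp (measurable_par S)
  refine Measure.ext_of_lintegral _ fun F hF => ?_
  rw [lintegral_map hF (continuous_folding hθ).measurable, lintegral_folding hθ hF,
    lintegral_map hF hm]

lemma quasiMeasurePreserving_folding
    (hθ : ∀ p, θ (D.wormholeMap p) = D.wormholeMap (symFold S m τ z p)) :
    Measure.QuasiMeasurePreserving θ D.μ D.μ :=
  ⟨(continuous_folding hθ).measurable, by
    rw [map_folding hθ]; exact (quasiMeasurePreserving_par S).absolutelyContinuous⟩

/-- The chain rule: on a cell of level at least n a folding acts on heights with slope `foldSign`,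
which is 1 or -1, and maps the cell into a cell of the same level. -/
lemma IsPiecewiseAffine.folding
    (hθ : ∀ p, θ (D.wormholeMap p) = D.wormholeMap (symFold S m τ z p)) {N : ℕ} (h : n ≤ N)
    {f : D.Space → ℝ} {v : D.Cell N → ℝ} (hf : IsPiecewiseAffine f v) :
    ∃ v' : D.Cell N → ℝ, IsPiecewiseAffine (f ∘ θ) v' ∧
      grad v' =ᵐ[D.μ] fun x => grad (foldSign (D := D) (n := n) m) x * grad v (θ x) := by
  choose T' hT' hT'' using exists_symFold_mem_block h S m τ z
  refine ⟨fun T => foldSign m (parent h T) * v (T' T), fun T p hp q hq => ?_, ?_⟩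
  · simp only [Function.comp, hθ]
    rw [hf (T' T) _ (hT' T p hp) _ (hT' T q hq), symFold_height_sub S m τ z
      (block_subset_parent h T hp) (block_subset_parent h T hq)]
    ring
  · refine ae_μ_of_ae_preMeasure (measurableSet_eq_fun (measurable_grad _)
      ((measurable_grad _).mul ((measurable_grad v).comp (continuous_folding hθ).measurable))) ?_
    filter_upwards [ae_exists_mem_openBlock (D := D) n, ae_exists_mem_openBlock (D := D) N]
      with p hp hp'
    obtain ⟨P, hP⟩ := hp
    obtain ⟨T, hT⟩ := hp'
    rw [grad_wormholeMap hT, hθ, grad_wormholeMap (hT'' T p hT), grad_wormholeMap hP,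
      openBlock_unique hP (block_subset_parent h T (openBlock_subset _ hT))]

lemma abs_grad_foldSign_ae (m : ℤ) :
    ∀ᵐ x ∂D.μ, |grad (foldSign (D := D) (n := n) m) x| = 1 := by
  refine ae_μ_of_ae_preMeasure (measurableSet_eq_fun (measurable_grad _).abs measurable_const) ?_
  filter_upwards [ae_exists_mem_openBlock (D := D) n] with p ⟨P, hP⟩
  rw [grad_wormholeMap hP]
  unfold foldSign
  split_ifs <;> simp

lemma abs_grad_foldSign_le (m : ℤ) (x : D.Space) :
    |grad (foldSign (D := D) (n := n) m) x| ≤ 1 := by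
  by_cases hx : ∃ T : D.Cell n, x ∈ openCell T
  · obtain ⟨T, hT⟩ := hx
    rw [grad_of_mem hT]
    unfold foldSign
    split_ifs <;> simp
  · push Not at hx
    unfold grad
    rw [Finset.sum_eq_zero fun T _ => indicator_of_notMem (hx T) _]
    simp

/-- Composition with a folding of a function with slope `V`. -/
theorem folding_mem_slopeGraph
    (hθ : ∀ p, θ (D.wormholeMap p) = D.wormholeMap (symFold S m τ z p)) {f : D.Space → ℝ}
    (hf : MemLp f 2 D.μ) {V : Lp ℝ 2 D.μ} (h : (hf.toLp f, V) ∈ slopeGraph D) :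
    ∃ (hf' : MemLp (f ∘ θ) 2 D.μ) (W : Lp ℝ 2 D.μ), (hf'.toLp (f ∘ θ), W) ∈ slopeGraph D ∧
      ∀ᵐ x ∂D.μ, |W x| = |V (θ x)| := by
  have hm := (continuous_folding hθ).measurable
  have hc : D.μ.map θ ≤ (Fintype.card (D.Cell n) : ℝ≥0) • D.μ := by
    rw [map_folding hθ]
    exact map_par_le S
  have hq := quasiMeasurePreserving_folding hθ
  obtain ⟨C₁, hC₁⟩ := exists_continuousLinearMap_comp hm hc (a := fun _ => 1) measurable_const
    (by simp)
  obtain ⟨C₂, hC₂⟩ := exists_continuousLinearMap_comp hm hc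
    (measurable_grad (foldSign (D := D) (n := n) m)) (abs_grad_foldSign_le m)
  -- Both components of the chain rule are continuous operators on L² and carry piecewise affine
  -- pairs into such pairs, hence preserve the closure.
  have key : (C₁ (hf.toLp f), C₂ V) ∈ closure (slopeGraph D : Set (Lp ℝ 2 D.μ × Lp ℝ 2 D.μ)) := by
    refine map_mem_closure (f := fun q : Lp ℝ 2 D.μ × Lp ℝ 2 D.μ => (C₁ q.1, C₂ q.2))
      (s := (affineGraph D : Set (Lp ℝ 2 D.μ × Lp ℝ 2 D.μ))) (by fun_prop) h ?_
    rintro ⟨u, U⟩ ⟨g, ⟨M, v, hg, hU⟩, hu⟩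
    obtain ⟨v', hv', hv''⟩ := (hg.refine (le_max_right n M)).folding hθ (le_max_left n M)
    refine affineGraph_le ⟨g ∘ θ, ⟨_, v', hv', ?_⟩, ?_⟩
    · filter_upwards [hC₂ U, hv'', hq.ae hU, hq.ae (grad_parent_ae (le_max_right n M) v)]
        with x h1 h2 h3 h4
      rw [h1, h2, h3, h4]
    · filter_upwards [hC₁ u, hq.ae hu] with x h1 h2
      rw [h1, h2, one_mul]
      rfl
  rw [isClosed_slopeGraph.closure_eq] at key
  have hC : C₁ (hf.toLp f) =ᵐ[D.μ] f ∘ θ := by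
    filter_upwards [hC₁ (hf.toLp f), hq.ae hf.coeFn_toLp] with x h1 h2
    rw [h1, h2, one_mul]
    rfl
  have hf' : MemLp (f ∘ θ) 2 D.μ := (memLp_congr_ae hC).1 (Lp.memLp _)
  refine ⟨hf', C₂ V, ?_, ?_⟩
  · have : hf'.toLp (f ∘ θ) = C₁ (hf.toLp f) := by
      ext1
      exact hf'.coeFn_toLp.trans hC.symm
    rw [this]
    exact key
  · filter_upwards [hC₂ V, abs_grad_foldSign_ae (D := D) (n := n) m] with x h1 h2
    rw [h1, abs_mul, h2, one_mul]

/-- The new slope has modulus |V ∘ θ|, and θ spreads μ uniformly over the cell. The energy therefore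
depends on the cell alone and not on `m`, `τ`, `z`, which is the source of the isometry invariance.
-/
lemma energy_folding (hθ : ∀ p, θ (D.wormholeMap p) = D.wormholeMap (symFold S m τ z p))
    {f : D.Space → ℝ} (hf : MemLp f 2 D.μ) {V : Lp ℝ 2 D.μ} (h : (hf.toLp f, V) ∈ slopeGraph D) :
    (slopeForm D).Mem (f ∘ θ) ∧ ENNReal.ofReal ((slopeForm D).energy (f ∘ θ)) =
      ∫⁻ p, ENNReal.ofReal |V (D.wormholeMap (par S p))| ^ 2 ∂D.preMeasure := by
  obtain ⟨hf', W, hW, hWV⟩ := folding_mem_slopeGraph hθ hf h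
  obtain ⟨h1, h2⟩ := energy_slopeForm hf' hW
  refine ⟨h1, ?_⟩
  rw [h2, ← lintegral_sq_eq, ← lintegral_folding hθ
    (F := fun x => ENNReal.ofReal |V x| ^ 2) ((measurable_ofReal_abs V).pow_const 2)]
  refine lintegral_congr_ae ?_
  filter_upwards [hWV] with x hx
  rw [hx]

end Folding

lemma energy_nonneg (E : DirichletForm D.μ) (f : D.Space → ℝ) : 0 ≤ E.energy f := by
  unfold DirichletForm.energy
  split_ifs with h
  · exact E.nonneg _
  · exact le_rfl

lemma foldPre_eq_symFold (S : D.Cell n) (p : D.Pre) :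
    foldPre S p = symFold S (S.1 : ℕ) 1 (fun _ _ => false) p := by
  have hd := d_pos_real (D := D) n
  refine Prod.ext (Subtype.ext ?_) ?_
  · simp only [foldPre, foldReal, symFold]
    have : (D.d n : ℝ) * (p.1 - (S.1 : ℕ) / D.d n) = D.d n * p.1 - ((S.1 : ℕ) : ℤ) := by
      field_simp; push_cast; ring
    rw [this, add_div]
  · funext c l
    simp [foldPre, symFold, overwrite, switchDigits]

lemma fold_wormholeMap (S : D.Cell n) (p : D.Pre) :
    (fold S (D.wormholeMap p) : D.Space) =
      D.wormholeMap (symFold S (S.1 : ℕ) 1 (fun _ _ => false) p) := by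
  rw [← foldPre_eq_symFold]
  rfl

/-- The folding map is the identity on the cell. -/
lemma fold_of_mem_block {S : D.Cell n} {p : D.Pre} (hp : p ∈ block S) :
    (fold S (D.wormholeMap p) : D.Space) = D.wormholeMap p := by
  rw [fold_wormholeMap]
  congr 1
  have h := symFold_height S (S.1 : ℕ) 1 (fun _ _ => false) hp
  simp only [sub_self, Even.zero, if_true, add_sub_cancel] at h
  refine Prod.ext (Subtype.ext (mul_right_cancel₀ (d_pos_real (D := D) n).ne' h)) ?_
  funext c l
  by_cases hl : l < n
  · simp [symFold, overwrite, hl, ← hp.2.2 c ⟨l, hl⟩]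
  · simp [symFold, overwrite, hl, switchDigits]

theorem memCell_restr (S : D.Cell n) {f : D.Space → ℝ} (hf : (slopeForm D).Mem f) :
    MemCell (slopeForm D) S (restr S f) := by
  obtain ⟨hf, V, h⟩ := Mem.exists_slope hf
  exact (energy_folding (θ := fun x => (fold S x : D.Space)) (fold_wormholeMap S) hf h).1

/-- The energy of each unfolding is the mean of |V|² over the cell, and the means over all cells
average to the integral over L. -/
theorem energy_eq_sum (n : ℕ) {f : D.Space → ℝ} (hf : (slopeForm D).Mem f) :
    (slopeForm D).energy f = ∑ S : D.Cell n, energyCell (slopeForm D) S (restr S f) := by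
  obtain ⟨hf, V, h⟩ := Mem.exists_slope hf
  have hcard : (0 : ℝ) < Fintype.card (D.Cell n) := by exact_mod_cast card_cell_pos n
  simp only [energyCell]
  rw [← Finset.mul_sum, one_div, eq_inv_mul_iff_mul_eq₀ hcard.ne',
    ← ENNReal.ofReal_eq_ofReal_iff (mul_nonneg hcard.le (energy_nonneg _ _))
      (Finset.sum_nonneg fun _ _ => energy_nonneg _ _),
    ENNReal.ofReal_sum_of_nonneg fun _ _ => energy_nonneg _ _,
    ENNReal.ofReal_mul hcard.le, (energy_slopeForm hf h).2, ← lintegral_sq_eq,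
    ENNReal.ofReal_natCast, ← sum_lintegral_cell n ((measurable_ofReal_abs V).pow_const 2)]
  exact Finset.sum_congr rfl fun S _ => ((energy_folding (θ := fun x => (fold S x : D.Space))
    (fold_wormholeMap S) hf h).2).symm

end LaaksoData

/-! ### Locality -/

namespace LaaksoData

variable {D : LaaksoData} {n : ℕ}

/-- The blocks form a neighbourhood basis. -/
lemma exists_block_subset {p : D.Pre} {O : Set D.Pre} (hO : O ∈ 𝓝 p) :
    ∃ (n : ℕ) (S : D.Cell n), p ∈ block S ∧ block S ⊆ O := by
  obtain ⟨O', hO', hopen, hp⟩ := mem_nhds_iff.1 hO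
  -- A continuous function separating p from the complement of the neighbourhood oscillates by at
  -- most 1/2 on small blocks.
  obtain ⟨ψ, hψ0, hψ1, -⟩ := exists_continuous_zero_one_of_isClosed (isClosed_singleton (x := p))
    hopen.isClosed_compl (disjoint_singleton_left.2 fun h => h hp)
  obtain ⟨N, hN⟩ := exists_forall_block_abs_sub_le ψ.continuous (ε := 1 / 2) (by norm_num)
  obtain ⟨S, hS⟩ := exists_mem_block N p
  refine ⟨N, S, hS, fun q hq => hO' ?_⟩
  by_contra hqO
  have h := hN N le_rfl S p hS q hq
  have h0 : ψ p = 0 := hψ0 rfl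
  have h1 : ψ q = 1 := hψ1 hqO
  rw [h0, h1] at h
  norm_num at h

lemma isClosed_aeSupport (f : D.Space → ℝ) : IsClosed (DirichletForm.aeSupport D.μ f) := by
  rw [← isOpen_compl_iff, isOpen_iff_mem_nhds]
  intro x hx
  have hx' : ∃ U ∈ 𝓝 x, ∀ᵐ y ∂D.μ, y ∈ U → f y = 0 := by
    simpa [DirichletForm.aeSupport] using hx
  obtain ⟨U, hU, h⟩ := hx'
  obtain ⟨O, hOU, hO, hxO⟩ := mem_nhds_iff.1 hU
  refine mem_of_superset (hO.mem_nhds hxO) fun y hy hy' => hy' O (hO.mem_nhds hy) ?_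
  filter_upwards [h] with a ha using fun haO => ha (hOU haO)

/-- The slope of a function vanishes where the function vanishes. -/
lemma slope_eq_zero_on_block {u V : Lp ℝ 2 D.μ} (h : (u, V) ∈ slopeGraph D) (S : D.Cell n)
    (hu : ∀ᵐ x ∂D.μ, x ∈ carrier S → u x = 0) :
    ∀ᵐ p ∂D.preMeasure, p ∈ block S → V (D.wormholeMap p) = 0 := by
  -- Unfolding u from the cell gives 0, so the slope of the unfolding is 0. Its modulus is that of V
  -- composed with the fold, and the fold is the identity on the cell.
  have hθ := fold_wormholeMap S
  have hq := quasiMeasurePreserving_folding (θ := fun x => (fold S x : D.Space)) hθ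
  have hmem : ((Lp.memLp u).toLp u, V) ∈ slopeGraph D := by rwa [Lp.toLp_coeFn]
  obtain ⟨hf', W, hW, hWV⟩ :=
    folding_mem_slopeGraph (θ := fun x => (fold S x : D.Space)) hθ (Lp.memLp u) hmem
  have h0 : hf'.toLp _ = 0 := by
    rw [Lp.eq_zero_iff_ae_eq_zero]
    filter_upwards [hf'.coeFn_toLp, hq.ae hu] with x h1 h2
    rw [h1]
    exact h2 (fold S x).2
  have hW0 : W = 0 := slopeGraph_eq_zero (h0 ▸ hW)
  have hV : ∀ᵐ x ∂D.μ, V (fold S x : D.Space) = 0 := by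
    filter_upwards [hWV, (Lp.eq_zero_iff_ae_eq_zero).1 hW0] with x h1 h2
    rw [h2, Pi.zero_apply, abs_zero] at h1
    exact abs_eq_zero.1 h1.symm
  filter_upwards [ae_preMeasure_of_ae_μ hV] with p hp hpS
  rwa [fold_of_mem_block hpS] at hp

lemma slope_eq_zero_of_notMem_aeSupport {u V : Lp ℝ 2 D.μ} (h : (u, V) ∈ slopeGraph D) :
    ∀ᵐ x ∂D.μ, x ∉ DirichletForm.aeSupport D.μ u → V x = 0 := by
  refine ae_μ_of_ae_preMeasure ?_ ?_
  · have e : {x | x ∉ DirichletForm.aeSupport D.μ u → V x = 0} =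
        DirichletForm.aeSupport D.μ u ∪ {x | V x = 0} := by
      ext x
      simp only [mem_ofPred_eq, mem_union]
      tauto
    rw [e]
    exact (isClosed_aeSupport _).measurableSet.union
      (measurableSet_eq_fun (Lp.stronglyMeasurable V).measurable measurable_const)
  -- There are countably many cells, so one null set serves for all of them.
  · have key : ∀ᵐ p ∂D.preMeasure, ∀ (n : ℕ) (S : D.Cell n),
        (∀ᵐ x ∂D.μ, x ∈ carrier S → u x = 0) → p ∈ block S → V (D.wormholeMap p) = 0 := by
      refine ae_all_iff.2 fun n => ae_all_iff.2 fun S => ?_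
      by_cases hS : ∀ᵐ x ∂D.μ, x ∈ carrier S → u x = 0
      · filter_upwards [slope_eq_zero_on_block h S hS] with p hp _ using hp
      · exact Eventually.of_forall fun p h => absurd h hS
    filter_upwards [key] with p hp hpu
    have hx' : ∃ U ∈ 𝓝 (D.wormholeMap p), ∀ᵐ y ∂D.μ, y ∈ U → u y = 0 := by
      simpa [DirichletForm.aeSupport] using hpu
    obtain ⟨U, hU, hUu⟩ := hx'
    obtain ⟨n, S, hpS, hSU⟩ := exists_block_subset
      (D.continuous_wormholeMap.continuousAt.preimage_mem_nhds hU)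
    refine hp n S ?_ hpS
    filter_upwards [hUu] with x hx
    rintro ⟨q, hq, rfl⟩
    exact hx (hSU hq)

theorem isLocal_slopeForm : (slopeForm D).IsLocal := by
  intro u v _ _ hdisj
  have hu := slope_mem_slopeGraph u
  have hv := slope_mem_slopeGraph v
  rw [slopeForm_apply hu hv u.2 v.2, L2.inner_def]
  refine integral_eq_zero_of_ae ?_
  filter_upwards [slope_eq_zero_of_notMem_aeSupport hu, slope_eq_zero_of_notMem_aeSupport hv]
    with x h1 h2
  by_cases hx : x ∈ DirichletForm.aeSupport D.μ (u : Lp ℝ 2 D.μ)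
  · have : slope D v x = 0 := h2 (disjoint_left.1 hdisj hx)
    simp [this]
  · have : slope D u x = 0 := h1 hx
    simp [this]

end LaaksoData

/-! ### Distance preserving maps between boxes -/

section Boxes

variable {ι α : Type*} [Fintype ι]

/-- Points at the distance of opposite corners of a box are corners. -/
lemma eq_zero_or_eq_of_sum_sq_sub_eq {side x y : ι → ℝ} (hx : ∀ i, 0 ≤ x i ∧ x i ≤ side i)
    (hy : ∀ i, 0 ≤ y i ∧ y i ≤ side i) (h : ∑ i, (x i - y i) ^ 2 = ∑ i, side i ^ 2) (i : ι) :
    x i = 0 ∨ x i = side i := by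
  have hle : ∀ i, (x i - y i) ^ 2 ≤ side i ^ 2 := fun i =>
    sq_le_sq' (by linarith [(hx i).1, (hy i).2]) (by linarith [(hx i).2, (hy i).1])
  have hi := (Finset.sum_eq_sum_iff_of_le fun i _ => hle i).1 h i (Finset.mem_univ i)
  rcases sq_eq_sq_iff_eq_or_eq_neg.1 hi with h1 | h1
  · right; linarith [(hx i).2, (hy i).1]
  · left; linarith [(hx i).1, (hy i).2]

/-- Distance preserving maps from a subset of a box that contains the corners into a box of the same
size, mapping a corner to the corner `0`, permute the coordinates. -/
lemma exists_perm_of_sum_mul_eq {side : ι → ℝ} (hside : ∀ i, 0 < side i) {u v : α → ι → ℝ}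
    (h : ∀ p q, ∑ i, v p i * v q i = ∑ i, u p i * u q i)
    (hv : ∀ p i, 0 ≤ v p i)
    (hcorner : ∀ i, ∃ p, (∀ j, u p j = open Classical in if j = i then side i else 0) ∧
      ∀ j, v p j = 0 ∨ v p j = side j) :
    ∃ π : Equiv.Perm ι, ∀ i, side (π i) = side i ∧ ∀ p, v p (π i) = u p i := by
  classical
  choose e he hev using hcorner
  have hinner : ∀ i p, ∑ j, v p j * v (e i) j = u p i * side i := by
    intro i p
    rw [h, Finset.sum_eq_single i]
    · rw [he, if_pos rfl]
    · intro j _ hj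
      rw [he, if_neg hj, mul_zero]
    · simp
  -- The images of the corners on the axes are nonzero corners, with disjoint supports by
  -- orthogonality and nonnegativity. There are as many of them as coordinates, so the supports are
  -- single coordinates, which defines the permutation.
  have hex : ∀ i, ∃ l, v (e i) l = side l := by
    intro i
    by_contra! hcon
    have h0 : ∀ l, v (e i) l = 0 := fun l => (hev i l).resolve_right (hcon l)
    have h1 := hinner i (e i)
    rw [he, if_pos rfl, Finset.sum_eq_zero fun j _ => by rw [h0, mul_zero]] at h1
    exact (mul_pos (hside i) (hside i)).ne h1
  choose π hπ using hex
  have hdisj : ∀ i j, i ≠ j → ∀ l, v (e i) l * v (e j) l = 0 := by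
    intro i j hij l
    have h1 := hinner j (e i)
    rw [he, if_neg hij.symm, zero_mul] at h1
    exact (Finset.sum_eq_zero_iff_of_nonneg fun l _ => mul_nonneg (hv _ _) (hv _ _)).1 h1 l
      (Finset.mem_univ l)
  have hinj : Function.Injective π := by
    intro i j hij
    by_contra hne
    have h1 := hdisj i j hne (π i)
    rw [hπ i] at h1
    rw [hij, hπ j] at h1
    exact (mul_pos (hside _) (hside _)).ne' h1
  have hbij : Function.Bijective π := Finite.injective_iff_bijective.1 hinj
  have hzero : ∀ i l, l ≠ π i → v (e i) l = 0 := by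
    intro i l hl
    obtain ⟨j, rfl⟩ := hbij.2 l
    have h1 := hdisj i j (fun hij => hl (by rw [hij])) (π j)
    rw [hπ j] at h1
    exact (mul_eq_zero.1 h1).resolve_right (hside _).ne'
  have hsum : ∀ i p, v p (π i) * side (π i) = u p i * side i := by
    intro i p
    rw [← hinner i p, Finset.sum_eq_single (π i), hπ i]
    · intro j _ hj
      rw [hzero i j hj, mul_zero]
    · simp
  have hs : ∀ i, side (π i) = side i := by
    intro i
    have h1 := hsum i (e i)
    rw [hπ i, he, if_pos rfl] at h1
    exact (mul_self_inj (hside _).le (hside _).le).1 h1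
  refine ⟨Equiv.ofBijective π hbij, fun i => ⟨hs i, fun p => ?_⟩⟩
  have h1 := hsum i p
  rw [hs i] at h1
  exact mul_right_cancel₀ (hside i).ne' h1

/-- Distance preserving maps from a subset of a box that contains the corners into a box of the same
size permute and reflect the coordinates. -/
theorem exists_perm_of_sum_sq_sub_eq {side : ι → ℝ} (hside : ∀ i, 0 < side i) {u v : α → ι → ℝ}
    (h : ∀ p q, ∑ i, (v p i - v q i) ^ 2 = ∑ i, (u p i - u q i) ^ 2)
    (hv : ∀ p i, 0 ≤ v p i ∧ v p i ≤ side i)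
    (hcorner : ∀ J : ι → Bool, ∃ p, ∀ i, u p i = if J i then side i else 0) :
    ∃ (π : Equiv.Perm ι) (ε : ι → Bool), ∀ i, side (π i) = side i ∧
      ∀ p, v p (π i) = if ε i then side i - u p i else u p i := by
  classical
  -- The opposite corner is at the largest distance the box allows, so both images must be corners.
  have hc : ∀ (J : ι → Bool) p, (∀ i, u p i = if J i then side i else 0) →
      ∀ i, v p i = 0 ∨ v p i = side i := by
    intro J p hp
    obtain ⟨q, hq⟩ := hcorner fun i => !J i
    refine eq_zero_or_eq_of_sum_sq_sub_eq (hv p) (hv q) ?_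
    rw [h]
    refine Finset.sum_congr rfl fun i _ => ?_
    rw [hp, hq]
    cases J i <;> simp
  obtain ⟨o, ho⟩ := hcorner fun _ => false
  have ho' : ∀ i, u o i = 0 := fun i => by simpa using ho i
  have hvo := hc _ o ho
  -- Reflecting the target box moves the image of the corner 0 back to 0.
  let ε : ι → Bool := fun i => decide (v o i = side i)
  let v' : α → ι → ℝ := fun p i => if ε i then side i - v p i else v p i
  have hv'o : ∀ i, v' o i = 0 := by
    intro i
    by_cases hi : v o i = side i
    · simp [v', ε, hi]
    · simp only [v', ε, hi, decide_false, Bool.false_eq_true, if_false]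
      exact (hvo i).resolve_right hi
  have hv'sub : ∀ p q i, (v' p i - v' q i) ^ 2 = (v p i - v q i) ^ 2 := by
    intro p q i
    simp only [v']
    split_ifs <;> ring
  have h' : ∀ p q, ∑ i, (v' p i - v' q i) ^ 2 = ∑ i, (u p i - u q i) ^ 2 := by
    intro p q
    rw [← h]
    exact Finset.sum_congr rfl fun i _ => hv'sub p q i
  -- Polarization: distances to a common point at 0 determine the inner products.
  have hpol : ∀ (w : α → ι → ℝ), (∀ i, w o i = 0) → ∀ p q, ∑ i, w p i * w q i =
      (∑ i, (w p i - w o i) ^ 2 + ∑ i, (w q i - w o i) ^ 2 - ∑ i, (w p i - w q i) ^ 2) / 2 := by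
    intro w hw p q
    rw [← Finset.sum_add_distrib, ← Finset.sum_sub_distrib, Finset.sum_div]
    refine Finset.sum_congr rfl fun i _ => ?_
    rw [hw]
    ring
  obtain ⟨π, hπ⟩ := exists_perm_of_sum_mul_eq hside (u := u) (v := v')
    (fun p q => by rw [hpol v' hv'o, hpol u ho', h', h', h'])
    (fun p i => by
      simp only [v']
      split_ifs
      · linarith [(hv p i).2]
      · exact (hv p i).1)
    (fun i => by
      obtain ⟨p, hp⟩ := hcorner fun j => decide (j = i)
      refine ⟨p, fun j => ?_, fun j => ?_⟩
      · rw [hp]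
        by_cases hj : j = i
        · subst hj; simp
        · simp [hj]
      · have := hc _ p hp j
        simp only [v']
        split_ifs
        · rcases this with h1 | h1
          · right; linarith
          · left; linarith
        · exact this)
  refine ⟨π, fun i => ε (π i), fun i => ⟨(hπ i).1, fun p => ?_⟩⟩
  have h1 := (hπ i).2 p
  simp only [v'] at h1
  split_ifs at h1 ⊢
  · rw [← (hπ i).1]; linarith
  · exact h1

end Boxes

/-! ### The Cantor set -/

namespace LaaksoData

variable {D : LaaksoData} {n : ℕ}

/-- The length of the pieces of level `n` of the Cantor set. -/
noncomputable def pieceLength (D : LaaksoData) (n : ℕ) : ℝ := ∏ l ∈ Finset.range n, D.r l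

lemma pieceLength_pos (n : ℕ) : 0 < pieceLength D n := Finset.prod_pos fun i _ => D.r_pos i

lemma pieceLength_succ (n : ℕ) : pieceLength D (n + 1) = pieceLength D n * D.r n :=
  Finset.prod_range_succ _ _

lemma two_mul_pieceLength_succ_lt (n : ℕ) : 2 * pieceLength D (n + 1) < pieceLength D n := by
  rw [pieceLength_succ]
  nlinarith [pieceLength_pos (D := D) n, D.r_lt n]

lemma tendsto_pieceLength : Tendsto (pieceLength D) atTop (𝓝 0) := by
  refine squeeze_zero (fun n => (pieceLength_pos n).le) (g := fun n => (1 / 2 : ℝ) ^ n) (fun n => ?_)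
    (tendsto_pow_atTop_nhds_zero_of_lt_one (by norm_num) (by norm_num))
  induction n with
  | zero => simp [pieceLength]
  | succ n ih =>
    have := two_mul_pieceLength_succ_lt (D := D) n
    rw [pow_succ]
    linarith

/-- The distance from the point with digits `w` to the left end of its piece of level `n`. -/
noncomputable def cantorTail (D : LaaksoData) (n : ℕ) (w : ℕ → Bool) : ℝ :=
  ∑' i, if w (i + n) then pieceLength D (i + n) - pieceLength D (i + n + 1) else 0

lemma pieceLength_sub_pos (n : ℕ) : 0 < pieceLength D n - pieceLength D (n + 1) := by
  linarith [two_mul_pieceLength_succ_lt (D := D) n, pieceLength_pos (D := D) (n + 1)]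

lemma hasSum_pieceLength_sub (n : ℕ) :
    HasSum (fun i => pieceLength D (i + n) - pieceLength D (i + n + 1)) (pieceLength D n) := by
  rw [hasSum_iff_tendsto_nat_of_nonneg fun i => (pieceLength_sub_pos _).le]
  have h : ∀ m, ∑ i ∈ Finset.range m, (pieceLength D (i + n) - pieceLength D (i + n + 1)) =
      pieceLength D n - pieceLength D (m + n) := by
    intro m
    have := Finset.sum_range_sub' (fun i => pieceLength D (i + n)) m
    simp only [zero_add] at this
    rw [← this]
    exact Finset.sum_congr rfl fun i _ => by rw [add_right_comm]
  simp only [h]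
  simpa using ((tendsto_add_atTop_iff_nat n).2 (tendsto_pieceLength (D := D))).const_sub
    (pieceLength D n)

lemma summable_cantorTail (n : ℕ) (w : ℕ → Bool) : Summable fun i =>
    if w (i + n) then pieceLength D (i + n) - pieceLength D (i + n + 1) else 0 := by
  refine Summable.of_nonneg_of_le (fun i => ?_) (fun i => ?_)
    (hasSum_pieceLength_sub (D := D) n).summable
  · split_ifs
    exacts [(pieceLength_sub_pos _).le, le_rfl]
  · split_ifs
    exacts [le_rfl, (pieceLength_sub_pos _).le]

lemma cantorPoint_eq (w : ℕ → Bool) : D.cantorPoint w = cantorTail D 0 w := by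
  unfold cantorPoint cantorTail
  refine tsum_congr fun i => ?_
  rw [add_zero, pieceLength_succ]
  unfold pieceLength
  split_ifs <;> ring

lemma cantorTail_succ (n : ℕ) (w : ℕ → Bool) : cantorTail D n w =
    (if w n then pieceLength D n - pieceLength D (n + 1) else 0) + cantorTail D (n + 1) w := by
  unfold cantorTail
  rw [(summable_cantorTail n w).tsum_eq_zero_add]
  simp only [zero_add]
  congr 2
  funext i
  rw [show i + 1 + n = i + (n + 1) by ring]

/-- Each level contributes to exactly one of the two sums, and the contributions telescope. So
switching all digits from n on is the reflection of a piece. -/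
lemma cantorTail_add_not (n : ℕ) (w : ℕ → Bool) :
    cantorTail D n w + cantorTail D n (fun l => !w l) = pieceLength D n := by
  unfold cantorTail
  rw [← (summable_cantorTail n w).tsum_add (summable_cantorTail n fun l => !w l),
    ← (hasSum_pieceLength_sub (D := D) n).tsum_eq]
  refine tsum_congr fun i => ?_
  cases w (i + n) <;> simp

lemma cantorTail_nonneg (n : ℕ) (w : ℕ → Bool) : 0 ≤ cantorTail D n w :=
  tsum_nonneg fun i => by
    split_ifs
    exacts [(pieceLength_sub_pos _).le, le_rfl]

lemma cantorTail_le (n : ℕ) (w : ℕ → Bool) : cantorTail D n w ≤ pieceLength D n := by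
  linarith [cantorTail_add_not (D := D) n w, cantorTail_nonneg (D := D) n fun l => !w l]

lemma cantorTail_const {w : ℕ → Bool} {b : Bool} (h : ∀ l ≥ n, w l = b) :
    cantorTail D n w = if b then pieceLength D n else 0 := by
  have h0 : ∀ w : ℕ → Bool, (∀ l ≥ n, w l = false) → cantorTail D n w = 0 := by
    intro w hw
    unfold cantorTail
    simp [hw]
  cases b
  · simpa using h0 w h
  · have h1 := cantorTail_add_not (D := D) n w
    rw [h0 (fun l => !w l) fun l hl => by simp [h l hl], add_zero] at h1
    simpa using h1

/-- The gap in the middle of a piece of the Cantor set. -/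
lemma cantorTail_gap (n : ℕ) (w : ℕ → Bool) :
    if w n then pieceLength D n < 2 * cantorTail D n w
      else 2 * cantorTail D n w < pieceLength D n := by
  have h1 := cantorTail_succ (D := D) n w
  have h2 := two_mul_pieceLength_succ_lt (D := D) n
  have h3 := cantorTail_nonneg (D := D) (n + 1) w
  have h4 := cantorTail_le (D := D) (n + 1) w
  split_ifs with h
  · rw [if_pos h] at h1; linarith
  · rw [if_neg h] at h1; linarith

/-- The midpoint of a Cantor piece lies in its gap, unlike the midpoint of an interval; this
distinguishes the height axis from the Cantor axes. -/
lemma two_mul_cantorTail_ne (n : ℕ) (w : ℕ → Bool) : 2 * cantorTail D n w ≠ pieceLength D n := by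
  have := cantorTail_gap (D := D) n w
  split_ifs at this
  exacts [this.ne', this.ne]

/-- The side of the gap reveals the leading digit; removing it, the argument repeats one level
deeper. -/
lemma eq_of_cantorTail_eq {w w' : ℕ → Bool} (h : cantorTail D n w = cantorTail D n w') :
    ∀ l ≥ n, w l = w' l := by
  have step : ∀ l, cantorTail D l w = cantorTail D l w' →
      w l = w' l ∧ cantorTail D (l + 1) w = cantorTail D (l + 1) w' := by
    intro l hl
    have h1 := cantorTail_gap (D := D) l w
    have h2 := cantorTail_gap (D := D) l w'
    have h3 := cantorTail_succ (D := D) l w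
    have h4 := cantorTail_succ (D := D) l w'
    cases h5 : w l <;> cases h6 : w' l <;>
      simp only [h5, h6, if_true, if_false, Bool.false_eq_true] at h1 h2 h3 h4
    · exact ⟨rfl, by linarith⟩
    · linarith
    · linarith
    · exact ⟨rfl, by linarith⟩
  have all : ∀ l ≥ n, cantorTail D l w = cantorTail D l w' := by
    intro l hl
    induction l, hl using Nat.le_induction with
    | base => exact h
    | succ l _ ih => exact (step l ih).2
  exact fun l hl => (step l (all l hl)).1

lemma cantorPoint_sub (n : ℕ) {w w' : ℕ → Bool} (h : ∀ l < n, w l = w' l) :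
    D.cantorPoint w - D.cantorPoint w' = cantorTail D n w - cantorTail D n w' := by
  rw [cantorPoint_eq, cantorPoint_eq]
  induction n with
  | zero => rfl
  | succ n ih =>
    rw [ih fun l hl => h l (by omega), cantorTail_succ n w, cantorTail_succ n w', h n (by omega)]
    ring

/-! ### Symmetries of cells -/

/-- The coordinates of a point of a block, measured from the lower corner of the block. -/
noncomputable def coords (S : D.Cell n) (p : D.Pre) : Fin (D.k + 1) → ℝ :=
  Fin.cons ((p.1 : ℝ) - (S.1 : ℕ) / D.d n) fun c => cantorTail D n (p.2 c)

/-- The side lengths of the box spanned by a block of level `n`. -/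
noncomputable def sides (D : LaaksoData) (n : ℕ) : Fin (D.k + 1) → ℝ :=
  Fin.cons (1 / D.d n) fun _ => pieceLength D n

lemma sides_pos (i : Fin (D.k + 1)) : 0 < sides D n i := by
  refine Fin.cases ?_ (fun c => ?_) i
  · exact one_div_pos.2 (d_pos_real n)
  · exact pieceLength_pos n

lemma coords_mem {S : D.Cell n} {p : D.Pre} (hp : p ∈ block S) (i : Fin (D.k + 1)) :
    0 ≤ coords S p i ∧ coords S p i ≤ sides D n i := by
  refine Fin.cases ?_ (fun c => ?_) i
  · have h := hp.2.1
    rw [add_div] at h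
    exact ⟨sub_nonneg.2 hp.1, by simp only [coords, sides, Fin.cons_zero]; linarith⟩
  · exact ⟨cantorTail_nonneg _ _, cantorTail_le _ _⟩

lemma dist_embed_sq {S : D.Cell n} {p q : D.Pre} (hp : p ∈ block S) (hq : q ∈ block S) :
    dist (D.embed p) (D.embed q) ^ 2 = ∑ i, (coords S p i - coords S q i) ^ 2 := by
  rw [EuclideanSpace.dist_eq, Real.sq_sqrt (Finset.sum_nonneg fun _ _ => sq_nonneg _)]
  refine Finset.sum_congr rfl fun i _ => ?_
  rw [Real.dist_eq, sq_abs]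
  congr 1
  refine Fin.cases ?_ (fun c => ?_) i
  · simp [embed, coords]
  · simp only [embed, coords, Fin.cons_succ]
    exact cantorPoint_sub n fun l hl => (hp.2.2 c ⟨l, hl⟩).trans (hq.2.2 c ⟨l, hl⟩).symm

lemma triangle_add_one (t : ℝ) : triangle (t + 1) = 1 - triangle t := by
  have h0 := Int.fract_nonneg t
  have h1 := (Int.fract_lt_one t).le
  have e : t = (⌊t⌋ : ℤ) + Int.fract t := (Int.floor_add_fract t).symm
  have e' : t + 1 = ((⌊t⌋ + 1 : ℤ) : ℝ) + Int.fract t := by push_cast; linarith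
  by_cases hz : Even ⌊t⌋
  · have hz' : ¬ Even (⌊t⌋ + 1) := by rw [Int.even_add_one]; exact not_not.2 hz
    rw [e', triangle_odd_add hz' h0 h1]
    conv_rhs => rw [e, triangle_even_add hz h0 h1]
  · have hz' : Even (⌊t⌋ + 1) := Int.even_add_one.2 hz
    rw [e', triangle_even_add hz' h0 h1]
    conv_rhs => rw [e, triangle_odd_add hz h0 h1]
    ring

lemma coords_foldPre_zero (S : D.Cell n) (p : D.Pre) :
    coords S (foldPre S p) 0 = triangle (D.d n * p.1 - (S.1 : ℕ)) / D.d n := by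
  have hd := (d_pos_real (D := D) n).ne'
  simp only [coords, foldPre, foldReal, Fin.cons_zero, add_sub_cancel_left]
  congr 2
  field_simp

lemma coords_foldPre_succ (S : D.Cell n) (p : D.Pre) (c : Fin D.k) :
    coords S (foldPre S p) c.succ = cantorTail D n (p.2 c) := by
  simp only [coords, Fin.cons_succ]
  unfold cantorTail
  refine tsum_congr fun i => ?_
  simp [foldPre]

lemma exists_coords_foldPre_zero (S : D.Cell n) {t : ℝ} (h0 : 0 ≤ t) (h1 : t ≤ 1)
    (w : Fin D.k → ℕ → Bool) :
    ∃ p : D.Pre, p.2 = w ∧ coords S (foldPre S p) 0 = t / D.d n := by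
  have hd := d_pos_real (D := D) n
  have hS : ((S.1 : ℕ) : ℝ) + 1 ≤ D.d n := by exact_mod_cast S.1.2
  refine ⟨(⟨((S.1 : ℕ) + t) / D.d n, by positivity, ?_⟩, w), rfl, ?_⟩
  · rw [div_le_one hd]; linarith
  · rw [coords_foldPre_zero]
    congr 1
    simp only
    rw [mul_div_cancel₀ _ hd.ne', add_sub_cancel_left]
    have := triangle_even_add (z := 0) (by simp) h0 h1
    simpa using this

/-- The maps between cells induced by isometries are foldings, when composed with the folding map:
isometries of blocks preserve the interval and permute and reflect the Cantor sets. -/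
theorem IsInducedBy.exists_symFold {S₁ S₂ : D.Cell n}
    {Φ : EuclideanSpace ℝ (Fin (D.k + 1)) → EuclideanSpace ℝ (Fin (D.k + 1))}
    {Ψ : carrier S₁ → carrier S₂} (h : IsInducedBy S₁ S₂ Φ Ψ) (hΦ : Isometry Φ) :
    ∃ (m : ℤ) (τ : Equiv.Perm (Fin D.k)) (z : Fin D.k → ℕ → Bool), ∀ p,
      (Ψ (fold S₁ (D.wormholeMap p)) : D.Space) = D.wormholeMap (symFold S₂ m τ z p) := by
  have hd := d_pos_real (D := D) n
  -- q p is a point of the second block whose embedding is the image under Φ of the folded point p.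
  choose q hq hqe hqΨ using fun p : D.Pre => h (foldPre S₁ p) (foldPre_mem S₁ p)
  obtain ⟨π, ε, hπ⟩ := exists_perm_of_sum_sq_sub_eq (side := sides D n) sides_pos
    (u := fun p => coords S₁ (foldPre S₁ p)) (v := fun p => coords S₂ (q p))
    (fun p p' => by
      rw [← dist_embed_sq (hq p) (hq p'), hqe, hqe, hΦ.dist_eq,
        dist_embed_sq (foldPre_mem S₁ p) (foldPre_mem S₁ p')])
    (fun p => coords_mem (hq p))
    (fun J => by
      obtain ⟨p, hp2, hp0⟩ := exists_coords_foldPre_zero S₁ (t := if J 0 then 1 else 0)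
        (by split_ifs <;> norm_num) (by split_ifs <;> norm_num) (fun c _ => J c.succ)
      refine ⟨p, fun i => ?_⟩
      refine Fin.cases ?_ (fun c => ?_) i
      · rw [hp0]
        split_ifs <;> simp [sides]
      · rw [coords_foldPre_succ, hp2]
        exact cantorTail_const fun _ _ => rfl)
  -- Even if the sides are equally long, the height axis cannot go to a Cantor axis: the midpoint of
  -- the interval would land in a gap.
  have hπ0 : π 0 = 0 := by
    by_contra h0
    obtain ⟨c, hc⟩ := Fin.exists_succ_eq.2 h0
    obtain ⟨p, -, hp0⟩ := exists_coords_foldPre_zero S₁ (t := 1 / 2) (by norm_num) (by norm_num)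
      fun _ _ => false
    obtain ⟨hs, hv⟩ := hπ 0
    have h1 := hv p
    rw [hp0] at h1
    have h2 : sides D n (π 0) = pieceLength D n := by rw [← hc]; rfl
    have h3 : coords S₂ (q p) (π 0) = cantorTail D n ((q p).2 c) := by rw [← hc]; rfl
    have h4 : sides D n 0 = 1 / D.d n := rfl
    refine two_mul_cantorTail_ne (D := D) n ((q p).2 c) ?_
    rw [← h3, h1, ← h2, hs, h4]
    split_ifs <;> ring
  have hsucc : ∀ c : Fin D.k, ∃ c' : Fin D.k, c'.succ = π c.succ := fun c =>
    Fin.exists_succ_eq.2 fun h0 => (Fin.succ_ne_zero c) (π.injective (h0.trans hπ0.symm))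
  choose τ hτ using hsucc
  have hinj : Function.Injective τ := fun c c' hcc => by
    have : π c.succ = π c'.succ := by rw [← hτ, ← hτ, hcc]
    exact Fin.succ_injective _ (π.injective this)
  let τ' : Equiv.Perm (Fin D.k) := Equiv.ofBijective τ (Finite.injective_iff_bijective.1 hinj)
  -- A reflected Cantor axis has all digits from index n on switched, an unreflected one keeps them.
  have hdig : ∀ p c, ∀ l ≥ n, (q p).2 (τ' c) l = xor (ε c.succ) (p.2 c l) := by
    intro p c
    have h1 := (hπ c.succ).2 p
    rw [← hτ, coords_foldPre_succ] at h1
    have h2 : coords S₂ (q p) (τ c).succ = cantorTail D n ((q p).2 (τ' c)) := rfl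
    have h3 : sides D n c.succ = pieceLength D n := rfl
    rw [h2, h3] at h1
    cases hε : ε c.succ
    · rw [hε] at h1
      simpa using eq_of_cantorTail_eq h1
    · rw [hε, if_pos rfl, ← cantorTail_add_not n (p.2 c), add_sub_cancel_left] at h1
      simpa using eq_of_cantorTail_eq h1
  -- Reflecting the interval shifts the triangle wave by one. The permutation is inverted because
  -- `symFold` looks up the source coordinate of each target coordinate.
  refine ⟨if ε 0 then (S₁.1 : ℕ) - 1 else (S₁.1 : ℕ), τ'.symm, fun c _ => ε (τ'.symm c).succ,
    fun p => (hqΨ p).trans ?_⟩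
  congr 1
  refine Prod.ext (Subtype.ext ?_) ?_
  · have h1 := (hπ 0).2 p
    rw [hπ0, coords_foldPre_zero] at h1
    have h2 : coords S₂ (q p) 0 = ((q p).1 : ℝ) - (S₂.1 : ℕ) / D.d n := rfl
    have h3 : sides D n 0 = 1 / D.d n := rfl
    rw [h2, h3, sub_eq_iff_eq_add] at h1
    rw [h1]
    simp only [symFold]
    split_ifs
    · have : (D.d n : ℝ) * p.1 - (((S₁.1 : ℕ) - 1 : ℤ) : ℝ) = (D.d n * p.1 - (S₁.1 : ℕ)) + 1 := by
        push_cast; ring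
      rw [this, triangle_add_one]
      ring
    · rw [Int.cast_natCast]
      ring
  · funext c l
    obtain ⟨c, rfl⟩ := τ'.surjective c
    by_cases hl : l < n
    · simpa [symFold, overwrite, hl] using (hq p).2.2 (τ' c) ⟨l, hl⟩
    · simp [symFold, overwrite, hl, switchDigits, hdig p c l (not_lt.1 hl)]

/-- Since folding is the identity on the second cell, both unfoldings are the function `unfold S₂ f`
composed with a folding onto that cell, and `energy_folding` gives them the same energy. -/
theorem energyCell_comp {S₁ S₂ : D.Cell n}
    {Φ : EuclideanSpace ℝ (Fin (D.k + 1)) → EuclideanSpace ℝ (Fin (D.k + 1))}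
    {Ψ : carrier S₁ → carrier S₂} (hΦ : Isometry Φ) (h : IsInducedBy S₁ S₂ Φ Ψ)
    {f : carrier S₂ → ℝ} (hf : MemCell (slopeForm D) S₂ f) :
    MemCell (slopeForm D) S₁ (f ∘ Ψ) ∧
      energyCell (slopeForm D) S₁ (f ∘ Ψ) = energyCell (slopeForm D) S₂ f := by
  have hid : ∀ y : carrier S₂, fold S₂ (y : D.Space) = y := by
    rintro ⟨_, p, hp, rfl⟩
    exact Subtype.ext (fold_of_mem_block hp)
  obtain ⟨m, τ, z, hθ⟩ := h.exists_symFold hΦ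
  obtain ⟨hg, V, hV⟩ := Mem.exists_slope hf
  have e₁ : unfold S₁ (f ∘ Ψ) = unfold S₂ f ∘ fun x => (Ψ (fold S₁ x) : D.Space) := by
    funext x
    simp only [unfold, Function.comp, hid]
  have e₂ : unfold S₂ f = unfold S₂ f ∘ fun x => (fold S₂ x : D.Space) := by
    funext x
    simp only [unfold, Function.comp, hid]
  obtain ⟨h1, h2⟩ := energy_folding (θ := fun x => (Ψ (fold S₁ x) : D.Space)) hθ hg hV
  obtain ⟨-, h3⟩ := energy_folding (θ := fun x => (fold S₂ x : D.Space)) (fold_wormholeMap S₂) hg hV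
  rw [← e₁] at h1 h2
  rw [← e₂] at h3
  refine ⟨h1, ?_⟩
  unfold energyCell
  rw [(ENNReal.ofReal_eq_ofReal_iff (energy_nonneg _ _) (energy_nonneg _ _)).1 (h2.trans h3.symm)]

theorem isInvariant_slopeForm : IsInvariant (slopeForm D) where
  unfold_restr _ S _ hf := memCell_restr S hf
  isometry _ _ _ _ _ hΦ h _ _ hf := energyCell_comp hΦ h hf
  energy_sum n _ hf := energy_eq_sum n hf

end LaaksoData

theorem mainTheorem6 (D : LaaksoData) :
    (∃ E : DirichletForm D.μ, D.IsMGUGForm E ∧ E ∈ D.invariantForms) ∧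
    (∀ (f : D.Space → ℝ) (p : D.Space → ℝ≥0∞), Continuous f → D.IsMinimalUpperGradient f p →
      ∫⁻ x, p x ^ 2 ∂D.μ ≠ ∞ → ∀ u : Lp ℝ 2 D.μ, u =ᵐ[D.μ] f → D.IsMGUG u p) :=
  ⟨⟨LaaksoData.slopeForm D, LaaksoData.isMGUGForm_slopeForm, LaaksoData.isInvariant_slopeForm,
    LaaksoData.isNonzero_slopeForm, LaaksoData.isLocal_slopeForm, LaaksoData.isRegular_slopeForm,
    LaaksoData.isConservative_slopeForm⟩,
    fun _ _ hf h hp2 _ hu => h.isMGUG hf hp2 hu⟩
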